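/- **Tile assembly.** Let $U_2=\{(0,\pm1),(\pm1,0)\}$. A tile type over a finite alphabet $\Sigma$ is a function $t:U_2\to\Sigma^*\times\mathbb N$ giving each side a glue (a color and a strength). Given a set $T$ of tile types, a configuration is a partial function $\alpha:\mathbb Z^2\rightharpoonup T$; tiles at adjacent points bind if their abutting sides carry the same glue, with the strength of that glue (and with strength $0$ otherwise). The configuration $\alpha$ is $\tau$-stable if for every partition of $\operatorname{dom}\alpha$ into two nonempty parts the binding strengths between the two parts sum to at least $\tau$. A tile assembly system (TAS) is a triple $\mathcal T=(T,\sigma,\tau)$ with $T$ a finite set of tile types, $\sigma$ a $\tau$-stable seed configuration with finite domain, and $\tau\in\mathbb N$ the temperature. It produces the results of all finite or infinite sequences of $\tau$-stable configurations that start with $\sigma$ and in which each configuration extends the previous one by a single tile. A produced configuration $\alpha$ is terminal if no tile of a type in $T$ can be placed at a point outside $\operatorname{dom}\alpha$ so that it binds to $\alpha$ with total strength at least $\tau$. $\mathcal T$ is directed if it has exactly one terminal produced configuration, and a set strictly self-assembles in $\mathcal T$ if it is the domain of every terminal produced configuration. **Nice fractals.** Let $c>1$ be an integer and $V\subseteq\{0,\dots,c-1\}^2$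 with $V\neq\{(i,i)\mid 0\le i<c\}$. Put $X_0=\{(0,0)\}$, $X_{i+1}=X_i\cup(X_i+c^iV)$ and $X=\bigcup_{i\ge0}X_i$, and suppose that $X\subsetneq\mathbb N^2$. Then $X$ is the $c$-discrete self-similar fractal generated by $V$. It is *nice* if $(\{0,\dots,c-1\}\times\{0\})\cup(\{0\}\times\{0,\dots,c-1\})\subseteq V$ and the graph on $V$ that joins points at distance $1$ is connected. **Fibered version.** Given $c$ and $V$ as above, define recursively $l(0)=c^2+1$, $l(i+1)=c\,l(i)+1$, $$F_0=\big(\{-1\}\times\{-1,\dots,c^2-1\}\big)\cup\big(\{-1,\dots,c^2-1\}\times\{-1\}\big),$$ $$F_{i+1}=F_i\cup\big(\{-i-2\}\times\{-i-2,\dots,l(i+1)-i-3\}\big)\cup\big(\{-i-2,\dots,l(i+1)-i-3\}\times\{-i-2\}\big),$$ $$T_0=X_2,\qquad T_{i+1}=T_i\cup\big((T_i\cup F_i)+l(i)\,(V\setminus\{(0,0)\})\big),$$ and let $\mathbf X=\bigcup_{i\ge0}T_i\subseteq\mathbb Z^2$. **Theorem.** For every nice discrete self-similar fractal $X\subsetneq\mathbb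 N^2$ ($c$-discrete and generated by $V$), there is a directed TAS of temperature $2$, whose seed is a single tile placed at the origin, in which the fibered version $\mathbf X$ strictly self-assembles. -/

import Mathlib

namespace SelfAssembly

/-! ### The Tile Assembly Model -/

/-- The four directions (names of the unit vectors of `ℤ²`). -/
inductive Dir where
  | north | east | south | west
  deriving DecidableEq

instance : Fintype Dir := ⟨{.north, .east, .south, .west}, by intro u; cases u <;> decide⟩

/-- The unit vector named by a direction. -/
def Dir.vec : Dir → ℤ × ℤ
  | .north => (0, 1)
  | .east => (1, 0)
  | .south => (0, -1)
  | .west => (-1, 0)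

/-- The direction whose unit vector is `-u`. -/
def Dir.opp : Dir → Dir
  | .north => .south
  | .east => .west
  | .south => .north
  | .west => .east

theorem Dir.vec_opp (u : Dir) : u.opp.vec = -u.vec := by
  cases u <;> rfl

/-- The directions name exactly the vectors of length `1`. -/
theorem Dir.exists_vec_eq_iff (p : ℤ × ℤ) :
    (∃ u : Dir, u.vec = p) ↔ p.1 ^ 2 + p.2 ^ 2 = 1 := by
  obtain ⟨a, b⟩ := p
  constructor
  · rintro ⟨u, hu⟩
    cases u <;> simp only [Dir.vec, Prod.mk.injEq] at hu <;> obtain ⟨rfl, rfl⟩ := hu <;> norm_num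
  · intro h
    simp only at h
    have ha : -1 ≤ a ∧ a ≤ 1 := ⟨by nlinarith, by nlinarith⟩
    have hb : -1 ≤ b ∧ b ≤ 1 := ⟨by nlinarith, by nlinarith⟩
    obtain ⟨ha1, ha2⟩ := ha
    obtain ⟨hb1, hb2⟩ := hb
    interval_cases a <;> interval_cases b <;> norm_num at h
    · exact ⟨.west, rfl⟩
    · exact ⟨.south, rfl⟩
    · exact ⟨.north, rfl⟩
    · exact ⟨.east, rfl⟩

/-- A tile type over the alphabet `A` assigns to each side a glue: a color (a string over `A`) and
a strength. -/
abbrev TileType (A : Type) := Dir → List A × ℕ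

/-- The color of the side `u` of `t`. -/
def TileType.col {A : Type} (t : TileType A) (u : Dir) : List A := (t u).1

/-- The strength of the side `u` of `t`. -/
def TileType.str {A : Type} (t : TileType A) (u : Dir) : ℕ := (t u).2

/-- A `T`-configuration: a partial function from `ℤ²` to `T`. -/
abbrev Config {A : Type} (T : Set (TileType A)) := ℤ × ℤ → Option T

/-- The domain of a configuration. -/
def Config.dom {A : Type} {T : Set (TileType A)} (α : Config T) : Set (ℤ × ℤ) :=
  {m | ∃ t, α m = some t}

/-- `α ⊑ α'`: `α` is a subconfiguration of `α'`. -/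
def Config.Sub {A : Type} {T : Set (TileType A)} (α α' : Config T) : Prop :=
  ∀ m t, α m = some t → α' m = some t

open Classical in
/-- The strength with which a tile of type `t` placed at `m` binds to the tile of `α` at `m + u`:
the strength of its side `u` if there is a tile at `m + u` whose abutting side carries the same
glue (same color and same strength), and `0` otherwise. -/
noncomputable def Config.bindAt {A : Type} {T : Set (TileType A)} (α : Config T)
    (m : ℤ × ℤ) (t : TileType A) (u : Dir) : ℕ :=
  if ∃ t' : T, α (m + u.vec) = some t' ∧ (t' : TileType A) u.opp = t u then t.str u else 0

/-- The strength with which the tiles of `α` at `m` and at `m + u` are bound to each other, i.e.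
the weight of the pair `{m, m + u}` in the binding graph of `α` (`0` if it is not an edge). -/
noncomputable def Config.bind {A : Type} {T : Set (TileType A)} (α : Config T)
    (m : ℤ × ℤ) (u : Dir) : ℕ :=
  match α m with
  | some t => α.bindAt m t u
  | none => 0

/-- `α` is `τ`-stable: for every cut `(C₀, C₁)` of its binding graph into two nonempty parts, the
total strength of the edges between `C₀` and `C₁` is at least `τ`. An edge across the cut is given
by its endpoint `m ∈ C₀` and the direction leading to its endpoint in `C₁`. There may be infinitely
many such edges; as strengths are natural numbers, their sum in `ℕ ∪ {∞}` is at least `τ` exactly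
if some finite partial sum is. -/
def Config.Stable {A : Type} {T : Set (TileType A)} (τ : ℕ) (α : Config T) : Prop :=
  ∀ C₀ C₁ : Set (ℤ × ℤ), C₀ ∪ C₁ = α.dom → Disjoint C₀ C₁ → C₀.Nonempty → C₁.Nonempty →
    ∃ E : Finset ((ℤ × ℤ) × Dir), (∀ e ∈ E, e.1 ∈ C₀ ∧ e.1 + e.2.vec ∈ C₁) ∧
      τ ≤ ∑ e ∈ E, α.bind e.1 e.2

/-- The `τ`-`t`-frontier of `α`: the empty positions to which a tile of type `t` can be
`τ`-stably added. -/
def Config.frontierOf {A : Type} {T : Set (TileType A)} (τ : ℕ) (α : Config T) (t : TileType A) :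
    Set (ℤ × ℤ) :=
  {m | m ∉ α.dom ∧ τ ≤ ∑ u : Dir, α.bindAt m t u}

/-- The `τ`-frontier of `α`. -/
def Config.frontier {A : Type} {T : Set (TileType A)} (τ : ℕ) (α : Config T) : Set (ℤ × ℤ) :=
  ⋃ t ∈ T, α.frontierOf τ t

/-- `α'` is a single-tile extension of `α`. -/
def Config.SingleTileExt {A : Type} {T : Set (TileType A)} (α α' : Config T) : Prop :=
  α.Sub α' ∧ ∃ m, α'.dom \ α.dom = {m}

/-- `(a i | 0 ≤ i < k)`, with `1 ≤ k ≤ ∞`, is a `τ`-`T`-assembly sequence. -/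
def IsAssemblySeq {A : Type} {T : Set (TileType A)} (τ : ℕ) (k : ℕ∞) (a : ℕ → Config T) : Prop :=
  0 < k ∧ (∀ i : ℕ, (i : ℕ∞) < k → (a i).Stable τ) ∧
    ∀ i : ℕ, ((i + 1 : ℕ) : ℕ∞) < k → (a i).SingleTileExt (a (i + 1))

/-- `α` is the result of the sequence `(a i | 0 ≤ i < k)`. -/
def IsResult {A : Type} {T : Set (TileType A)} (k : ℕ∞) (a : ℕ → Config T) (α : Config T) : Prop :=
  α.dom = {m | ∃ i : ℕ, (i : ℕ∞) < k ∧ m ∈ (a i).dom} ∧ ∀ i : ℕ, (i : ℕ∞) < k → (a i).Sub α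

/-- There is a `τ`-`T`-assembly sequence from `α` to `α'`. -/
def Produces {A : Type} {T : Set (TileType A)} (τ : ℕ) (α α' : Config T) : Prop :=
  ∃ (k : ℕ∞) (a : ℕ → Config T), IsAssemblySeq τ k a ∧ a 0 = α ∧ IsResult k a α'

/-- A generalized tile assembly system `(T, σ, τ)` over the alphabet `A`. -/
structure GTAS (A : Type) where
  /-- the set of tile types -/
  tiles : Set (TileType A)
  /-- the seed assembly -/
  seed : Config tiles
  /-- the temperature -/
  temp : ℕ
  seed_stable : seed.Stable temp

/-- A tile assembly system: finitely many tile types and a finite seed. -/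
def GTAS.IsTAS {A : Type} (𝒯 : GTAS A) : Prop :=
  𝒯.tiles.Finite ∧ 𝒯.seed.dom.Finite

/-- The assemblies produced by `𝒯`. -/
def GTAS.produced {A : Type} (𝒯 : GTAS A) : Set (Config 𝒯.tiles) :=
  {α | α.Stable 𝒯.temp ∧ Produces 𝒯.temp 𝒯.seed α}

/-- The terminal assemblies produced by `𝒯`. -/
def GTAS.terminal {A : Type} (𝒯 : GTAS A) : Set (Config 𝒯.tiles) :=
  {α | α ∈ 𝒯.produced ∧ α.frontier 𝒯.temp = ∅}

/-- `𝒯` is directed: it has exactly one terminal assembly. -/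
def GTAS.Directed {A : Type} (𝒯 : GTAS A) : Prop :=
  𝒯.terminal.encard = 1

/-- The set `X` strictly self-assembles in `𝒯`. -/
def GTAS.StrictlyAssembles {A : Type} (𝒯 : GTAS A) (X : Set (ℤ × ℤ)) : Prop :=
  ∀ α ∈ 𝒯.terminal, α.dom = X

/-! ### Discrete self-similar fractals -/

/-- The first quadrant `ℕ²`, as a subset of `ℤ²`. -/
def quadrant : Set (ℤ × ℤ) := {p | 0 ≤ p.1 ∧ 0 ≤ p.2}

/-- The full grid graph on a set of points. -/
def fullGridGraph (S : Set (ℤ × ℤ)) : SimpleGraph S where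
  Adj p q := ∃ u : Dir, (q : ℤ × ℤ) = p + u.vec
  symm := ⟨by
    rintro p q ⟨u, hu⟩
    exact ⟨u.opp, by rw [Dir.vec_opp, hu, add_neg_cancel_right]⟩⟩
  loopless := ⟨by
    rintro p ⟨u, hu⟩
    have h : u.vec = 0 := left_eq_add.mp hu
    cases u <;> simp [Dir.vec] at h⟩

/-- The stages `X₀ = {(0,0)}`, `X_{i+1} = X_i ∪ (X_i + c^i V)`. -/
def stage (c : ℕ) (V : Set (ℤ × ℤ)) : ℕ → Set (ℤ × ℤ)
  | 0 => {(0, 0)}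
  | i + 1 => stage c V i ∪ {p | ∃ q ∈ stage c V i, ∃ v ∈ V, p = q + (c : ℤ) ^ i • v}

/-- `X` is a `c`-discrete self-similar fractal generated by `V`. -/
structure IsFractal (c : ℕ) (V X : Set (ℤ × ℤ)) : Prop where
  one_lt : 1 < c
  ssubset_quadrant : X ⊂ quadrant
  subset_square : V ⊆ Set.Icc (0 : ℤ) (c - 1) ×ˢ Set.Icc (0 : ℤ) (c - 1)
  ne_diagonal : V ≠ {p | ∃ i ∈ Set.Icc (0 : ℤ) (c - 1), p = (i, i)}
  eq_iUnion : X = ⋃ i, stage c V i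

/-- `X` is a nice `c`-discrete self-similar fractal generated by `V`. -/
structure IsNiceFractal (c : ℕ) (V X : Set (ℤ × ℤ)) : Prop extends IsFractal c V X where
  axes_subset : Set.Icc (0 : ℤ) (c - 1) ×ˢ {0} ∪ {0} ×ˢ Set.Icc (0 : ℤ) (c - 1) ⊆ V
  connected : (fullGridGraph V).Connected

/-! ### The fibered version -/

/-- The edge length `l(i)` of `T_i ∪ F_i`: `l(0) = c² + 1`, `l(i+1) = c l(i) + 1`. -/
def edgeLength (c : ℕ) : ℕ → ℤ
  | 0 => c ^ 2 + 1
  | i + 1 => c * edgeLength c i + 1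

/-- The fibers `F_i`: `F₀` is one layer of length `l(0)` along the left and the bottom of the square
`{0, …, c² - 1}²`, and `F_{i+1}` adds to `F_i` one further layer, of length `l(i+1)`. -/
def fiber (c : ℕ) : ℕ → Set (ℤ × ℤ)
  | 0 => {-1} ×ˢ Set.Icc (-1 : ℤ) (c ^ 2 - 1) ∪ Set.Icc (-1 : ℤ) (c ^ 2 - 1) ×ˢ {-1}
  | i + 1 => fiber c i ∪
      ({-(i : ℤ) - 2} ×ˢ Set.Icc (-(i : ℤ) - 2) (edgeLength c (i + 1) - i - 3) ∪
        Set.Icc (-(i : ℤ) - 2) (edgeLength c (i + 1) - i - 3) ×ˢ {-(i : ℤ) - 2})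

/-- The stages of the fibered version: `T₀ = X₂`, `T_{i+1} = T_i ∪ ((T_i ∪ F_i) + l(i) (V ∖ {0}))`.
The copy of `T_i` at the origin gets no fiber. -/
def fiberedStage (c : ℕ) (V : Set (ℤ × ℤ)) : ℕ → Set (ℤ × ℤ)
  | 0 => stage c V 2
  | i + 1 => fiberedStage c V i ∪
      {p | ∃ q ∈ fiberedStage c V i ∪ fiber c i, ∃ v ∈ V \ {(0, 0)}, p = q + edgeLength c i • v}

/-- The fibered version of the fractal generated by `V`. -/
def fibered (c : ℕ) (V : Set (ℤ × ℤ)) : Set (ℤ × ℤ) := ⋃ i, fiberedStage c V i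

end SelfAssembly

/-!
The fibered version is a union of nested square *blocks*. The block of level `k` is a stage `T_k`
of the fibered version together with its fibers `F_k`, so that its outermost layer consists of a
vertical arm on the left and a horizontal arm at the bottom, which meet in a corner. Inside these
arms it is a `c × c` array of blocks of level `k - 1` at the points of `V`, and a block of level `0`
contains a copy of the second stage (`block_ne_none_iff`). Only the blocks that touch the origin of
the fractal have no arms. The difficulty is that finitely many tile types have to build arms of
unbounded lengths `l(k)`.

The idea is that an arm copies its length from what it surrounds. A tile of the arm of a block of
level `k` is attached to the previous tile of the arm and, at the same time, to the outer arm of the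
subblock next to it, each with strength `1`. The tile of the subblock tells the kind of its row: the
last row (`top`), where the counter of subblocks is increased or the arm ends, the rows `0, …, k`,
which contain the ends of the bottom arms of the blocks nested in the corner (`cross`), or any other
row (`mid`). The kind of a row is determined by the kind of that row in the subblock and the number
of the subblock (`Scheme.Proper.rowKind_step`), so that a bounded amount of information is enough.
Blocks start each other along a spanning tree of `V`: upwards and to the right, the end of an arm
attracts, with strength `2`, the corner of the next block; downwards and to the left, the tiles in
the `cross` rows or columns start the arms of the next block from their far ends.

A block knows its position in its parent, whether this parent lies at the origin, and the side from
which it is started (`Ctx`). If it is started from the left, say, then the arms of the blocks nested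
in its lower left corner have not been built when the lowest tiles of its left arm are placed. In
these rows the arm therefore cooperates with the bottom arms that end at the neighboring block on
its left, one for each level; this is what the rows `cross` and the tiles `Xing.first`,
`Xing.later` are for. A block to the right of the block at the origin has a neighbor without arms of
its own level, so that the first tile of its arm is attached before its corner (`rfirst`).

Two facts about a block suffice: the sides of adjacent tiles fit together (`Scheme.Proper.compat_east`,
`Scheme.Proper.compat_north`), and the tiles can be placed in some order (`Scheme.Proper.grows`).
Both are proved by induction on the level; reflection in the diagonal (`Scheme.swap`) halves the number of cases. It
is then a general fact about the model (`Blueprint.exists_system`) that the tile assembly system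
whose glues record these sides is directed and builds exactly this set, since a glue that
determines the kind of the tile attached through it is presented only where this tile belongs.
-/

namespace SelfAssembly

/-! ### Transposition -/

/-- The direction obtained by exchanging the two coordinates. -/
def Dir.swap : Dir → Dir
  | .north => .east
  | .east => .north
  | .south => .west
  | .west => .south

@[simp] theorem Dir.swap_north : Dir.north.swap = .east := rfl
@[simp] theorem Dir.swap_east : Dir.east.swap = .north := rfl
@[simp] theorem Dir.swap_south : Dir.south.swap = .west := rfl
@[simp] theorem Dir.swap_west : Dir.west.swap = .south := rfl
@[simp] theorem Dir.swap_swap (u : Dir) : u.swap.swap = u := by cases u <;> rfl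
@[simp] theorem Dir.opp_opp (u : Dir) : u.opp.opp = u := by cases u <;> rfl
theorem Dir.vec_swap (u : Dir) : u.swap.vec = u.vec.swap := by cases u <;> rfl
theorem Dir.opp_swap (u : Dir) : u.swap.opp = u.opp.swap := by cases u <;> rfl
theorem Dir.swap_eq_iff {u v : Dir} : u.swap = v ↔ u = v.swap :=
  ⟨fun h => by rw [← h, swap_swap], fun h => by rw [h, swap_swap]⟩

/-- The data that govern the growth: the scaling factor `c`, the generator `V` with a spanning tree
(`par v` is the direction from `v` to its parent), and a finite pattern `Q` inside the square
`{0, …, n - 1}²` with a spanning tree `qpar`. If `pax` holds, a copy of the pattern is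
attached to the arm on its left, otherwise to the arm below it. -/
structure Scheme where
  c : ℤ
  n : ℤ
  V : Set (ℤ × ℤ)
  par : ℤ × ℤ → Dir
  Q : Set (ℤ × ℤ)
  qpar : ℤ × ℤ → Dir
  pax : Bool

/-- The transposed scheme. -/
def Scheme.swap (G : Scheme) : Scheme where
  c := G.c
  n := G.n
  V := {p | p.swap ∈ G.V}
  par p := (G.par p.swap).swap
  Q := {p | p.swap ∈ G.Q}
  qpar p := (G.qpar p.swap).swap
  pax := !G.pax

@[simp] theorem Scheme.swap_swap (G : Scheme) : G.swap.swap = G := by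
  simp [Scheme.swap]

@[simp] theorem Scheme.swap_c (G : Scheme) : G.swap.c = G.c := rfl
@[simp] theorem Scheme.swap_n (G : Scheme) : G.swap.n = G.n := rfl
@[simp] theorem Scheme.swap_pax (G : Scheme) : G.swap.pax = !G.pax := rfl
@[simp] theorem Scheme.mem_swap_V (G : Scheme) (p : ℤ × ℤ) : p ∈ G.swap.V ↔ p.swap ∈ G.V := Iff.rfl
@[simp] theorem Scheme.mem_swap_Q (G : Scheme) (p : ℤ × ℤ) : p ∈ G.swap.Q ↔ p.swap ∈ G.Q := Iff.rfl
@[simp] theorem Scheme.swap_par (G : Scheme) (p : ℤ × ℤ) :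
    G.swap.par p = (G.par p.swap).swap := rfl
@[simp] theorem Scheme.swap_qpar (G : Scheme) (p : ℤ × ℤ) :
    G.swap.qpar p = (G.qpar p.swap).swap := rfl

/-- The side length of a block of level `k`. -/
def Scheme.len (G : Scheme) : ℕ → ℤ
  | 0 => G.n + 1
  | k + 1 => G.c * G.len k + 1

@[simp] theorem Scheme.swap_len (G : Scheme) (k : ℕ) : G.swap.len k = G.len k := by
  induction k with
  | zero => rfl
  | succ k ih => simp [Scheme.len, ih]

/-- The conditions on a scheme: the square, the axes and the two spanning trees are as described,
where the tree on `V` is only used for points off the axes. -/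
structure Scheme.Proper (G : Scheme) : Prop where
  two_le_c : 2 ≤ G.c
  two_le_n : 2 ≤ G.n
  V_bounds : ∀ a b, (a, b) ∈ G.V → 0 ≤ a ∧ a < G.c ∧ 0 ≤ b ∧ b < G.c
  row_mem : ∀ a, 0 ≤ a → a < G.c → (a, 0) ∈ G.V
  col_mem : ∀ b, 0 ≤ b → b < G.c → (0, b) ∈ G.V
  tree : ∃ rk : ℤ × ℤ → ℕ, ∀ w ∈ G.V, w.1 ≠ 0 → w.2 ≠ 0 →
    w + (G.par w).vec ∈ G.V ∧ rk (w + (G.par w).vec) < rk w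
  Q_bounds : ∀ a b, (a, b) ∈ G.Q → 0 ≤ a ∧ a < G.n ∧ 0 ≤ b ∧ b < G.n
  Q_zero : (0, 0) ∈ G.Q
  Q_right : (G.n - 1, 0) ∈ G.Q
  Q_top : (0, G.n - 1) ∈ G.Q
  Q_tree : ∃ rk : ℤ × ℤ → ℕ, ∀ q ∈ G.Q, q ≠ (0, 0) →
    q + (G.qpar q).vec ∈ G.Q ∧ rk (q + (G.qpar q).vec) < rk q

theorem add_vec_swap (q : ℤ × ℤ) (u : Dir) : q.swap + u.swap.vec = (q + u.vec).swap := by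
  rw [Dir.vec_swap]; rfl

@[simp] theorem Prod.swap_eq_mk {α : Type*} (p : α × α) (a b : α) :
    p.swap = (a, b) ↔ p = (b, a) := by
  obtain ⟨x, y⟩ := p
  simp [and_comm]

theorem Scheme.Proper.swap {G : Scheme} (hG : G.Proper) : G.swap.Proper where
  two_le_c := hG.two_le_c
  two_le_n := hG.two_le_n
  V_bounds a b h := by have := hG.V_bounds b a h; simp only [swap_c]; tauto
  row_mem a h h' := hG.col_mem a h h'
  col_mem a h h' := hG.row_mem a h h'
  tree := by
    obtain ⟨rk, h⟩ := hG.tree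
    refine ⟨fun w => rk w.swap, fun w hw h1 h2 => ?_⟩
    have := h w.swap hw h2 h1
    have e : w + (G.swap.par w).vec = (w.swap + (G.par w.swap).vec).swap := by
      rw [← add_vec_swap, Prod.swap_swap]; rfl
    rw [e, mem_swap_V, Prod.swap_swap]
    exact this
  Q_bounds a b h := by have := hG.Q_bounds b a h; simp only [swap_n]; tauto
  Q_zero := hG.Q_zero
  Q_right := hG.Q_top
  Q_top := hG.Q_right
  Q_tree := by
    obtain ⟨rk, h⟩ := hG.Q_tree
    refine ⟨fun w => rk w.swap, fun w hw h1 => ?_⟩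
    have := h w.swap hw (by simpa using h1)
    have e : w + (G.swap.qpar w).vec = (w.swap + (G.qpar w.swap).vec).swap := by
      rw [← add_vec_swap, Prod.swap_swap]; rfl
    rw [e, mem_swap_Q, Prod.swap_swap]
    exact this

theorem Scheme.Proper.add_three_le_len {G : Scheme} (hG : G.Proper) (k : ℕ) : k + 3 ≤ G.len k := by
  have hc := hG.two_le_c
  have hn := hG.two_le_n
  induction k with
  | zero => simp only [Scheme.len]; omega
  | succ k ih => simp only [Scheme.len]; push_cast; nlinarith

/-! ### Tile kinds and their faces -/

/-- What a block knows about its place: whether its parent is one of the blocks at the origin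
(which carry no fibers), its position `w` in the parent, and the direction `m` from which its
growth is started. -/
@[ext] structure Ctx where
  root : Bool
  w : ℤ × ℤ
  m : Dir
  deriving DecidableEq, Countable

/-- The transposed context. -/
def Ctx.swap (γ : Ctx) : Ctx := ⟨γ.root, γ.w.swap, γ.m.swap⟩

@[simp] theorem Ctx.swap_swap (γ : Ctx) : γ.swap.swap = γ := by simp [Ctx.swap]
@[simp] theorem Ctx.swap_root (γ : Ctx) : γ.swap.root = γ.root := rfl
@[simp] theorem Ctx.swap_w (γ : Ctx) : γ.swap.w = γ.w.swap := rfl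
@[simp] theorem Ctx.swap_m (γ : Ctx) : γ.swap.m = γ.m.swap := rfl
@[simp] theorem Ctx.swap_mk (r w m) : Ctx.swap ⟨r, w, m⟩ = ⟨r, w.swap, m.swap⟩ := rfl

/-- The kind of a row of a block of level `k`: `cross` for the rows `0, …, k`, which contain the
bottom arms of the nested blocks at the lower left corner (`bot` marks the row `0` and `zero` the
row `k`, whose arm has level `0`), `top` for the last row, and `mid` for all others. -/
inductive RowKind
  | cross (bot zero : Bool)
  | mid
  | top
  deriving DecidableEq, Fintype, Countable

/-- Whether a tile of an arm cooperates with its outer neighbor (`first`, `later`) or with its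
inner neighbor (`no`); `first` marks the tile next to the corner. -/
inductive Xing
  | no | first | later
  deriving DecidableEq

instance : Fintype Xing := ⟨{.no, .first, .later}, by intro x; cases x <;> decide⟩

/-- The kinds of tiles. An arm is vertical if `ax` is `true`, and horizontal otherwise. -/
inductive Kind
  /-- a point of the pattern `Q` -/
  | pat (root : Bool) (q : ℤ × ℤ)
  /-- the corner of a block, which has level `0` if `zero` holds -/
  | corner (γ : Ctx) (zero : Bool)
  /-- the tile number `z` of an arm of a block of level `0` -/
  | arm0 (ax : Bool) (γ : Ctx) (z : ℤ)
  /-- the first tile of the arm through which the growth of a block next to a block at the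
  origin is started, where that block has level `1` if `zero` holds -/
  | rfirst (ax : Bool) (γ : Ctx) (zero : Bool)
  /-- a tile of an arm of a block of positive level next to the subblock number `d`, where `K`
  describes its row (or column) in that subblock -/
  | arm (ax : Bool) (γ : Ctx) (d : ℤ) (x : Xing) (K : RowKind)
  deriving DecidableEq, Countable

/-- The transposed kind. -/
def Kind.swap : Kind → Kind
  | .pat r q => .pat r q.swap
  | .corner γ z => .corner γ.swap z
  | .arm0 ax γ z => .arm0 (!ax) γ.swap z
  | .rfirst ax γ z => .rfirst (!ax) γ.swap z
  | .arm ax γ d x K => .arm (!ax) γ.swap d x K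

@[simp] theorem Kind.swap_swap (k : Kind) : k.swap.swap = k := by
  cases k <;> simp [Kind.swap]

theorem Kind.swap_corner (γ : Ctx) (z : Bool) : (corner γ z).swap = corner γ.swap z := rfl

/-- The labels of glues. The label `single k` has strength `2` and names the kind of the tile that
it attracts; `coop` has strength `1` and names this kind up to the row kind, which is supplied by
a second glue of strength `1` with label `row`. -/
inductive Label
  | single (k : Kind)
  | coop (ax : Bool) (γ : Ctx) (d : ℤ) (x : Xing)
  | row (K : RowKind)
  deriving DecidableEq, Countable

/-- The transposed label. -/
def Label.swap : Label → Label
  | .single k => .single k.swap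
  | .coop ax γ d x => .coop (!ax) γ.swap d x
  | .row K => .row K

@[simp] theorem Label.swap_swap (L : Label) : L.swap.swap = L := by
  cases L <;> simp [Label.swap]

/-- A side of a tile has no glue, or a glue through which the tile is attached (`inn`), or a glue
through which it may attract its neighbor (`out`). -/
inductive Face (Λ : Type)
  | idle
  | inn (L : Λ)
  | out (L : Λ)
  deriving DecidableEq

/-- The transposed face. -/
def Face.swap : Face Label → Face Label
  | .idle => .idle
  | .inn L => .inn L.swap
  | .out L => .out L.swap

@[simp] theorem Face.swap_swap (f : Face Label) : f.swap.swap = f := by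
  cases f <;> simp [Face.swap]

/-- The context of the block at the right of a block at the origin. -/
abbrev rctx : Ctx := ⟨true, (1, 0), .west⟩

/-- Whether `γ` is the context `rctx`. -/
def Ctx.isR (γ : Ctx) : Bool := decide (γ = rctx)

/-- The row kind in a block of level `k + 1`, for a row with row kind `K` in the subblocks with
second coordinate `d`. -/
def Scheme.step (G : Scheme) (d : ℤ) : RowKind → RowKind
  | .cross _ zero => if d = 0 then .cross false zero else .mid
  | .mid => .mid
  | .top => if d = G.c - 1 then .top else .mid

/-- The row kind in the subblock, for an arm tile with the data `x` and `K`. -/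
def effRow : Xing → RowKind → RowKind
  | .first, .cross _ zero => .cross true zero
  | _, K => K

/-- The context of the subblock at `w`. For the context `none` of a block at the origin, this is
again such a block if `w = 0`. -/
def Scheme.sub (G : Scheme) (B : Option Ctx) (w : ℤ × ℤ) : Option Ctx :=
  match B with
  | none =>
    if w = (0, 0) then none
    else if w.2 = 0 then some ⟨true, w, .west⟩
    else if w.1 = 0 then some ⟨true, w, .south⟩
    else some ⟨true, w, G.par w⟩
  | some γ =>
    if w = (0, 0) then some ⟨false, w, γ.m⟩
    else if w.2 = 0 then some ⟨false, w, if γ.m = .east then .east else .west⟩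
    else if w.1 = 0 then some ⟨false, w, if γ.m = .north then .north else .south⟩
    else some ⟨false, w, G.par w⟩

open Classical in
/-- The context of the left neighbor, if the growth of that block is started from this one. -/
noncomputable def Scheme.childW (G : Scheme) (γ : Ctx) : Option Ctx :=
  if (γ.w.2 = 0 ∧ γ.m = .east ∧ 1 ≤ γ.w.1) ∨
      (1 ≤ γ.w.2 ∧ 2 ≤ γ.w.1 ∧ (γ.w.1 - 1, γ.w.2) ∈ G.V ∧ G.par (γ.w.1 - 1, γ.w.2) = .east) then
    some ⟨γ.root, (γ.w.1 - 1, γ.w.2), .east⟩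
  else none

open Classical in
/-- The context of the upper neighbor, if the growth of that block is started from this one. -/
noncomputable def Scheme.childN (G : Scheme) (γ : Ctx) : Option Ctx :=
  if (γ.w.1 = 0 ∧ γ.w.2 < G.c - 1) ∨
      (1 ≤ γ.w.1 ∧ (γ.w.1, γ.w.2 + 1) ∈ G.V ∧ G.par (γ.w.1, γ.w.2 + 1) = .south) then
    some ⟨γ.root, (γ.w.1, γ.w.2 + 1), .south⟩
  else none

/-- The label that starts the leftward growth of a bottom arm. -/
def Scheme.initE (G : Scheme) (γ : Ctx) (zero : Bool) : Label :=
  if zero then .single (.arm0 false γ G.n) else .coop false γ (G.c - 1) .no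

/-- The left face of the left arm in a row with row kind `K`, unless it is attached there. -/
noncomputable def Scheme.westFace (G : Scheme) (γ : Ctx) : RowKind → Face Label
  | .cross bot zero =>
    match G.childW γ with
    | some γ' => .out (G.initE (if bot then γ' else ⟨false, (G.c - 1, 0), .east⟩) zero)
    | none => .out (.row (.cross bot zero))
  | K => .out (.row K)

/-- The upper face of the last tile of the left arm of a block that is not started from above. -/
noncomputable def Scheme.endFace (G : Scheme) (γ : Ctx) (zero : Bool) : Face Label :=
  if γ.w = (0, G.c - 1) then
    if γ.root then .out (.single (.rfirst false rctx.swap zero))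
    else .out (.row (.cross false zero))
  else
    match G.childN γ with
    | some γ' => .out (.single (.corner γ' zero))
    | none => .idle

/-- The `Xing` of the arm tile above one with row kind `K`. -/
def nextXing (x : Xing) (K : RowKind) : Xing :=
  if x = .no then .no else match K with | .cross _ false => .later | _ => .no

/-- The upper face of a tile of a left arm of positive level. -/
noncomputable def Scheme.armNorth (G : Scheme) (γ : Ctx) (d : ℤ) (x : Xing) (K : RowKind) :
    Face Label :=
  if γ.m = .north then .inn (.coop true γ d x)
  else if K = .top then
    if d = G.c - 1 then G.endFace γ false else .out (.coop true γ (d + 1) .no)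
  else .out (.coop true γ d (nextXing x K))

/-- The lower face of a tile of a left arm of positive level. -/
def Scheme.armSouth (_ : Scheme) (γ : Ctx) (d : ℤ) (x : Xing) (K : RowKind) : Face Label :=
  if γ.m = .north then
    match K with
    | .cross true _ =>
      if d = 0 then .out (.single (.corner γ false)) else .out (.coop true γ (d - 1) .no)
    | _ => .out (.coop true γ d .no)
  else .inn (.coop true γ d x)

/-- The right face of a tile of a left arm of positive level in a row that is attached from the
left. -/
def Scheme.crossEast (_ : Scheme) (γ : Ctx) : RowKind → Face Label
  | .cross true zero => .out (.single (.corner ⟨false, (0, 0), γ.m⟩ zero))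
  | .cross false zero => .out (.row (.cross false zero))
  | _ => .idle

/-- The faces of a tile of a left arm of positive level. -/
noncomputable def Scheme.armFace (G : Scheme) (γ : Ctx) (d : ℤ) (x : Xing) (K : RowKind) :
    Dir → Face Label
  | .north => G.armNorth γ d x (effRow x K)
  | .south => G.armSouth γ d x (effRow x K)
  | .east => if x = .no then .inn (.row K) else G.crossEast γ (effRow x K)
  | .west => if x = .no then G.westFace γ (G.step d (effRow x K)) else .inn (.row K)

/-- The faces of the first tile of the left arm through which a block of positive level is
started. -/
noncomputable def Scheme.rfirstFace (G : Scheme) (γ : Ctx) (zero : Bool) : Dir → Face Label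
  | .north => .out (.coop true γ 0 (if zero then .no else .later))
  | .south => .out (.single (.corner γ false))
  | .east => G.crossEast γ (.cross true zero)
  | .west => .inn (.single (.rfirst true γ zero))

/-- The faces of a tile of a left arm of level `0`. -/
noncomputable def Scheme.arm0Face (G : Scheme) (γ : Ctx) (z : ℤ) : Dir → Face Label
  | .north =>
    if γ.m = .north then .inn (.single (.arm0 true γ z))
    else if z = G.n then G.endFace γ true else .out (.single (.arm0 true γ (z + 1)))
  | .south =>
    if γ.m = .north then
      if z = 1 then .out (.single (.corner γ true)) else .out (.single (.arm0 true γ (z - 1)))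
    else if γ.isR ∧ z = 1 then .out (.single (.corner γ true))
    else .inn (.single (.arm0 true γ z))
  | .east => if z = 1 ∧ G.pax then .out (.single (.pat false (0, 0))) else .idle
  | .west =>
    if γ.isR ∧ z = 1 then .inn (.single (.arm0 true γ z))
    else .out (.row (if z = G.n then .top else .mid))

/-- The upper face of a corner. -/
def Scheme.cornerNorth (_ : Scheme) (γ : Ctx) (zero : Bool) : Face Label :=
  if γ.m = .north ∨ γ.isR then .inn (.single (.corner γ zero))
  else if zero then .out (.single (.arm0 true γ 1))
  else .out (.coop true γ 0 (if γ.m = .west then .first else .no))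

/-- The left face of a corner. -/
noncomputable def Scheme.cornerWest (G : Scheme) (γ : Ctx) (zero : Bool) : Face Label :=
  if γ.m = .west then
    if γ.isR then .idle else .inn (.single (.corner γ zero))
  else G.westFace γ (.cross true zero)

open Classical in
/-- The faces of a pattern tile. -/
noncomputable def Scheme.patFace (G : Scheme) (root : Bool) (q : ℤ × ℤ) (u : Dir) : Face Label :=
  if q = (0, 0) ∧ root = false ∧ u = (if G.pax then .west else .south) then
    .inn (.single (.pat root q))
  else if q ≠ (0, 0) ∧ u = G.qpar q then .inn (.single (.pat root q))
  else if q + u.vec ∈ G.Q ∧ q + u.vec ≠ (0, 0) ∧ G.qpar (q + u.vec) = u.opp then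
    .out (.single (.pat root (q + u.vec)))
  else if root ∧ q = (G.n - 1, 0) ∧ u = .east then .out (.single (.arm0 true rctx 1))
  else if root ∧ q = (0, G.n - 1) ∧ u = .north then .out (.single (.arm0 false rctx.swap 1))
  else .idle

/-- The faces of a tile. Those of horizontal arms and two sides of the corners are obtained by
transposition. -/
noncomputable def Scheme.face (G : Scheme) : Kind → Dir → Face Label
  | .pat r q, u => G.patFace r q u
  | .corner γ zero, .north => G.cornerNorth γ zero
  | .corner γ zero, .west => G.cornerWest γ zero
  | .corner γ zero, .east => (G.swap.cornerNorth γ.swap zero).swap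
  | .corner γ zero, .south => (G.swap.cornerWest γ.swap zero).swap
  | .arm0 true γ z, u => G.arm0Face γ z u
  | .arm0 false γ z, u => (G.swap.arm0Face γ.swap z u.swap).swap
  | .rfirst true γ zero, u => G.rfirstFace γ zero u
  | .rfirst false γ zero, u => (G.swap.rfirstFace γ.swap zero u.swap).swap
  | .arm true γ d x K, u => G.armFace γ d x K u
  | .arm false γ d x K, u => (G.swap.armFace γ.swap d x K u.swap).swap

theorem Scheme.face_swap (G : Scheme) (k : Kind) (u : Dir) :
    G.swap.face k.swap u.swap = (G.face k u).swap := by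
  rcases k with ⟨r, q⟩ | ⟨γ, z⟩ | ⟨_ | _, γ, z⟩ | ⟨_ | _, γ, z⟩ | ⟨_ | _, γ, d, x, K⟩
  · have h0 : q.swap + u.swap.vec = (q + u.vec).swap := add_vec_swap q u
    have h1 : q.swap = (0, 0) ↔ q = (0, 0) := Prod.swap_eq_mk q 0 0
    have h2 : (q + u.vec).swap = (0, 0) ↔ q + u.vec = (0, 0) := Prod.swap_eq_mk _ 0 0
    have h3 (v : Dir) : u.swap = v ↔ u = v.swap := Dir.swap_eq_iff
    have h4 (v w : Dir) : v.swap = w.swap ↔ v = w := by rw [Dir.swap_eq_iff, Dir.swap_swap]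
    have h5 : (if G.swap.pax then Dir.west else Dir.south).swap =
        if G.pax then Dir.west else Dir.south := by
      cases hp : G.pax <;> simp [hp]
    have e1 : (q.swap = (0, 0) ∧ r = false ∧
        u.swap = (if G.swap.pax then Dir.west else Dir.south)) ↔
        (q = (0, 0) ∧ r = false ∧ u = (if G.pax then Dir.west else Dir.south)) := by
      rw [h1, h3, h5]
    have e2 : (q.swap ≠ (0, 0) ∧ u.swap = G.swap.qpar q.swap) ↔
        (q ≠ (0, 0) ∧ u = G.qpar q) := by
      rw [ne_eq, h1, Scheme.swap_qpar, Prod.swap_swap, h4]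
    have e3 : (q.swap + u.swap.vec ∈ G.swap.Q ∧ q.swap + u.swap.vec ≠ (0, 0) ∧
        G.swap.qpar (q.swap + u.swap.vec) = u.swap.opp) ↔
        (q + u.vec ∈ G.Q ∧ q + u.vec ≠ (0, 0) ∧ G.qpar (q + u.vec) = u.opp) := by
      rw [h0, ne_eq, h2, Scheme.swap_qpar, Prod.swap_swap, Dir.opp_swap, h4, Scheme.mem_swap_Q,
        Prod.swap_swap]
    have e4 : (r ∧ q.swap = (G.swap.n - 1, 0) ∧ u.swap = .east) ↔
        (r ∧ q = (0, G.n - 1) ∧ u = .north) := by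
      rw [h3, Prod.swap_eq_mk]; rfl
    have e5 : (r ∧ q.swap = (0, G.swap.n - 1) ∧ u.swap = .north) ↔
        (r ∧ q = (G.n - 1, 0) ∧ u = .east) := by
      rw [h3, Prod.swap_eq_mk]; rfl
    have hr (z : ℤ × ℤ) : (Kind.pat r z).swap = Kind.pat r z.swap := rfl
    simp only [Kind.swap, Scheme.face, Scheme.patFace, e1, e2, e3, e4, e5]
    split_ifs with c1 c2 c3 c4 c5 <;> first | rfl | simp_all [Face.swap, Label.swap, Kind.swap]
  · cases u <;> simp [Kind.swap, Scheme.face]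
  all_goals simp [Kind.swap, Scheme.face]

/-! ### Blocks -/

/-- The kind of the row `z` of a block of level `k`. -/
def Scheme.rowKind (G : Scheme) (k : ℕ) (z : ℤ) : RowKind :=
  if z ≤ k then .cross (z = 0) (z = k) else if z = G.len k - 1 then .top else .mid

/-- The tile number `z ≥ 1` of the left arm of a block of level `k`. -/
def Scheme.leftArm (G : Scheme) (k : ℕ) (γ : Ctx) (z : ℤ) : Kind :=
  match k with
  | 0 => .arm0 true γ z
  | k + 1 =>
    if γ.isR ∧ z = 1 then .rfirst true γ (k = 0)
    else if γ.m = .west ∧ z ≤ k + 1 then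
      .arm true γ 0 (if z = 1 then .first else .later) (.cross false (z = k + 1))
    else .arm true γ ((z - 1) / G.len k) .no (G.rowKind k ((z - 1) % G.len k))

/-- The left and the bottom arm of a block. -/
def Scheme.frame (G : Scheme) (k : ℕ) (B : Option Ctx) (x y : ℤ) : Option Kind :=
  match B with
  | none => none
  | some γ =>
    if x = 0 ∧ y = 0 then some (.corner γ (k = 0))
    else if x = 0 then some (G.leftArm k γ y)
    else some (G.swap.leftArm k γ.swap x).swap

open Classical in
/-- The tiles of a block of level `k` in the context `B`, where `x` and `y` count from its lower
left corner. Only the values for `0 ≤ x, y < G.len k` are meaningful. -/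
noncomputable def Scheme.block (G : Scheme) : ℕ → Option Ctx → ℤ → ℤ → Option Kind
  | 0, B, x, y =>
    if 1 ≤ x ∧ 1 ≤ y then
      if (x - 1, y - 1) ∈ G.Q then some (.pat B.isNone (x - 1, y - 1)) else none
    else G.frame 0 B x y
  | k + 1, B, x, y =>
    if 1 ≤ x ∧ 1 ≤ y then
      if ((x - 1) / G.len k, (y - 1) / G.len k) ∈ G.V then
        G.block k (G.sub B ((x - 1) / G.len k, (y - 1) / G.len k)) ((x - 1) % G.len k)
          ((y - 1) % G.len k)
      else none
    else G.frame (k + 1) B x y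

theorem Scheme.sub_swap (G : Scheme) (B : Option Ctx) (w : ℤ × ℤ) :
    G.swap.sub (B.map Ctx.swap) w.swap = (G.sub B w).map Ctx.swap := by
  obtain ⟨a, b⟩ := w
  rcases B with _ | ⟨r, w, m⟩
  · by_cases ha : a = 0 <;> by_cases hb : b = 0 <;> simp [Scheme.sub, ha, hb]
  · by_cases ha : a = 0 <;> by_cases hb : b = 0 <;> cases m <;> simp [Scheme.sub, ha, hb]

theorem Scheme.frame_swap (G : Scheme) (k : ℕ) (B : Option Ctx) (x y : ℤ) (h : x = 0 ∨ y = 0) :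
    G.swap.frame k (B.map Ctx.swap) y x = (G.frame k B x y).map Kind.swap := by
  rcases B with _ | γ
  · simp [Scheme.frame]
  · by_cases hx : x = 0 <;> by_cases hy : y = 0 <;> simp_all [Scheme.frame, Kind.swap_corner]

theorem Scheme.Proper.block_swap {G : Scheme} (hG : G.Proper) (k : ℕ) (B : Option Ctx) (x y : ℤ)
    (hx : 0 ≤ x) (hy : 0 ≤ y) :
    G.swap.block k (B.map Ctx.swap) y x = (G.block k B x y).map Kind.swap := by
  induction k generalizing B x y with
  | zero =>
    by_cases h : 1 ≤ x ∧ 1 ≤ y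
    · by_cases hq : (x - 1, y - 1) ∈ G.Q <;> simp [Scheme.block, h, hq, Kind.swap]
    · rw [Scheme.block, Scheme.block, if_neg h, if_neg (by tauto), G.frame_swap _ _ _ _ (by omega)]
  | succ k ih =>
    by_cases h : 1 ≤ x ∧ 1 ≤ y
    · rw [Scheme.block, Scheme.block, if_pos h, if_pos h.symm]
      by_cases hv : ((x - 1) / G.len k, (y - 1) / G.len k) ∈ G.V
      · rw [if_pos hv, if_pos (by simpa using hv)]
        rw [← ih]
        · rw [← G.sub_swap]; simp
        all_goals exact Int.emod_nonneg _ (by have := hG.add_three_le_len k; omega)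
      · rw [if_neg hv, if_neg (by simpa using hv)]; rfl
    · rw [Scheme.block, Scheme.block, if_neg h, if_neg (by tauto), G.frame_swap _ _ _ _ (by omega)]

namespace Scheme

variable {G : Scheme}

/-! ### Coordinates in a block -/

theorem Proper.len_mul_add_lt (hG : G.Proper) {k : ℕ} {a r : ℤ} (ha : a < G.c) (hr : r < G.len k) :
    1 + G.len k * a + r < G.len (k + 1) := by
  have := hG.add_three_le_len k
  simp only [len]
  nlinarith

/-- A coordinate of a point off the arms, in terms of the coordinates of the subblock and of the
point in the subblock. -/
theorem Proper.exists_digit (hG : G.Proper) {k : ℕ} {x : ℤ} (h0 : 1 ≤ x) (h1 : x < G.len (k + 1)) :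
    ∃ a r, 0 ≤ a ∧ a < G.c ∧ 0 ≤ r ∧ r < G.len k ∧ x = 1 + G.len k * a + r := by
  have hl := hG.add_three_le_len k
  refine ⟨(x - 1) / G.len k, (x - 1) % G.len k, Int.ediv_nonneg (by omega) (by omega), ?_,
    Int.emod_nonneg _ (by omega), Int.emod_lt_of_pos _ (by omega), ?_⟩
  · apply Int.ediv_lt_of_lt_mul (by omega)
    simp only [len] at h1
    linarith
  · have := Int.mul_ediv_add_emod (x - 1) (G.len k)
    linarith

theorem digit_ediv {l a r : ℤ} (h0 : 0 ≤ r) (h1 : r < l) : (1 + l * a + r - 1) / l = a := by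
  rw [show 1 + l * a + r - 1 = r + l * a by ring, Int.add_mul_ediv_left _ _ (by omega),
    Int.ediv_eq_zero_of_lt h0 h1, zero_add]

theorem digit_emod {l a r : ℤ} (h0 : 0 ≤ r) (h1 : r < l) : (1 + l * a + r - 1) % l = r := by
  rw [show 1 + l * a + r - 1 = r + l * a by ring, Int.add_mul_emod_self_left,
    Int.emod_eq_of_lt h0 h1]

theorem Proper.rowKind_step (hG : G.Proper) {k : ℕ} {a r : ℤ} (ha : 0 ≤ a) (ha' : a < G.c)
    (hr : 0 ≤ r) (hr' : r < G.len k) :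
    G.rowKind (k + 1) (1 + G.len k * a + r) = G.step a (G.rowKind k r) := by
  have hl := hG.add_three_le_len k
  have hc := hG.two_le_c
  have hL : G.len (k + 1) = G.c * G.len k + 1 := rfl
  have e : G.len k * a = a * G.len k := mul_comm _ _
  rcases eq_or_lt_of_le ha with rfl | h0
  · have : 2 * G.len k ≤ G.c * G.len k := by nlinarith
    simp only [rowKind, step, hL]
    push_cast
    split_ifs <;> first | omega | rfl | skip
    all_goals simp
    all_goals omega
  · have h1 : G.len k ≤ G.len k * a := by nlinarith
    have h2 : a = G.c - 1 ∨ a < G.c - 1 := by omega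
    rcases h2 with rfl | h2
    · have : G.len k * (G.c - 1) = G.c * G.len k - G.len k := by ring
      simp only [rowKind, step, hL]
      push_cast
      split_ifs <;> first | omega | rfl
    · have : G.len k * a + G.len k ≤ G.c * G.len k - G.len k := by nlinarith
      simp only [rowKind, step, hL]
      push_cast
      split_ifs <;> first | omega | rfl

theorem block_sub (G : Scheme) {k : ℕ} (B : Option Ctx) {a b x y : ℤ}
    (hx : 0 ≤ x) (hx' : x < G.len k) (hy : 0 ≤ y) (hy' : y < G.len k)
    (ha : 0 ≤ a) (hb : 0 ≤ b) (hV : (a, b) ∈ G.V) :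
    G.block (k + 1) B (1 + G.len k * a + x) (1 + G.len k * b + y) =
      G.block k (G.sub B (a, b)) x y := by
  have h1 : 0 ≤ G.len k * a := mul_nonneg (by omega) ha
  have h2 : 0 ≤ G.len k * b := mul_nonneg (by omega) hb
  rw [block, if_pos (by omega), digit_ediv hx hx', digit_ediv hy hy', digit_emod hx hx',
    digit_emod hy hy', if_pos hV]

theorem block_sub_none (G : Scheme) {k : ℕ} (B : Option Ctx) {a b x y : ℤ}
    (hx : 0 ≤ x) (hx' : x < G.len k) (hy : 0 ≤ y) (hy' : y < G.len k)
    (ha : 0 ≤ a) (hb : 0 ≤ b) (hV : (a, b) ∉ G.V) :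
    G.block (k + 1) B (1 + G.len k * a + x) (1 + G.len k * b + y) = none := by
  have h1 : 0 ≤ G.len k * a := mul_nonneg (by omega) ha
  have h2 : 0 ≤ G.len k * b := mul_nonneg (by omega) hb
  rw [block, if_pos (by omega), digit_ediv hx hx', digit_ediv hy hy', if_neg hV]

theorem block_left (G : Scheme) (k : ℕ) (γ : Ctx) {y : ℤ} (hy : y ≠ 0) :
    G.block k (some γ) 0 y = some (G.leftArm k γ y) := by
  cases k <;> simp [block, frame, hy]

theorem block_bottom (G : Scheme) (k : ℕ) (γ : Ctx) {x : ℤ} (hx : x ≠ 0) :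
    G.block k (some γ) x 0 = some (G.swap.leftArm k γ.swap x).swap := by
  cases k <;> simp [block, frame, hx]

theorem block_corner (G : Scheme) (k : ℕ) (γ : Ctx) :
    G.block k (some γ) 0 0 = some (.corner γ (k = 0)) := by
  cases k <;> simp [block, frame]

theorem block_none_edge (G : Scheme) (k : ℕ) {x y : ℤ} (h : x = 0 ∨ y = 0) :
    G.block k none x y = none := by
  rcases h with rfl | rfl <;> cases k <;> simp [block, frame]

/-- The arm tile next to the subblock number `a`, away from the rows that are attached from
outside. -/
theorem Proper.leftArm_succ (hG : G.Proper) {k : ℕ} (γ : Ctx) {a r : ℤ} (ha : 0 ≤ a)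
    (hr : 0 ≤ r) (hr' : r < G.len k) :
    G.leftArm (k + 1) γ (1 + G.len k * a + r) =
      if γ.isR ∧ a = 0 ∧ r = 0 then .rfirst true γ (k = 0)
      else if γ.m = .west ∧ a = 0 ∧ r ≤ k then
        .arm true γ 0 (if r = 0 then .first else .later) (.cross false (r = k))
      else .arm true γ a .no (G.rowKind k r) := by
  have hl := hG.add_three_le_len k
  rw [leftArm, digit_ediv hr hr', digit_emod hr hr']
  have h0 : 0 ≤ G.len k * a := mul_nonneg (by omega) ha
  rcases eq_or_lt_of_le ha with rfl | h1
  · have e1 : (1 + G.len k * 0 + r = 1) ↔ r = 0 := by omega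
    have e2 : (1 + G.len k * 0 + r ≤ k + 1) ↔ r ≤ k := by omega
    have e3 : (1 + G.len k * 0 + r = k + 1) ↔ r = k := by omega
    simp only [e1, e2, e3, true_and]
  · have : G.len k ≤ G.len k * a := by nlinarith
    rw [if_neg (by omega), if_neg (by omega), if_neg (by omega), if_neg (by omega)]

/-! ### Compatibility of facing sides -/

/-- Labels with this property must not be presented to a neighbor that is not attached
through them. -/
def _root_.SelfAssembly.Label.Binding : Label → Prop
  | .row _ => False
  | _ => True

/-- A face that is not attached and presents no binding label. -/
def _root_.SelfAssembly.Face.Quiet (f : Face Label) : Prop :=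
  f = .idle ∨ ∃ K, f = .out (.row K)

/-- Two facing sides fit together. -/
inductive _root_.SelfAssembly.Face.Compat : Face Label → Face Label → Prop
  | quiet {f g : Face Label} : f.Quiet → g.Quiet → Compat f g
  | inn_out (L : Label) : Compat (.inn L) (.out L)
  | out_inn (L : Label) : Compat (.out L) (.inn L)

theorem _root_.SelfAssembly.Face.Compat.symm {f g : Face Label} (h : f.Compat g) : g.Compat f := by
  cases h with
  | quiet h1 h2 => exact .quiet h2 h1
  | inn_out L => exact .out_inn L
  | out_inn L => exact .inn_out L

theorem _root_.SelfAssembly.Face.Quiet.swap {f : Face Label} (h : f.Quiet) : f.swap.Quiet := by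
  rcases h with rfl | ⟨K, rfl⟩
  · exact .inl rfl
  · exact .inr ⟨K, rfl⟩

theorem _root_.SelfAssembly.Face.Compat.swap {f g : Face Label} (h : f.Compat g) :
    f.swap.Compat g.swap := by
  cases h with
  | quiet h1 h2 => exact .quiet h1.swap h2.swap
  | inn_out L => exact .inn_out L.swap
  | out_inn L => exact .out_inn L.swap

theorem _root_.SelfAssembly.Face.quiet_idle : Face.Quiet .idle := .inl rfl
theorem _root_.SelfAssembly.Face.quiet_row (K : RowKind) : Face.Quiet (.out (.row K)) :=
  .inr ⟨K, rfl⟩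

/-- The face of a position, which is idle if there is no tile. -/
noncomputable def faceAt (G : Scheme) (o : Option Kind) (u : Dir) : Face Label :=
  match o with
  | none => .idle
  | some k => G.face k u

@[simp] theorem faceAt_none (G : Scheme) (u : Dir) : G.faceAt none u = .idle := rfl
@[simp] theorem faceAt_some (G : Scheme) (k : Kind) (u : Dir) :
    G.faceAt (some k) u = G.face k u := rfl

theorem faceAt_swap (G : Scheme) (o : Option Kind) (u : Dir) :
    G.swap.faceAt (o.map Kind.swap) u.swap = (G.faceAt o u).swap := by
  cases o with
  | none => rfl
  | some k => exact G.face_swap k u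

/-- The contexts of the subblocks at points of `V`; off the axes their growth is started along the
spanning tree. -/
structure ValidCtx (G : Scheme) (γ : Ctx) : Prop where
  mem : γ.w ∈ G.V
  m_off : γ.w.1 ≠ 0 → γ.w.2 ≠ 0 → γ.m = G.par γ.w

theorem valid_sub {B : Option Ctx} {γ' : Ctx} {w : ℤ × ℤ} (hw : w ∈ G.V)
    (h : G.sub B w = some γ') : G.ValidCtx γ' := by
  obtain ⟨a, b⟩ := w
  rcases B with _ | ⟨r, v, m⟩ <;> simp only [sub] at h <;> split_ifs at h with h0 h1 h2 <;>
    simp only [Option.some.injEq] at h <;> subst h <;> simp only [Prod.mk.injEq] at * <;>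
    constructor <;> simp_all

/-! ### The sides of a block -/

theorem rowKind_zero (G : Scheme) (k : ℕ) : G.rowKind k 0 = .cross true (k = 0) := by
  simp [rowKind, eq_comm]

theorem rowKind_cross (G : Scheme) {k : ℕ} {z : ℤ} (h : z ≤ k) :
    G.rowKind k z = .cross (z = 0) (z = k) := if_pos h

theorem Proper.rowKind_top (hG : G.Proper) (k : ℕ) : G.rowKind k (G.len k - 1) = .top := by
  have := hG.add_three_le_len k
  rw [rowKind, if_neg (by omega), if_pos rfl]

theorem rowKind_ne_top (G : Scheme) {k : ℕ} {z : ℤ} (h : z < G.len k - 1) :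
    G.rowKind k z ≠ .top := by
  rw [rowKind]; split_ifs <;> first | omega | simp

theorem rowKind_of_lt (G : Scheme) {k : ℕ} {z : ℤ} (h : k < z) :
    G.rowKind k z = .mid ∨ G.rowKind k z = .top := by
  rw [rowKind]; split_ifs <;> first | omega | simp

theorem isR_iff {γ : Ctx} : γ.isR ↔ γ = rctx := by simp [Ctx.isR]

theorem block_west_inn (G : Scheme) {k : ℕ} {γ : Ctx} (hγ : γ.isR = false) (hm : γ.m = .west) :
    G.faceAt (G.block k (some γ) 0 0) .west = .inn (.single (.corner γ (k = 0))) := by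
  simp [block_corner, face, cornerWest, hγ, hm]

theorem block_west_row (G : Scheme) {k : ℕ} {γ : Ctx} (hm : γ.m = .west) {y : ℤ}
    (hy : 1 ≤ y) (hyk : y ≤ k) (hR : γ.isR → 2 ≤ y) :
    G.faceAt (G.block k (some γ) 0 y) .west = .inn (.row (.cross false (y = k))) := by
  rw [G.block_left k γ (by omega)]
  rcases k with _ | k
  · simp at hyk; omega
  rw [leftArm, if_neg (by rintro ⟨h, rfl⟩; have := hR h; omega), if_pos ⟨hm, by exact_mod_cast hyk⟩]
  by_cases h : y = 1 <;> simp [face, armFace, h]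

/-- The left side of a block in the rows that are not attached from the left. -/
theorem Proper.block_west_out (hG : G.Proper) {k : ℕ} {γ : Ctx} {y : ℤ} (hy : 0 ≤ y)
    (hy' : y < G.len k) (hm : γ.m ≠ .west ∨ k < y) (hR : γ.isR → y ≠ 1) :
    G.faceAt (G.block k (some γ) 0 y) .west = G.westFace γ (G.rowKind k y) := by
  rcases eq_or_lt_of_le hy with rfl | h0
  · have hm : γ.m ≠ .west := by
      rcases hm with h | h
      · exact h
      · omega
    rw [block_corner, faceAt_some, face, cornerWest, if_neg hm, rowKind_zero]
  rw [G.block_left k γ (by omega)]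
  rcases k with _ | k
  · have e : (γ.isR ∧ y = 1) ↔ False := by
      simp only [iff_false, not_and]; exact hR
    have : ¬ y ≤ 0 := by omega
    simp only [faceAt_some, leftArm, face, arm0Face, e, if_false, rowKind, len]
    simp only [Nat.cast_zero, this, if_false]
    by_cases h : y = G.n <;> simp [h, westFace]
  · obtain ⟨a, r, ha, ha', hr, hr', rfl⟩ := hG.exists_digit h0 hy'
    rw [hG.leftArm_succ γ ha hr hr', if_neg, if_neg, hG.rowKind_step ha ha' hr hr']
    · simp [face, armFace, effRow]
    · rintro ⟨h1, rfl, h3⟩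
      rcases hm with h | h
      · exact h h1
      · push_cast at h; omega
    · rintro ⟨h1, rfl, rfl⟩
      exact hR h1 (by ring)

theorem westFace_quiet (G : Scheme) {γ : Ctx} {K : RowKind} (h : G.childW γ = none) :
    (G.westFace γ K).Quiet := by
  rcases K with _ | _ | _ <;> simp [westFace, h, Face.quiet_row]

theorem westFace_quiet_of_lt (G : Scheme) {k : ℕ} {γ : Ctx} {y : ℤ} (h : k < y) :
    (G.westFace γ (G.rowKind k y)).Quiet := by
  rcases G.rowKind_of_lt h with h | h <;> simp [westFace, h, Face.quiet_row]

/-- The upper side of the last tile of a left arm. -/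
theorem Proper.leftArm_top (hG : G.Proper) (k : ℕ) (γ : Ctx) :
    G.face (G.leftArm k γ (G.len k - 1)) .north =
      if γ.m = .north then .inn (G.swap.initE γ.swap (k = 0)).swap else G.endFace γ (k = 0) := by
  have hn := hG.two_le_n
  have hc := hG.two_le_c
  rcases k with _ | k
  · simp [leftArm, len, face, arm0Face, initE, Label.swap, Kind.swap]
  · have hl := hG.add_three_le_len k
    have e : G.len (k + 1) - 1 = 1 + G.len k * (G.c - 1) + (G.len k - 1) := by simp only [len]; ring
    rw [e, hG.leftArm_succ γ (by omega) (by omega) (by omega), if_neg (by omega), if_neg (by omega),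
      hG.rowKind_top]
    simp [face, armFace, armNorth, effRow, initE, Label.swap]

theorem Proper.patFace_east (hG : G.Proper) {y : ℤ} {root : Bool} (hQ : (G.n - 1, y) ∈ G.Q) :
    G.patFace root (G.n - 1, y) .east =
      if root ∧ y = 0 then .out (.single (.arm0 true rctx 1)) else .idle := by
  have hn := hG.two_le_n
  obtain ⟨rk, htree⟩ := hG.Q_tree
  have h0 : ((G.n - 1, y) : ℤ × ℤ) ≠ (0, 0) := by simp; omega
  have h1 : ((G.n - 1, y) : ℤ × ℤ) + Dir.east.vec ∉ G.Q := fun h => by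
    have := hG.Q_bounds _ _ h
    simp [Dir.vec] at this
  have h2 : ¬ (Dir.east = G.qpar (G.n - 1, y)) := fun h => by
    have := (htree _ hQ h0).1
    rw [← h] at this
    exact h1 this
  rw [patFace, if_neg (fun h => h0 h.1), if_neg (fun h => h2 h.2), if_neg (fun h => h1 h.1)]
  simp

/-- The right side of a block of level `k` in a row `y ≤ k`: there ends a bottom arm, which belongs
to the block itself if `y = 0`, and otherwise to a block nested in its lower right corner. -/
noncomputable def eastFace (G : Scheme) (k : ℕ) (γ : Ctx) (y : ℤ) : Face Label :=
  if γ.m = .east then .inn (G.initE (if y = 0 then γ else ⟨false, (G.c - 1, 0), .east⟩) (y = k))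
  else if y = 0 then (G.swap.endFace γ.swap (k = 0)).swap
  else .out (.row (.cross false (y = k)))

theorem block_bottom_face (G : Scheme) (k : ℕ) (γ : Ctx) {x : ℤ} (hx : x ≠ 0) (u : Dir) :
    G.faceAt (G.block k (some γ) x 0) u =
      (G.swap.face (G.swap.leftArm k γ.swap x) u.swap).swap := by
  have h := G.swap.face_swap (G.swap.leftArm k γ.swap x) u.swap
  rw [swap_swap, Dir.swap_swap] at h
  rw [G.block_bottom k γ hx, faceAt_some, h]

theorem Proper.block_east_zero (hG : G.Proper) (k : ℕ) (γ : Ctx) :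
    G.faceAt (G.block k (some γ) (G.len k - 1) 0) .east = G.eastFace k γ 0 := by
  have hlk := hG.add_three_le_len k
  have := hG.swap.leftArm_top k γ.swap
  rw [swap_len, swap_swap, Ctx.swap_swap] at this
  rw [G.block_bottom_face k γ (by omega), Dir.swap_east, this]
  by_cases hm : γ.m = .east
  · simp [eastFace, hm, Face.swap, eq_comm]
  · have : γ.m.swap ≠ .north := by rw [ne_eq, Dir.swap_eq_iff]; exact hm
    simp [eastFace, hm, this]

/-- The blocks in the last column, except for the lowest one, do not interact with the blocks to
the right of their parents. -/
theorem Proper.eastFace_quiet (hG : G.Proper) {k : ℕ} {γ : Ctx} (hγ : G.ValidCtx γ) {b y : ℤ}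
    (hb : 1 ≤ b) (hw : γ.w = (G.c - 1, b)) : (G.eastFace k γ y).Quiet := by
  have hc := hG.two_le_c
  have hV : (G.c, b) ∉ G.V := fun h => by have := hG.V_bounds _ _ h; omega
  obtain ⟨rk, htree⟩ := hG.tree
  have hm : γ.m ≠ .east := by
    rw [hγ.m_off (by rw [hw]; simp; omega) (by rw [hw]; simp; omega)]
    intro h
    have := (htree _ hγ.mem (by rw [hw]; simp; omega) (by rw [hw]; simp; omega)).1
    rw [h, hw] at this
    simp [Dir.vec] at this
    exact hV this
  rw [eastFace, if_neg hm]
  split_ifs with h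
  · have h1 : ¬ ((b, G.c - 1) : ℤ × ℤ) = (0, G.c - 1) := by simp; omega
    have h2 : ¬ (b = 0 ∧ G.c - 1 < G.c - 1) := by omega
    simp [endFace, childN, hw, h1, hV, Face.swap, Face.quiet_idle]
  · exact Face.quiet_row _

theorem sub_some_last (G : Scheme) (γ : Ctx) {a : ℤ} (ha : a ≠ 0) :
    G.sub (some γ) (a, 0) = some ⟨false, (a, 0), if γ.m = .east then .east else .west⟩ := by
  simp [sub, ha]

/-- The right side of a block: only the rows `y ≤ k` interact with the right neighbor. -/
theorem Proper.block_east (hG : G.Proper) {k : ℕ} {γ : Ctx} (hγ : G.ValidCtx γ) {y : ℤ}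
    (hy : 0 ≤ y) (hy' : y < G.len k) :
    (k < y → (G.faceAt (G.block k (some γ) (G.len k - 1) y) .east).Quiet) ∧
    (y ≤ k → G.faceAt (G.block k (some γ) (G.len k - 1) y) .east = G.eastFace k γ y) := by
  have hn := hG.two_le_n
  have hc := hG.two_le_c
  have hlk := hG.add_three_le_len k
  rcases eq_or_lt_of_le hy with rfl | h0
  · exact ⟨fun h => by omega, fun _ => hG.block_east_zero k γ⟩
  induction k generalizing γ y with
  | zero =>
    refine ⟨fun _ => ?_, fun h => by simp at h; omega⟩
    rw [block, if_pos (by omega)]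
    split_ifs with hq
    · rw [len] at hq ⊢
      rw [show G.n + 1 - 1 - 1 = G.n - 1 by ring] at hq
      rw [show G.n + 1 - 1 - 1 = G.n - 1 by ring]
      rw [faceAt_some, face, hG.patFace_east hq]
      simp [Face.quiet_idle]
    · exact Face.quiet_idle
  | succ k ih =>
    have hl := hG.add_three_le_len k
    have e : G.len (k + 1) - 1 = 1 + G.len k * (G.c - 1) + (G.len k - 1) := by simp only [len]; ring
    obtain ⟨b, r, hb, hb', hr, hr', rfl⟩ := hG.exists_digit h0 hy'
    rw [e]
    rcases eq_or_lt_of_le hb with rfl | hb0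
    · have hmem := hG.row_mem (G.c - 1) (by omega) (by omega)
      rw [G.block_sub _ (by omega) (by omega) hr hr' (by omega) le_rfl hmem,
        G.sub_some_last γ (by omega)]
      have hval := valid_sub (G := G) hmem (G.sub_some_last γ (by omega))
      have key : (k < r → (G.faceAt (G.block k (some ⟨false, (G.c - 1, 0),
            if γ.m = .east then .east else .west⟩) (G.len k - 1) r) .east).Quiet) ∧
          (r ≤ k → G.faceAt (G.block k (some ⟨false, (G.c - 1, 0),
            if γ.m = .east then .east else .west⟩) (G.len k - 1) r) .east =
            G.eastFace k ⟨false, (G.c - 1, 0), if γ.m = .east then .east else .west⟩ r) := by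
        rcases eq_or_lt_of_le hr with rfl | hr0
        · exact ⟨fun h => by omega, fun _ => hG.block_east_zero k _⟩
        · exact ih hval hr hr' hl (by omega)
      refine ⟨fun h => key.1 (by push_cast at h; omega), fun h => ?_⟩
      rw [key.2 (by push_cast at h; omega)]
      have e1 : ¬ (1 + G.len k * 0 + r = 0) := by omega
      have e2 : (1 + G.len k * 0 + r = (k + 1 : ℕ)) ↔ r = k := by push_cast; omega
      simp only [eastFace, e1, e2]
      by_cases hm : γ.m = .east
      · simp [hm]
      · by_cases hr0 : r = 0
        · subst hr0
          simp [hm, endFace, Face.swap, Label.swap, eq_comm]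
        · simp [hm, hr0]
    · have hlb : G.len k ≤ G.len k * b := by nlinarith
      refine ⟨fun _ => ?_, fun h => by push_cast at h; omega⟩
      by_cases hV : (G.c - 1, b) ∈ G.V
      · rw [G.block_sub _ (by omega) (by omega) hr hr' (by omega) hb hV]
        have hs : G.sub (some γ) (G.c - 1, b) = some ⟨false, (G.c - 1, b), G.par (G.c - 1, b)⟩ := by
          have : G.c - 1 ≠ 0 := by omega
          simp [sub, this, show b ≠ 0 by omega]
        have hval := valid_sub (G := G) hV hs
        rw [hs]
        have hq := fun k y => hG.eastFace_quiet (k := k) (y := y) hval hb0 rfl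
        rcases eq_or_lt_of_le hr with rfl | hr0
        · rw [hG.block_east_zero]
          exact hq _ _
        · have := ih hval hr hr' hl (by omega)
          rcases lt_or_ge (k : ℤ) r with h | h
          · exact this.1 h
          · rw [this.2 h]
            exact hq _ _
      · rw [G.block_sub_none _ (by omega) (by omega) hr hr' (by omega) hb hV]
        exact Face.quiet_idle

/-! ### Compatibility inside a block -/

/-- Successive tiles of the left arm fit together. -/
theorem Proper.compat_along (hG : G.Proper) (k : ℕ) (γ : Ctx) {y : ℤ} (hy : 0 ≤ y)
    (hy' : y + 1 < G.len k) :
    (G.faceAt (G.block k (some γ) 0 y) .north).Compat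
      (G.faceAt (G.block k (some γ) 0 (y + 1)) .south) := by
  have hlk := hG.add_three_le_len k
  have hRm : γ.isR → γ.m = .west := fun h => by rw [isR_iff.1 h]
  rw [G.block_left k γ (by omega : y + 1 ≠ 0), faceAt_some]
  rcases eq_or_lt_of_le hy with rfl | h0
  · rw [block_corner, faceAt_some, zero_add, face, cornerNorth]
    rcases k with _ | k
    · simp only [leftArm, face, arm0Face]
      by_cases h1 : γ.m = .north
      · simp [h1, Face.Compat.inn_out]
      · by_cases h2 : γ.isR
        · simp [h1, h2, Face.Compat.inn_out]
        · simp [h1, h2, Face.Compat.out_inn]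
    · have hl := hG.add_three_le_len k
      have := hG.leftArm_succ (k := k) γ le_rfl le_rfl (by omega)
      rw [show (1 : ℤ) + G.len k * 0 + 0 = 1 by ring] at this
      rw [this]
      by_cases h2 : γ.isR
      · simp [h2, face, rfirstFace, Face.Compat.inn_out]
      · by_cases h3 : γ.m = .west
        · simp [h2, h3, face, armFace, armSouth, Face.Compat.out_inn]
        · by_cases h1 : γ.m = .north
          · simp [h2, h1, face, armFace, armSouth, Face.Compat.inn_out, effRow, rowKind_zero]
          · simp [h2, h1, h3, face, armFace, armSouth, Face.Compat.out_inn]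
  rw [G.block_left k γ (by omega), faceAt_some]
  rcases k with _ | k
  · simp only [len] at hy'
    simp only [leftArm, face, arm0Face]
    rw [if_neg (show ¬ (y = G.n) by omega), if_neg (show ¬ (y + 1 = 1) by omega),
      if_neg (show ¬ (γ.isR ∧ y + 1 = 1) by omega), show y + 1 - 1 = y by ring]
    by_cases h1 : γ.m = .north
    · simp [h1, Face.Compat.inn_out]
    · simp [h1, Face.Compat.out_inn]
  · have hl := hG.add_three_le_len k
    obtain ⟨a, r, ha, ha', hr, hr', rfl⟩ := hG.exists_digit (k := k) h0 (by omega)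
    rcases lt_or_ge (r + 1) (G.len k) with h | h
    · have hK : G.rowKind k r ≠ .top := G.rowKind_ne_top (by omega)
      rw [show 1 + G.len k * a + r + 1 = 1 + G.len k * a + (r + 1) by ring,
        hG.leftArm_succ γ ha hr hr', hG.leftArm_succ γ ha (by omega) h]
      rw [if_neg (show ¬ (γ.isR ∧ a = 0 ∧ r + 1 = 0) by omega)]
      by_cases hx : γ.m = .west ∧ a = 0 ∧ r ≤ k
      · obtain ⟨hm, rfl, hrk⟩ := hx
        have e : (r + 1 ≤ k) ↔ ¬ r = k := by omega
        have e' : ¬ r + 1 = 0 := by omega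
        have hk0 (h : r = 0) : (r = k) ↔ k = 0 := by omega
        by_cases hr0 : r = 0 <;> by_cases hR : γ.isR <;> by_cases hk : r = k <;>
          simp_all [face, armFace, rfirstFace, armNorth, armSouth, effRow, nextXing,
            Face.Compat.out_inn]
      · have hx' : ¬ (γ.m = .west ∧ a = 0 ∧ r + 1 ≤ k) := by
          rintro ⟨h1, h2, h3⟩; exact hx ⟨h1, h2, by omega⟩
        have hR : ¬ (γ.isR ∧ a = 0 ∧ r = 0) := by
          rintro ⟨h1, h2, h3⟩; exact hx ⟨hRm h1, h2, by omega⟩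
        rw [if_neg hx, if_neg hx', if_neg hR]
        by_cases h1 : γ.m = .north
        · have e' : ¬ r + 1 = 0 := by omega
          simp only [face, armFace, armNorth, armSouth, effRow, h1, if_true]
          rw [rowKind]
          split_ifs <;> simp [e', Face.Compat.inn_out]
        · simp [face, armFace, armNorth, armSouth, effRow, h1, hK, nextXing, Face.Compat.out_inn]
    · obtain rfl : r = G.len k - 1 := by omega
      have ha2 : a + 1 < G.c := by
        by_contra hcon
        obtain rfl : a = G.c - 1 := by omega
        have : G.len (k + 1) = 1 + G.len k * (G.c - 1) + (G.len k - 1) + 1 := by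
          simp only [len]; ring
        omega
      have e : 1 + G.len k * a + (G.len k - 1) + 1 = 1 + G.len k * (a + 1) + 0 := by ring
      rw [e, hG.leftArm_succ γ ha hr hr', hG.leftArm_succ γ (by omega) le_rfl (by omega),
        if_neg (by omega), if_neg (by omega), if_neg (by omega), if_neg (by omega),
        hG.rowKind_top, rowKind_zero]
      have e1 : ¬ a = G.c - 1 := by omega
      have e2 : ¬ a + 1 = 0 := by omega
      by_cases h1 : γ.m = .north
      · simp [face, armFace, armNorth, armSouth, effRow, h1, e2, Face.Compat.inn_out]
      · simp [face, armFace, armNorth, armSouth, effRow, h1, e1, Face.Compat.out_inn]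

/-- The left arm fits to the subblocks to the right of it. -/
theorem Proper.compat_left (hG : G.Proper) {k : ℕ} (γ : Ctx) {b r : ℤ} (hb : 0 ≤ b)
    (hb' : b < G.c) (hr : 0 ≤ r) (hr' : r < G.len k) :
    (G.faceAt (G.block (k + 1) (some γ) 0 (1 + G.len k * b + r)) .east).Compat
      (G.faceAt (G.block (k + 1) (some γ) 1 (1 + G.len k * b + r)) .west) := by
  have hl := hG.add_three_le_len k
  have hRm : γ.isR → γ.m = .west := fun h => by rw [isR_iff.1 h]
  have h0 : 0 ≤ G.len k * b := mul_nonneg (by omega) hb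
  have hblk := G.block_sub (some γ) le_rfl (show 0 < G.len k by omega) hr hr' le_rfl hb
    (hG.col_mem b hb hb')
  rw [mul_zero, add_zero, add_zero] at hblk
  rw [hblk, G.block_left _ _ (by omega), faceAt_some, hG.leftArm_succ γ hb hr hr']
  by_cases hx : γ.m = .west ∧ b = 0 ∧ r ≤ k
  · obtain ⟨hm, rfl, hrk⟩ := hx
    have hs : G.sub (some γ) (0, 0) = some ⟨false, (0, 0), .west⟩ := by simp [sub, hm]
    rw [hs]
    rcases eq_or_lt_of_le hr with rfl | hr0
    · rw [block_west_inn (k := k) (γ := ⟨false, (0, 0), .west⟩) G rfl rfl]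
      by_cases hR : γ.isR
      · simp [hR, face, rfirstFace, crossEast, hm, Face.Compat.out_inn]
      · simp [hR, face, armFace, crossEast, hm, effRow, Face.Compat.out_inn, hrk, eq_comm]
    · rw [block_west_row (γ := ⟨false, (0, 0), .west⟩) G rfl hr0 hrk (by simp [Ctx.isR])]
      have : ¬ r = 0 := by omega
      simp [hrk, this, face, armFace, crossEast, hm, effRow, Face.Compat.out_inn]
  · rw [if_neg (fun h => hx ⟨hRm h.1, h.2.1, by omega⟩), if_neg hx]
    obtain ⟨γ', hs, hw, hm, hroot⟩ : ∃ γ' : Ctx, G.sub (some γ) (0, b) = some γ' ∧ γ'.w = (0, b) ∧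
        (γ'.m = .west → γ.m = .west ∧ b = 0) ∧ γ'.root = false := by
      by_cases hb0 : b = 0
      · exact ⟨_, by simp [sub, hb0]; rfl, by simp [hb0], by simp [hb0], rfl⟩
      · refine ⟨_, by simp [sub, hb0]; rfl, rfl, ?_, rfl⟩
        by_cases h : γ.m = .north <;> simp [h]
    have hR : γ'.isR = false := by
      rw [← Bool.not_eq_true, isR_iff]; rintro rfl; simp at hroot
    rw [hs, hG.block_west_out hr hr' _ (by simp [hR])]
    · have hc : G.childW γ' = none := by simp [childW, hw]
      have : G.westFace γ' (G.rowKind k r) = .out (.row (G.rowKind k r)) := by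
        cases G.rowKind k r <;> simp [westFace, hc]
      rw [this]
      simp [face, armFace, Face.Compat.inn_out]
    · by_contra hcon
      push Not at hcon
      obtain ⟨h1, h2⟩ := hm hcon.1
      exact hx ⟨h1, h2, hcon.2⟩

/-- Horizontally adjacent points of the pattern fit together: at most one of them is attached to the
other, as the rank decreases along the spanning tree. -/
theorem Proper.compat_pat (hG : G.Proper) (root : Bool) {x y : ℤ} (hq : (x, y) ∈ G.Q)
    (hq' : (x + 1, y) ∈ G.Q) :
    (G.patFace root (x, y) .east).Compat (G.patFace root (x + 1, y) .west) := by
  obtain ⟨rk, htree⟩ := hG.Q_tree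
  have hb := hG.Q_bounds _ _ hq
  have hb' := hG.Q_bounds _ _ hq'
  have e1 : ((x, y) : ℤ × ℤ) + Dir.east.vec = (x + 1, y) := by simp [Dir.vec]
  have e2 : ((x + 1, y) : ℤ × ℤ) + Dir.west.vec = (x, y) := by simp [Dir.vec]
  have h0 : ((x + 1, y) : ℤ × ℤ) ≠ (0, 0) := by simp; omega
  have h1 : ¬ ((x, y) = ((0, 0) : ℤ × ℤ) ∧ root = false ∧
      Dir.east = if G.pax then .west else .south) := by cases G.pax <;> simp
  have h3 : ¬ (root ∧ ((x, y) : ℤ × ℤ) = (G.n - 1, 0) ∧ Dir.east = .east) := by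
    simp; omega
  have t1 := htree _ hq
  have t2 := htree _ hq' h0
  by_cases c1 : ((x, y) : ℤ × ℤ) ≠ (0, 0) ∧ Dir.east = G.qpar (x, y)
  · have c2 : ¬ Dir.west = G.qpar (x + 1, y) := by
      intro h
      have t1 := (t1 c1.1).2
      have t2 := t2.2
      rw [← h, e2] at t2
      rw [← c1.2, e1] at t1
      omega
    have f1 : G.patFace root (x, y) .east = .inn (.single (.pat root (x, y))) := by
      rw [patFace, if_neg h1, if_pos c1]
    have f2 : G.patFace root (x + 1, y) .west = .out (.single (.pat root (x, y))) := by
      rw [patFace, if_neg (fun h => h0 h.1), if_neg (fun h => c2 h.2), e2,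
        if_pos ⟨hq, c1.1, c1.2.symm⟩]
    rw [f1, f2]
    exact .inn_out _
  · by_cases c2 : Dir.west = G.qpar (x + 1, y)
    · have f1 : G.patFace root (x, y) .east = .out (.single (.pat root (x + 1, y))) := by
        rw [patFace, if_neg h1, if_neg c1, e1, if_pos ⟨hq', h0, c2.symm⟩]
      have f2 : G.patFace root (x + 1, y) .west = .inn (.single (.pat root (x + 1, y))) := by
        rw [patFace, if_neg (fun h => h0 h.1), if_pos ⟨h0, c2⟩]
      rw [f1, f2]
      exact .out_inn _
    · have c3 : ¬ (((x, y) : ℤ × ℤ) ∈ G.Q ∧ ((x, y) : ℤ × ℤ) ≠ (0, 0) ∧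
          G.qpar (x, y) = Dir.west.opp) := fun h => c1 ⟨h.2.1, h.2.2.symm⟩
      have c4 : ¬ (((x + 1, y) : ℤ × ℤ) ∈ G.Q ∧ ((x + 1, y) : ℤ × ℤ) ≠ (0, 0) ∧
          G.qpar (x + 1, y) = Dir.east.opp) := fun h => c2 h.2.2.symm
      have f1 : G.patFace root (x, y) .east = .idle := by
        rw [patFace, if_neg h1, if_neg c1, e1, if_neg c4, if_neg h3]
        simp
      have f2 : G.patFace root (x + 1, y) .west = .idle := by
        rw [patFace, if_neg (fun h => h0 h.1), if_neg (fun h => c2 h.2), e2, if_neg c3]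
        simp
      rw [f1, f2]
      exact .quiet Face.quiet_idle Face.quiet_idle

theorem Proper.patFace_quiet_east (hG : G.Proper) {root : Bool} {x y : ℤ} (hq : (x, y) ∈ G.Q)
    (hq' : (x + 1, y) ∉ G.Q) (hx : x + 1 < G.n) : G.patFace root (x, y) .east = .idle := by
  obtain ⟨rk, htree⟩ := hG.Q_tree
  have e1 : ((x, y) : ℤ × ℤ) + Dir.east.vec = (x + 1, y) := by simp [Dir.vec]
  have h1 : ¬ ((x, y) = ((0, 0) : ℤ × ℤ) ∧ root = false ∧
      Dir.east = if G.pax then .west else .south) := by cases G.pax <;> simp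
  have c1 : ¬ (((x, y) : ℤ × ℤ) ≠ (0, 0) ∧ Dir.east = G.qpar (x, y)) := fun h => by
    have := (htree _ hq h.1).1
    rw [← h.2, e1] at this
    exact hq' this
  rw [patFace, if_neg h1, if_neg c1, e1, if_neg (fun h => hq' h.1), if_neg, if_neg]
  · simp
  · simp; omega

theorem Proper.patFace_west (hG : G.Proper) {root : Bool} {x y : ℤ} (hq : (x, y) ∈ G.Q)
    (hq' : (x - 1, y) ∉ G.Q) : G.patFace root (x, y) .west =
      if (x, y) = ((0, 0) : ℤ × ℤ) ∧ root = false ∧ G.pax then .inn (.single (.pat false (0, 0)))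
      else .idle := by
  obtain ⟨rk, htree⟩ := hG.Q_tree
  have e1 : ((x, y) : ℤ × ℤ) + Dir.west.vec = (x - 1, y) := by simp [Dir.vec]; ring
  have c1 : ¬ (((x, y) : ℤ × ℤ) ≠ (0, 0) ∧ Dir.west = G.qpar (x, y)) := fun h => by
    have := (htree _ hq h.1).1
    rw [← h.2, e1] at this
    exact hq' this
  rw [patFace, if_neg c1, e1, if_neg (show ¬ ((x - 1, y) ∈ G.Q ∧ _) from fun h => hq' h.1)]
  rcases hp : G.pax with _ | _
  · simp
  · by_cases h : (x, y) = ((0, 0) : ℤ × ℤ) ∧ root = false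
    · simp only [h.1, h.2]; simp
    · have : ¬ ((x, y) = ((0, 0) : ℤ × ℤ) ∧ root = false ∧ Dir.west = Dir.west) := by tauto
      have h' : ¬ ((x, y) = ((0, 0) : ℤ × ℤ) ∧ root = false ∧ True) := by tauto
      simp only [if_true, h', if_false]
      simp

theorem block_zero_of_mem (G : Scheme) (B : Option Ctx) {x y : ℤ} (hx : 1 ≤ x) (hy : 1 ≤ y)
    (h : (x - 1, y - 1) ∈ G.Q) : G.block 0 B x y = some (.pat B.isNone (x - 1, y - 1)) := by
  rw [block, if_pos ⟨hx, hy⟩, if_pos h]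

theorem block_zero_of_notMem (G : Scheme) (B : Option Ctx) {x y : ℤ} (hx : 1 ≤ x) (hy : 1 ≤ y)
    (h : (x - 1, y - 1) ∉ G.Q) : G.block 0 B x y = none := by
  rw [block, if_pos ⟨hx, hy⟩, if_neg h]

/-- The pattern inside a block of level `0`. -/
theorem Proper.compat_zero (hG : G.Proper) (B : Option Ctx) {x y : ℤ} (hx : 0 ≤ x)
    (hx' : x + 1 < G.len 0) (hy : 1 ≤ y) (hy' : y < G.len 0) :
    (G.faceAt (G.block 0 B x y) .east).Compat (G.faceAt (G.block 0 B (x + 1) y) .west) := by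
  simp only [len] at hx' hy'
  have hQ (q : ℤ) : (-1, q) ∉ G.Q := fun h => by have := hG.Q_bounds _ _ h; omega
  rcases eq_or_lt_of_le hx with rfl | h0
  · rw [zero_add]
    have h1 : (1 - 1, y - 1) ∈ G.Q → G.patFace B.isNone (1 - 1, y - 1) .west =
        if y = 1 ∧ B.isNone = false ∧ G.pax then .inn (.single (.pat false (0, 0))) else .idle := by
      intro h
      rw [hG.patFace_west h (by simpa using hQ _)]
      have : y - 1 = 0 ↔ y = 1 := by omega
      simp [this]
    rcases B with _ | γ
    · rw [block_none_edge G 0 (.inl rfl), faceAt_none]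
      refine .quiet Face.quiet_idle ?_
      by_cases h : (1 - 1, y - 1) ∈ G.Q
      · rw [G.block_zero_of_mem _ le_rfl hy h, faceAt_some, face, h1 h]
        simp [Face.quiet_idle]
      · rw [G.block_zero_of_notMem _ le_rfl hy h]
        exact Face.quiet_idle
    · rw [G.block_left _ _ (by omega), faceAt_some]
      by_cases h : (1 - 1, y - 1) ∈ G.Q
      · rw [G.block_zero_of_mem _ le_rfl hy h, faceAt_some, face, h1 h]
        by_cases hc : y = 1 ∧ G.pax
        · simp [leftArm, face, arm0Face, hc, Face.Compat.out_inn]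
        · simp [leftArm, face, arm0Face, hc, Face.Compat.quiet, Face.quiet_idle]
      · rw [G.block_zero_of_notMem _ le_rfl hy h]
        have : ¬ y = 1 := by
          rintro rfl; exact h (by simpa using hG.Q_zero)
        simp [leftArm, face, arm0Face, this, Face.Compat.quiet, Face.quiet_idle]
  · have e : x + 1 - 1 = x - 1 + 1 := by ring
    by_cases h1 : (x - 1, y - 1) ∈ G.Q <;> by_cases h2 : (x + 1 - 1, y - 1) ∈ G.Q
    · rw [G.block_zero_of_mem B h0 hy h1, G.block_zero_of_mem B (by omega) hy h2]
      rw [e] at h2 ⊢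
      exact hG.compat_pat _ h1 h2
    · rw [G.block_zero_of_mem B h0 hy h1, G.block_zero_of_notMem B (by omega) hy h2, faceAt_some,
        face, hG.patFace_quiet_east h1 (by rwa [← e]) (by omega)]
      exact .quiet Face.quiet_idle Face.quiet_idle
    · rw [G.block_zero_of_notMem B h0 hy h1, G.block_zero_of_mem B (by omega) hy h2, faceAt_some,
        face, hG.patFace_west h2 (by rwa [e, add_sub_cancel_right])]
      have : ¬ (x + 1 - 1 = 0) := by omega
      simp only [Prod.mk.injEq, this, false_and, if_false]
      exact .quiet Face.quiet_idle Face.quiet_idle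
    · rw [G.block_zero_of_notMem B h0 hy h1, G.block_zero_of_notMem B (by omega) hy h2]
      exact .quiet Face.quiet_idle Face.quiet_idle

/-! ### Compatibility of neighboring subblocks -/

theorem sub_eq_none_iff (G : Scheme) {B : Option Ctx} {w : ℤ × ℤ} :
    G.sub B w = none ↔ B = none ∧ w = (0, 0) := by
  rcases B with _ | γ <;> simp only [sub] <;> split_ifs <;> simp_all

theorem sub_w {B : Option Ctx} {γ : Ctx} {w : ℤ × ℤ} (h : G.sub B w = some γ) : γ.w = w := by
  rcases B with _ | γ <;> simp only [sub] at h <;> split_ifs at h <;>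
    simp only [Option.some.injEq] at h <;> subst h <;> rfl

theorem sub_root {B : Option Ctx} {γ : Ctx} {w : ℤ × ℤ} (h : G.sub B w = some γ) :
    γ.root = B.isNone := by
  rcases B with _ | γ <;> simp only [sub] at h <;> split_ifs at h <;>
    simp only [Option.some.injEq] at h <;> subst h <;> rfl

/-- In the bottom row of subblocks, either all blocks are started from the right, or all but
the first one are started from the left. -/
theorem sub_row {B : Option Ctx} {γ γ' : Ctx} {a : ℤ} (ha : 0 ≤ a) (h : G.sub B (a, 0) = some γ)
    (h' : G.sub B (a + 1, 0) = some γ') :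
    (γ.m = .east ∧ γ'.m = .east) ∨ (γ.m ≠ .east ∧ γ'.m = .west) := by
  have e : ¬ a + 1 = 0 := by omega
  rcases B with _ | β <;> simp only [sub, Prod.mk.injEq, e, if_false, if_true, and_true,
    Option.some.injEq] at h h' <;> subst h'
  · split_ifs at h
    simp_all only [Option.some.injEq]
    subst h; simp
  · split_ifs at h <;> simp_all only [Option.some.injEq] <;> subst h <;> split_ifs <;> simp_all

theorem sub_off {B : Option Ctx} {γ : Ctx} {a b : ℤ} (ha : a ≠ 0) (hb : b ≠ 0)
    (h : G.sub B (a, b) = some γ) : γ.m = G.par (a, b) := by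
  rcases B with _ | β <;> simp [sub, ha, hb] at h <;> rw [← h]

theorem sub_col {B : Option Ctx} {γ : Ctx} {b : ℤ} (hb : b ≠ 0)
    (h : G.sub B (0, b) = some γ) : γ.m = .south ∨ γ.m = .north := by
  rcases B with _ | β <;> simp [sub, hb] at h <;> rw [← h]
  · simp
  · by_cases h : β.m = .north <;> simp [h]

theorem Proper.par_mem (hG : G.Proper) {a b : ℤ} (h : (a, b) ∈ G.V) (ha : a ≠ 0) (hb : b ≠ 0) :
    (a, b) + (G.par (a, b)).vec ∈ G.V := by
  obtain ⟨rk, htree⟩ := hG.tree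
  exact (htree _ h ha hb).1

theorem Proper.not_east_west (hG : G.Proper) {a b : ℤ} (h : (a, b) ∈ G.V) (h' : (a + 1, b) ∈ G.V)
    (ha : 0 < a) (hb : b ≠ 0) (h1 : G.par (a, b) = .east) : G.par (a + 1, b) ≠ .west := by
  intro h2
  obtain ⟨rk, htree⟩ := hG.tree
  have t1 := (htree _ h (by simp; omega) hb).2
  have t2 := (htree _ h' (by simp; omega) hb).2
  rw [h1] at t1
  rw [h2] at t2
  simp [Dir.vec] at t1 t2
  omega

/-- If a block is started from the right, its right neighbor is aware of this. -/
theorem Proper.sibling_east (hG : G.Proper) {B : Option Ctx} {γ γ' : Ctx} {a b : ℤ}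
    (hV : (a, b) ∈ G.V) (hV' : (a + 1, b) ∈ G.V)
    (h : G.sub B (a, b) = some γ) (h' : G.sub B (a + 1, b) = some γ') (hm : γ.m = .east) :
    γ'.m ≠ .west ∧ G.childW γ' = some γ := by
  obtain ⟨ha, -, hb, -⟩ := hG.V_bounds _ _ hV
  have hw := sub_w h
  have hw' := sub_w h'
  have hr := sub_root h
  have hr' := sub_root h'
  have hγ : γ = ⟨γ'.root, (γ'.w.1 - 1, γ'.w.2), .east⟩ := by
    ext <;> simp [hw, hw', hr, hr', hm]
  rcases eq_or_lt_of_le hb with rfl | hb0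
  · have := sub_row ha h h'
    simp only [hm, true_and, ne_eq, not_true, false_and, or_false] at this
    refine ⟨by simp [this], ?_⟩
    rw [childW, if_pos (.inl ⟨by rw [hw'], this, by rw [hw']; simp; omega⟩), ← hγ]
  · rcases eq_or_lt_of_le ha with rfl | ha0
    · have := sub_col hb0.ne' h
      simp [hm] at this
    · rw [sub_off (by omega) (by omega) h] at hm
      refine ⟨?_, ?_⟩
      · rw [sub_off (by omega) (by omega) h']
        exact hG.not_east_west hV hV' ha0 hb0.ne' hm
      · rw [childW, if_pos, ← hγ]
        right
        rw [hw']
        simpa [hV, hm] using ⟨by omega, by omega⟩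

/-- If a block is started from the left, its left neighbor is aware of this. -/
theorem Proper.sibling_west (hG : G.Proper) {B : Option Ctx} {γ γ' : Ctx} {a b : ℤ}
    (hV : (a, b) ∈ G.V) (hV' : (a + 1, b) ∈ G.V)
    (h : G.sub B (a, b) = some γ) (h' : G.sub B (a + 1, b) = some γ') (hm : γ'.m = .west) :
    G.swap.childN γ.swap = some γ'.swap := by
  obtain ⟨ha, -, hb, -⟩ := hG.V_bounds _ _ hV
  obtain ⟨-, ha', -, -⟩ := hG.V_bounds _ _ hV'
  have hw := sub_w h
  have hw' := sub_w h'
  have hr := sub_root h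
  have hr' := sub_root h'
  have hγ : γ'.swap = ⟨γ.swap.root, (γ.swap.w.1, γ.swap.w.2 + 1), .south⟩ := by
    ext <;> simp [hw, hw', hr, hr', hm]
  rw [childN, if_pos, ← hγ]
  rcases eq_or_lt_of_le hb with rfl | hb0
  · left
    simp [hw]; omega
  · right
    rw [sub_off (by omega) (by omega) h'] at hm
    simp [hw, hV', hm]; omega

/-- If neither of two horizontal neighbors starts the other one, both are aware of this. -/
theorem Proper.sibling_idle (hG : G.Proper) {B : Option Ctx} {γ γ' : Ctx} {a b : ℤ}
    (hV : (a, b) ∈ G.V)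
    (h : G.sub B (a, b) = some γ) (h' : G.sub B (a + 1, b) = some γ') (hm : γ.m ≠ .east)
    (hm' : γ'.m ≠ .west) :
    G.childW γ' = none ∧ G.swap.childN γ.swap = none := by
  obtain ⟨ha, -, hb, -⟩ := hG.V_bounds _ _ hV
  have hw := sub_w h
  have hw' := sub_w h'
  rcases eq_or_lt_of_le hb with rfl | hb0
  · have := sub_row ha h h'
    tauto
  · have := sub_off (by omega) (by omega) h'
    rw [this] at hm'
    rw [childW, if_neg, childN, if_neg]
    · simp
    · simp [hw, hm', Dir.swap_eq_iff]; omega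
    · simp [hw', hb0.ne']
      intro h1 h2 h3
      exact fun h4 => hm (by rw [sub_off (by omega) (by omega) h]; exact h4)

theorem endFace_of_child (G : Scheme) {γ γ' : Ctx} {z : Bool} (hw : γ.w ≠ (0, G.c - 1))
    (h : G.childN γ = some γ') : G.endFace γ z = .out (.single (.corner γ' z)) := by
  simp [endFace, hw, h]

theorem endFace_of_none (G : Scheme) {γ : Ctx} {z : Bool} (hw : γ.w ≠ (0, G.c - 1))
    (h : G.childN γ = none) : G.endFace γ z = .idle := by
  simp [endFace, hw, h]

theorem Proper.block_east_quiet (hG : G.Proper) {k : ℕ} {γ : Ctx} (hγ : G.ValidCtx γ) {r : ℤ}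
    (hr : 0 ≤ r) (hr' : r < G.len k) (hm : γ.m ≠ .east) (hw : γ.w.1 ≠ G.c - 1)
    (hc : r = 0 → G.swap.childN γ.swap = none) :
    (G.faceAt (G.block k (some γ) (G.len k - 1) r) .east).Quiet := by
  have := hG.block_east hγ hr hr'
  rcases lt_or_ge (k : ℤ) r with h | h
  · exact this.1 h
  · rw [this.2 h, eastFace, if_neg hm]
    split_ifs with h0
    · rw [endFace_of_none _ _ (hc h0)]
      · exact Face.quiet_idle
      · rw [Ctx.swap_w]
        intro h
        rw [Prod.swap_eq_mk] at h
        exact hw (by rw [h]; rfl)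
    · exact Face.quiet_row _

theorem isR_false {γ : Ctx} (h : γ.w ≠ (1, 0) ∨ γ.root = false) : γ.isR = false := by
  rw [← Bool.not_eq_true, isR_iff]
  rintro rfl
  simp at h

/-- Compatibility of two adjacent subblocks that both carry arms. -/
theorem Proper.compat_sibling (hG : G.Proper) (k : ℕ) {B : Option Ctx} {γ γ' : Ctx} {a b r : ℤ}
    (hV : (a, b) ∈ G.V) (hV' : (a + 1, b) ∈ G.V) (hr : 0 ≤ r) (hr' : r < G.len k)
    (h : G.sub B (a, b) = some γ) (h' : G.sub B (a + 1, b) = some γ') :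
    (G.faceAt (G.block k (some γ) (G.len k - 1) r) .east).Compat
      (G.faceAt (G.block k (some γ') 0 r) .west) := by
  obtain ⟨ha, -, hb, -⟩ := hG.V_bounds _ _ hV
  obtain ⟨-, ha', -, -⟩ := hG.V_bounds _ _ hV'
  have hγ := valid_sub hV h
  have hw := sub_w h
  have hw' := sub_w h'
  have hr1 := sub_root h
  have hr2 := sub_root h'
  have hws : γ.swap.w ≠ (0, G.swap.c - 1) := by simp [hw]; omega
  have hR : γ'.isR = false := by
    rw [← Bool.not_eq_true, isR_iff]
    rintro rfl
    have e1 : a = 0 := by simp at hw'; omega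
    have e2 : b = 0 := by simp at hw'; omega
    subst e1 e2
    rcases B with _ | β
    · simp [sub] at h
    · simp at hr2
  have hE := hG.block_east hγ hr hr' (k := k)
  rcases lt_or_ge (k : ℤ) r with hk | hk
  · rw [hG.block_west_out hr hr' (.inr hk) (by simp [hR])]
    exact .quiet (hE.1 hk) (G.westFace_quiet_of_lt hk)
  by_cases hm : γ.m = .east
  · obtain ⟨h1, h2⟩ := hG.sibling_east hV hV' h h' hm
    rw [hE.2 hk, hG.block_west_out hr hr' (.inl h1) (by simp [hR]), G.rowKind_cross hk, westFace,
      h2, eastFace, if_pos hm]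
    simp only [decide_eq_true_eq]
    exact .inn_out _
  · by_cases hm' : γ'.m = .west
    · have h2 := hG.sibling_west hV hV' h h' hm'
      rw [hE.2 hk, eastFace, if_neg hm]
      rcases eq_or_lt_of_le hr with rfl | hr0
      · rw [if_pos rfl, G.swap.endFace_of_child hws h2, block_west_inn G hR hm']
        simp only [Face.swap, Label.swap, Kind.swap, Ctx.swap_swap]
        exact .out_inn _
      · rw [if_neg (by omega), G.block_west_row hm' hr0 hk (by simp [hR])]
        exact .out_inn _
    · obtain ⟨h1, h2⟩ := hG.sibling_idle hV h h' hm hm'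
      rw [hG.block_west_out hr hr' (.inl hm') (by simp [hR])]
      exact .quiet (hG.block_east_quiet hγ hr hr' hm (by rw [hw]; simp; omega) fun _ => h2)
        (G.westFace_quiet h1)

/-- The right side of a block at the origin. -/
theorem Proper.top_east (hG : G.Proper) (k : ℕ) {y : ℤ} (hy : 0 ≤ y) (hy' : y < G.len k) :
    (2 ≤ y → y ≤ k → G.faceAt (G.block k none (G.len k - 1) y) .east =
      .out (.row (.cross false (y = k)))) ∧
    (y = 1 → G.faceAt (G.block k none (G.len k - 1) y) .east = .out (.single
      (match k with | 0 => .arm0 true rctx 1 | k + 1 => .rfirst true rctx (k = 0)))) ∧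
    (y = 0 ∨ (2 ≤ y ∧ k < y) → (G.faceAt (G.block k none (G.len k - 1) y) .east).Quiet) := by
  have hn := hG.two_le_n
  have hc := hG.two_le_c
  rcases eq_or_lt_of_le hy with rfl | h0
  · refine ⟨fun h => by omega, fun h => by omega, fun _ => ?_⟩
    rw [G.block_none_edge k (.inr rfl)]
    exact Face.quiet_idle
  rcases k with _ | k
  · simp only [len] at hy' ⊢
    rw [add_sub_cancel_right]
    refine ⟨fun h h' => by simp at h'; omega, ?_, fun h => ?_⟩
    · rintro rfl
      rw [G.block_zero_of_mem none (by omega) le_rfl hG.Q_right, faceAt_some, face,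
        sub_self, hG.patFace_east hG.Q_right]
      simp
    · by_cases hq : (G.n - 1, y - 1) ∈ G.Q
      · rw [G.block_zero_of_mem none (by omega) h0 hq, faceAt_some, face, hG.patFace_east hq,
          if_neg (by omega)]
        exact Face.quiet_idle
      · rw [G.block_zero_of_notMem none (by omega) h0 hq]
        exact Face.quiet_idle
  · have hl := hG.add_three_le_len k
    have e : G.len (k + 1) - 1 = 1 + G.len k * (G.c - 1) + (G.len k - 1) := by simp only [len]; ring
    obtain ⟨b, r, hb, hb', hr, hr', rfl⟩ := hG.exists_digit h0 hy'
    rw [e]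
    rcases eq_or_lt_of_le hb with rfl | hb0
    · have hmem := hG.row_mem (G.c - 1) (by omega) (by omega)
      have hs : G.sub none (G.c - 1, 0) = some ⟨true, (G.c - 1, 0), .west⟩ := by
        have : G.c - 1 ≠ 0 := by omega
        simp [sub, this]
      rw [G.block_sub _ (by omega) (by omega) hr hr' (by omega) le_rfl hmem, hs]
      have := hG.block_east (valid_sub hmem hs) hr hr' (k := k)
      push_cast
      refine ⟨fun h h' => ?_, fun h => ?_, fun h => this.1 (by omega)⟩
      · have e1 : 1 + G.len k * 0 + r = k + 1 ↔ r = k := by omega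
        rw [this.2 (by omega), eastFace, if_neg (by simp), if_neg (by omega)]
        simp only [e1]
      · obtain rfl : r = 0 := by omega
        rw [this.2 (by omega), eastFace, if_neg (by simp), if_pos rfl]
        simp [endFace, Face.swap, Label.swap, Kind.swap]
    · have hlb : G.len k ≤ G.len k * b := by nlinarith
      push_cast
      refine ⟨fun _ h => by omega, fun h => by omega, fun _ => ?_⟩
      by_cases hV : (G.c - 1, b) ∈ G.V
      · rw [G.block_sub _ (by omega) (by omega) hr hr' (by omega) hb hV]
        obtain ⟨γ, hs⟩ : ∃ γ, G.sub none (G.c - 1, b) = some γ := by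
          rw [← Option.ne_none_iff_exists', ne_eq, sub_eq_none_iff]
          simp; omega
        have hval := valid_sub hV hs
        have := hG.block_east hval hr hr' (k := k)
        rw [hs]
        rcases lt_or_ge (k : ℤ) r with h | h
        · exact this.1 h
        · rw [this.2 h]
          exact hG.eastFace_quiet hval hb0 (sub_w hs)
      · rw [G.block_sub_none _ (by omega) (by omega) hr hr' (by omega) hb hV]
        exact Face.quiet_idle

theorem childW_rctx (G : Scheme) : G.childW rctx = none := by simp [childW]

/-- Compatibility of a block at the origin with the block to the right of it. -/
theorem Proper.compat_top (hG : G.Proper) (k : ℕ) {r : ℤ} (hr : 0 ≤ r) (hr' : r < G.len k) :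
    (G.faceAt (G.block k none (G.len k - 1) r) .east).Compat
      (G.faceAt (G.block k (some rctx) 0 r) .west) := by
  have hE := hG.top_east k hr hr'
  have hR : rctx.isR := by simp [Ctx.isR]
  rcases eq_or_lt_of_le hr with rfl | h0
  · refine .quiet (hE.2.2 (.inl rfl)) ?_
    rw [block_corner, faceAt_some, face, cornerWest]
    simp [hR, Face.quiet_idle]
  · by_cases h1 : r = 1
    · subst h1
      rw [hE.2.1 rfl, G.block_left _ _ (by omega), faceAt_some]
      rcases k with _ | k
      · simp [leftArm, face, arm0Face, hR, Face.Compat.out_inn]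
      · simp [leftArm, face, rfirstFace, hR, Face.Compat.out_inn]
    · rcases lt_or_ge (k : ℤ) r with h | h
      · rw [hG.block_west_out hr hr' (.inr h) (fun _ => h1)]
        exact .quiet (hE.2.2 (.inr ⟨by omega, h⟩)) (G.westFace_quiet G.childW_rctx)
      · rw [hE.1 (by omega) h, G.block_west_row rfl h0 h (by omega)]
        exact .out_inn _

/-- The contexts of blocks that occur, including those of the blocks at the origin. -/
def Valid (G : Scheme) (B : Option Ctx) : Prop := ∀ γ, B = some γ → G.ValidCtx γ

/-- Tiles on the two sides of a boundary between two columns of subblocks fit together. -/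
theorem Proper.compat_boundary (hG : G.Proper) (k : ℕ) {B : Option Ctx} {a b r : ℤ}
    (ha : 0 ≤ a) (ha' : a + 1 < G.c) (hb : 0 ≤ b) (hb' : b < G.c)
    (hr : 0 ≤ r) (hr' : r < G.len k) :
    (G.faceAt (G.block (k + 1) B (1 + G.len k * a + (G.len k - 1)) (1 + G.len k * b + r))
      .east).Compat
      (G.faceAt (G.block (k + 1) B (1 + G.len k * (a + 1) + 0) (1 + G.len k * b + r)) .west) := by
  have hl := hG.add_three_le_len k
  by_cases hV : (a, b) ∈ G.V <;> by_cases hV' : (a + 1, b) ∈ G.V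
  · rw [G.block_sub _ (by omega) (by omega) hr hr' ha hb hV,
      G.block_sub _ le_rfl (by omega) hr hr' (by omega) hb hV']
    obtain ⟨γ', h'⟩ : ∃ γ, G.sub B (a + 1, b) = some γ := by
      rw [← Option.ne_none_iff_exists', ne_eq, sub_eq_none_iff]
      simp; omega
    rcases h : G.sub B (a, b) with _ | γ
    · rw [sub_eq_none_iff] at h
      obtain ⟨rfl, h⟩ := h
      obtain ⟨rfl, rfl⟩ := Prod.mk.inj h
      have : G.sub none (0 + 1, 0) = some rctx := by simp [sub]
      rw [this]
      exact hG.compat_top k hr hr'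
    · rw [h']
      exact hG.compat_sibling k hV hV' hr hr' h h'
  · rw [G.block_sub _ (by omega) (by omega) hr hr' ha hb hV,
      G.block_sub_none _ le_rfl (by omega) hr hr' (by omega) hb hV']
    have hb0 : b ≠ 0 := by rintro rfl; exact hV' (hG.row_mem _ (by omega) ha')
    obtain ⟨γ, h⟩ : ∃ γ, G.sub B (a, b) = some γ := by
      rw [← Option.ne_none_iff_exists', ne_eq, sub_eq_none_iff]
      simp [hb0]
    rw [h]
    refine .quiet (hG.block_east_quiet (valid_sub hV h) hr hr' ?_ ?_ fun _ => ?_) Face.quiet_idle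
    · rcases eq_or_lt_of_le ha with rfl | ha0
      · rcases sub_col hb0 h with h | h <;> simp [h]
      · rw [sub_off (by omega) hb0 h]
        intro h1
        have := hG.par_mem hV (by omega) hb0
        rw [h1] at this
        exact hV' (by simpa [Dir.vec] using this)
    · rw [sub_w h]; simp; omega
    · simp [childN, sub_w h, hb0, hV']
  · rw [G.block_sub_none _ (by omega) (by omega) hr hr' ha hb hV,
      G.block_sub _ le_rfl (by omega) hr hr' (by omega) hb hV']
    have hb0 : b ≠ 0 := by rintro rfl; exact hV (hG.row_mem _ (by omega) (by omega))
    obtain ⟨γ, h⟩ : ∃ γ, G.sub B (a + 1, b) = some γ := by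
      rw [← Option.ne_none_iff_exists', ne_eq, sub_eq_none_iff]
      simp [hb0]
    have hR : γ.isR = false := isR_false (.inl (by rw [sub_w h]; simp [hb0]))
    have hm : γ.m ≠ .west := by
      rw [sub_off (by omega) hb0 h]
      intro h1
      have := hG.par_mem hV' (by omega) hb0
      rw [h1] at this
      exact hV (by simpa [Dir.vec] using this)
    rw [h, hG.block_west_out hr hr' (.inl hm) (by simp [hR])]
    refine .quiet Face.quiet_idle (G.westFace_quiet ?_)
    simp [childW, sub_w h, hb0, hV]
  · rw [G.block_sub_none _ (by omega) (by omega) hr hr' ha hb hV,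
      G.block_sub_none _ le_rfl (by omega) hr hr' (by omega) hb hV']
    exact .quiet Face.quiet_idle Face.quiet_idle

theorem Proper.compat_bottom (hG : G.Proper) (k : ℕ) (γ : Ctx) {x : ℤ} (hx : 0 ≤ x)
    (hx' : x + 1 < G.len k) :
    (G.faceAt (G.block k (some γ) x 0) .east).Compat
      (G.faceAt (G.block k (some γ) (x + 1) 0) .west) := by
  have h := (hG.swap.compat_along k γ.swap hx (by simpa using hx')).swap
  have e (x : ℤ) (hx : 0 ≤ x) (u : Dir) :
      (G.swap.faceAt (G.swap.block k (some γ.swap) 0 x) u).swap =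
      G.faceAt (G.block k (some γ) x 0) u.swap := by
    have h1 := hG.block_swap k (some γ) x 0 hx le_rfl
    have h2 := G.faceAt_swap (G.block k (some γ) x 0) u.swap
    rw [Dir.swap_swap, ← h1] at h2
    rw [← Face.swap_swap (G.faceAt (G.block k (some γ) x 0) u.swap), ← h2]
    rfl
  rwa [e _ hx, e _ (by omega)] at h

/-- Horizontally adjacent tiles of a block fit together. -/
theorem Proper.compat_east (hG : G.Proper) (k : ℕ) (B : Option Ctx) {x y : ℤ}
    (hx : 0 ≤ x) (hx' : x + 1 < G.len k) (hy : 0 ≤ y) (hy' : y < G.len k) :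
    (G.faceAt (G.block k B x y) .east).Compat (G.faceAt (G.block k B (x + 1) y) .west) := by
  rcases eq_or_lt_of_le hy with rfl | hy0
  · rcases B with _ | γ
    · rw [G.block_none_edge k (.inr rfl), G.block_none_edge k (.inr rfl)]
      exact .quiet Face.quiet_idle Face.quiet_idle
    · exact hG.compat_bottom k γ hx hx'
  induction k generalizing B x y with
  | zero => exact hG.compat_zero B hx hx' hy0 hy'
  | succ k ih =>
    have hl := hG.add_three_le_len k
    obtain ⟨b, s, hb, hb', hs, hs', rfl⟩ := hG.exists_digit (k := k) (by omega : 1 ≤ y) hy'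
    rcases eq_or_lt_of_le hx with rfl | hx0
    · rw [zero_add]
      rcases B with _ | γ
      · rw [G.block_none_edge _ (.inl rfl)]
        refine .quiet Face.quiet_idle ?_
        have hblk := G.block_sub none le_rfl (show 0 < G.len k by omega) hs hs' le_rfl hb
          (hG.col_mem b hb hb')
        rw [mul_zero, add_zero, add_zero] at hblk
        rw [hblk]
        by_cases hb0 : b = 0
        · subst hb0
          have : G.sub none (0, 0) = none := by simp [sub]
          rw [this, G.block_none_edge _ (.inl rfl)]
          exact Face.quiet_idle
        · have : G.sub none (0, b) = some ⟨true, (0, b), .south⟩ := by simp [sub, hb0]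
          rw [this, hG.block_west_out hs hs' (.inl (by simp)) (by simp [Ctx.isR])]
          exact G.westFace_quiet (by simp [childW])
      · exact hG.compat_left γ hb hb' hs hs'
    · obtain ⟨a, r, ha, ha', hr, hr', rfl⟩ := hG.exists_digit (k := k) (by omega : 1 ≤ x) (by omega)
      rcases lt_or_ge (r + 1) (G.len k) with h | h
      · rw [show 1 + G.len k * a + r + 1 = 1 + G.len k * a + (r + 1) by ring]
        by_cases hV : (a, b) ∈ G.V
        · rw [G.block_sub _ hr hr' hs hs' ha hb hV, G.block_sub _ (by omega) h hs hs' ha hb hV]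
          rcases eq_or_lt_of_le hs with rfl | hs0
          · rcases hB : G.sub B (a, b) with _ | γ
            · rw [G.block_none_edge k (.inr rfl), G.block_none_edge k (.inr rfl)]
              exact .quiet Face.quiet_idle Face.quiet_idle
            · exact hG.compat_bottom k γ hr h
          · exact ih _ hr h hs hs' hs0
        · rw [G.block_sub_none _ hr hr' hs hs' ha hb hV,
            G.block_sub_none _ (by omega) h hs hs' ha hb hV]
          exact .quiet Face.quiet_idle Face.quiet_idle
      · obtain rfl : r = G.len k - 1 := by omega
        rw [show 1 + G.len k * a + (G.len k - 1) + 1 = 1 + G.len k * (a + 1) + 0 by ring]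
        refine hG.compat_boundary k ha ?_ hb hb' hs hs'
        by_contra hcon
        obtain rfl : a = G.c - 1 := by omega
        have : G.len (k + 1) = 1 + G.len k * (G.c - 1) + (G.len k - 1) + 1 := by
          simp only [len]; ring
        omega

/-- Vertically adjacent tiles of a block fit together. -/
theorem Proper.compat_north (hG : G.Proper) (k : ℕ) (B : Option Ctx) {x y : ℤ}
    (hx : 0 ≤ x) (hx' : x < G.len k) (hy : 0 ≤ y) (hy' : y + 1 < G.len k) :
    (G.faceAt (G.block k B x y) .north).Compat (G.faceAt (G.block k B x (y + 1)) .south) := by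
  have h := (hG.swap.compat_east k (B.map Ctx.swap) hy (by simpa using hy') hx
    (by simpa using hx')).swap
  rw [hG.block_swap k B x y hx hy, hG.block_swap k B x (y + 1) hx (by omega)] at h
  rw [← Dir.swap_north, ← Dir.swap_south, faceAt_swap, faceAt_swap] at h
  simpa using h

end Scheme
/-! ### From a blueprint to a tile assembly system -/

/-- The strength through which a tile is attached at a face. -/
def Face.inStr {Λ : Type} (str : Λ → ℕ) : Face Λ → ℕ
  | .inn L => str L
  | _ => 0

/-- An assignment of kinds of tiles to the points of a set, together with labelled faces of the
kinds, that makes the set grow from the origin in a unique way. The labels in `binding` are only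
presented to neighbors that are attached through them, and a kind is determined by a
binding label and the labels at the other sides through which it is attached. -/
structure Blueprint (κ Λ : Type) where
  face : κ → Dir → Face Λ
  str : Λ → ℕ
  binding : Λ → Prop
  kind : ℤ × ℤ → Option κ
  seed : κ
  str_pos : ∀ L, 0 < str L
  kind_zero : kind (0, 0) = some seed
  seed_ne_inn : ∀ u L, face seed u ≠ .inn L
  exists_inn : ∀ p k u L, kind p = some k → face k u = .out L → binding L →
    ∃ k', kind (p + u.vec) = some k' ∧ face k' u.opp = .inn L
  exists_out : ∀ p k u L, kind p = some k → face k u = .inn L →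
    ∃ k', kind (p + u.vec) = some k' ∧ face k' u.opp = .out L
  sum_inStr : ∀ p k, kind p = some k → p ≠ (0, 0) → ∑ u, (face k u).inStr str = 2
  exists_binding : ∀ p k, kind p = some k → p ≠ (0, 0) → ∃ u L, face k u = .inn L ∧ binding L
  inn_of_binding : ∀ k k' u L, face k u = .inn L → face k' u = .inn L → binding L →
    ∀ u' L', face k' u' = .inn L' → ∃ L'', face k u' = .inn L''
  eq_of_binding : ∀ k k' u L, face k u = .inn L → face k' u = .inn L → binding L →
    (∀ u' L', face k' u' = .inn L' → face k u' = .inn L') → k = k'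
  induction : ∀ S : Set (ℤ × ℤ), (∀ p, (∀ k u L, kind p = some k → face k u = .inn L →
    p + u.vec ∈ S) → p ∈ S) → S = Set.univ
  finite_kinds : {k | ∃ p, kind p = some k}.Finite
  infinite_dom : {p | ∃ k, kind p = some k}.Infinite

namespace Blueprint

variable {κ Λ : Type} (P : Blueprint κ Λ)

/-- The points with a tile. -/
def dom : Set (ℤ × ℤ) := {p | ∃ k, P.kind p = some k}

/-- A set that with each point contains those to which its tile is attached. -/
structure Closed (S : Set (ℤ × ℤ)) : Prop where
  subset : S ⊆ P.dom
  zero_mem : (0, 0) ∈ S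
  mem : ∀ p ∈ S, ∀ k u L, P.kind p = some k → P.face k u = .inn L → p + u.vec ∈ S

theorem closed_dom : P.Closed P.dom where
  subset := subset_rfl
  zero_mem := ⟨_, P.kind_zero⟩
  mem p _ k u L hk hu := by
    obtain ⟨k', h, -⟩ := P.exists_out p k u L hk hu
    exact ⟨k', h⟩

theorem closed_singleton : P.Closed {(0, 0)} where
  subset := by rintro _ rfl; exact ⟨_, P.kind_zero⟩
  zero_mem := rfl
  mem := by
    rintro _ rfl k u L hk hu
    rw [P.kind_zero] at hk
    cases hk
    exact absurd hu (P.seed_ne_inn u L)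

theorem add_vec_opp (p : ℤ × ℤ) (u : Dir) : p + u.vec + u.opp.vec = p := by
  rw [Dir.vec_opp, add_neg_cancel_right]

/-- A nonempty set without the origin has a point whose tile is not attached to this set. -/
theorem exists_minimal {D : Set (ℤ × ℤ)} (hD : D ⊆ P.dom) (hne : D.Nonempty) :
    ∃ p ∈ D, ∃ k, P.kind p = some k ∧ ∀ u L, P.face k u = .inn L → p + u.vec ∉ D := by
  by_contra hcon
  push Not at hcon
  have := P.induction Dᶜ fun p hp hpD => by
    obtain ⟨k, hk⟩ := hD hpD
    obtain ⟨u, L, h, h'⟩ := hcon p hpD k hk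
    exact hp k u L hk h h'
  obtain ⟨p, hp⟩ := hne
  have h : p ∈ Dᶜ := by rw [this]; trivial
  exact h hp

/-- The points at which a tile can be added to the finite set `S`. -/
def eligible (S : Finset (ℤ × ℤ)) : Set (ℤ × ℤ) :=
  {p | p ∉ S ∧ ∃ k, P.kind p = some k ∧ ∀ u L, P.face k u = .inn L → p + u.vec ∈ S}

theorem eligible_nonempty (S : Finset (ℤ × ℤ)) : (P.eligible S).Nonempty := by
  have hinf : (P.dom \ (S : Set (ℤ × ℤ))).Infinite := P.infinite_dom.sdiff S.finite_toSet
  obtain ⟨p, hp, k, hk, h⟩ := P.exists_minimal Set.sdiff_subset hinf.nonempty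
  refine ⟨p, hp.2, k, hk, fun u L hL => ?_⟩
  have h1 := h u L hL
  obtain ⟨k', hk', -⟩ := P.exists_out p k u L hk hL
  by_contra hcon
  exact h1 ⟨⟨k', hk'⟩, hcon⟩

/-- The eligible point with the least number in an enumeration of the plane. -/
noncomputable def pick (S : Finset (ℤ × ℤ)) : ℤ × ℤ :=
  Function.argminOn (Encodable.encode : ℤ × ℤ → ℕ) (P.eligible S) (P.eligible_nonempty S)

theorem pick_mem (S : Finset (ℤ × ℤ)) : P.pick S ∈ P.eligible S :=
  Function.argminOn_mem _ _ _

theorem encode_pick_le (S : Finset (ℤ × ℤ)) {p : ℤ × ℤ} (hp : p ∈ P.eligible S) :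
    Encodable.encode (P.pick S) ≤ Encodable.encode p :=
  Function.argminOn_le _ _ hp

/-- The domains of an assembly sequence in which the eligible point with the least number
is added in each step. -/
noncomputable def stages : ℕ → Finset (ℤ × ℤ)
  | 0 => {(0, 0)}
  | i + 1 => insert (P.pick (stages i)) (stages i)

theorem stages_mono : Monotone P.stages :=
  monotone_nat_of_le_succ fun _ => Finset.subset_insert _ _

theorem closed_stages (i : ℕ) : P.Closed (P.stages i : Set (ℤ × ℤ)) := by
  induction i with
  | zero => simpa [stages] using P.closed_singleton
  | succ i ih =>
    obtain ⟨-, k, hk, h⟩ := P.pick_mem (P.stages i)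
    rw [stages, Finset.coe_insert]
    refine ⟨?_, .inr ih.zero_mem, ?_⟩
    · rintro p (rfl | hp)
      · exact ⟨k, hk⟩
      · exact ih.subset hp
    · rintro p (rfl | hp) k' u L hk' hu
      · rw [hk] at hk'
        cases hk'
        exact .inr (h u L hu)
      · exact .inr (ih.mem p hp k' u L hk' hu)

/-- Every point is reached: a point that stays eligible forever would have infinitely many
points with smaller numbers. -/
theorem exists_mem_stages {p : ℤ × ℤ} (hp : p ∈ P.dom) : ∃ i, p ∈ P.stages i := by
  have := P.induction {p | p ∈ P.dom → ∃ i, p ∈ P.stages i} fun p ih hp => by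
    obtain ⟨k, hk⟩ := hp
    have hin : ∀ u, ∃ i, ∀ L, P.face k u = .inn L → p + u.vec ∈ P.stages i := by
      intro u
      by_cases h : ∃ L, P.face k u = .inn L
      · obtain ⟨L, hL⟩ := h
        obtain ⟨k', hk', -⟩ := P.exists_out p k u L hk hL
        obtain ⟨i, hi⟩ := ih k u L hk hL ⟨k', hk'⟩
        exact ⟨i, fun _ _ => hi⟩
      · exact ⟨0, fun L hL => absurd ⟨L, hL⟩ h⟩
    choose f hf using hin
    by_contra hcon
    push Not at hcon
    have hel (j : ℕ) : p ∈ P.eligible (P.stages (∑ u, f u + j)) := by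
      refine ⟨hcon _, k, hk, fun u L hL => P.stages_mono ?_ (hf u L hL)⟩
      exact (Finset.single_le_sum (fun _ _ => Nat.zero_le _) (Finset.mem_univ u)).trans
        (Nat.le_add_right _ j)
    have hinj : Function.Injective fun j => P.pick (P.stages (∑ u, f u + j)) := by
      intro i j hij
      by_contra hne
      wlog hlt : i < j generalizing i j
      · exact this hij.symm (Ne.symm hne) (by omega)
      have h1 : P.pick (P.stages (∑ u, f u + i)) ∈ P.stages (∑ u, f u + i + 1) :=
        Finset.mem_insert_self _ _
      have h2 := P.stages_mono (show ∑ u, f u + i + 1 ≤ ∑ u, f u + j by omega) h1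
      simp only at hij
      rw [hij] at h2
      exact (P.pick_mem _).1 h2
    have hfin : (Set.range fun j => P.pick (P.stages (∑ u, f u + j))).Finite := by
      refine Set.Finite.subset ((Set.finite_Iic (Encodable.encode p)).preimage
        (Encodable.encode_injective.injOn (s := Set.univ) |>.mono (Set.subset_univ _))) ?_
      rintro _ ⟨j, rfl⟩
      exact P.encode_pick_le _ (hel j)
    exact Set.infinite_range_of_injective hinj hfin
  have h : p ∈ {p | p ∈ P.dom → ∃ i, p ∈ P.stages i} := by rw [this]; trivial
  exact h hp

variable [Countable Λ]

/-- A numbering of pairs of a label and a direction. -/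
noncomputable def code (x : Λ × Dir) : ℕ := (exists_injective_nat (Λ × Dir)).choose x

omit P in
theorem code_injective : Function.Injective (code (Λ := Λ)) :=
  (exists_injective_nat (Λ × Dir)).choose_spec

/-- The tile type of a kind. The color of a glue encodes its label and the direction of growth. -/
noncomputable def tile (k : κ) : TileType Unit := fun u =>
  match P.face k u with
  | .idle => ([], 0)
  | .inn L => (List.replicate (code (L, u.opp)) (), P.str L)
  | .out L => (List.replicate (code (L, u)) (), P.str L)

/-- The tile types of the kinds that occur. -/
def tiles : Set (TileType Unit) := {t | ∃ p k, P.kind p = some k ∧ t = P.tile k}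

theorem tiles_finite : P.tiles.Finite := by
  refine (P.finite_kinds.image P.tile).subset ?_
  rintro t ⟨p, k, h, rfl⟩
  exact ⟨k, ⟨p, h⟩, rfl⟩

open Classical in
/-- The configuration that the blueprint describes, restricted to `S`. -/
noncomputable def conf (S : Set (ℤ × ℤ)) : Config P.tiles := fun p =>
  if h : p ∈ S ∧ ∃ k, P.kind p = some k then
    some ⟨P.tile h.2.choose, p, h.2.choose, h.2.choose_spec, rfl⟩
  else none

theorem conf_eq_some {S : Set (ℤ × ℤ)} {p : ℤ × ℤ} {t : P.tiles} :
    P.conf S p = some t ↔ p ∈ S ∧ ∃ k, P.kind p = some k ∧ (t : TileType Unit) = P.tile k := by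
  rw [conf]
  split_ifs with h
  · have hk := h.2.choose_spec
    simp only [Option.some.injEq]
    constructor
    · rintro rfl
      exact ⟨h.1, _, hk, rfl⟩
    · rintro ⟨-, k, hk', ht⟩
      rw [hk] at hk'
      apply Subtype.ext
      rw [ht, ← Option.some.inj hk']
  · simp only [false_iff]
    rintro ⟨h1, k, h2, -⟩
    exact h ⟨h1, k, h2⟩

theorem dom_conf (S : Set (ℤ × ℤ)) : (P.conf S).dom = S ∩ P.dom := by
  ext p
  constructor
  · rintro ⟨t, ht⟩
    obtain ⟨h, k, hk, -⟩ := P.conf_eq_some.1 ht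
    exact ⟨h, k, hk⟩
  · rintro ⟨h, k, hk⟩
    exact ⟨⟨P.tile k, p, k, hk, rfl⟩, P.conf_eq_some.2 ⟨h, k, hk, rfl⟩⟩

theorem inStr_le_bind {S : Set (ℤ × ℤ)} {p : ℤ × ℤ} {k : κ} (hp : p ∈ S) (hk : P.kind p = some k)
    (u : Dir) (hS : ∀ L, P.face k u = .inn L → p + u.vec ∈ S) :
    (P.face k u).inStr P.str ≤ (P.conf S).bind p u ∧
      (P.face k u).inStr P.str ≤ (P.conf S).bind (p + u.vec) u.opp := by
  rcases hf : P.face k u with _ | L | L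
  · simp [Face.inStr]
  · obtain ⟨k', hk', hf'⟩ := P.exists_out p k u L hk hf
    have e1 : P.conf S p = some ⟨P.tile k, p, k, hk, rfl⟩ := P.conf_eq_some.2 ⟨hp, k, hk, rfl⟩
    have e2 : P.conf S (p + u.vec) = some ⟨P.tile k', p + u.vec, k', hk', rfl⟩ :=
      P.conf_eq_some.2 ⟨hS L hf, k', hk', rfl⟩
    have g : P.tile k' u.opp = P.tile k u := by simp [tile, hf, hf']
    constructor
    · rw [Config.bind, e1]
      simp only [Config.bindAt]
      rw [if_pos ⟨_, e2, g⟩]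
      simp [Face.inStr, TileType.str, tile, hf]
    · rw [Config.bind, e2]
      simp only [Config.bindAt]
      rw [if_pos ⟨⟨P.tile k, p, k, hk, rfl⟩, by rw [add_vec_opp, e1],
        by rw [Dir.opp_opp]; exact g.symm⟩]
      simp [Face.inStr, TileType.str, tile, hf']
  · simp [Face.inStr]

theorem Closed.stable {S : Set (ℤ × ℤ)} (hS : P.Closed S) : (P.conf S).Stable 2 := by
  classical
  intro C₀ C₁ hU hdis hne₀ hne₁
  rw [P.dom_conf, Set.inter_eq_left.2 hS.subset] at hU
  have h0 : (0, 0) ∈ C₀ ∪ C₁ := hU ▸ hS.zero_mem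
  have key : ∀ D ⊆ S, D.Nonempty → (0, 0) ∉ D → ∃ p ∈ D, ∃ k, P.kind p = some k ∧
      2 ≤ ∑ u ∈ Finset.univ.filter (fun u => ∃ L, P.face k u = .inn L),
        (P.face k u).inStr P.str ∧
      ∀ u ∈ Finset.univ.filter (fun u => ∃ L, P.face k u = .inn L), p + u.vec ∈ S \ D := by
    intro D hD hne h0
    obtain ⟨p, hp, k, hk, h⟩ := P.exists_minimal (hD.trans hS.subset) hne
    refine ⟨p, hp, k, hk, ?_, ?_⟩
    · rw [Finset.sum_filter_of_ne]
      · exact (P.sum_inStr p k hk (by rintro rfl; exact h0 hp)).ge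
      · intro u _ hu
        rcases hf : P.face k u with _ | L | L
        · simp [hf, Face.inStr] at hu
        · exact ⟨L, rfl⟩
        · simp [hf, Face.inStr] at hu
    · intro u hu
      obtain ⟨L, hL⟩ := (Finset.mem_filter.1 hu).2
      exact ⟨hS.mem p (hD hp) k u L hk hL, h u L hL⟩
  rcases h0 with h0 | h0
  · have hD : C₁ ⊆ S := hU ▸ Set.subset_union_right
    obtain ⟨p, hp, k, hk, h2, h⟩ := key C₁ hD hne₁ (Set.disjoint_left.1 hdis h0)
    refine ⟨(Finset.univ.filter (fun u => ∃ L, P.face k u = .inn L)).image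
      (fun u => (p + u.vec, u.opp)), ?_, ?_⟩
    · intro e he
      obtain ⟨u, hu, rfl⟩ := Finset.mem_image.1 he
      have := h u hu
      rw [← hU] at this
      refine ⟨this.1.resolve_right this.2, ?_⟩
      simp only [add_vec_opp]
      exact hp
    · rw [Finset.sum_image]
      · refine h2.trans (Finset.sum_le_sum fun u hu => ?_)
        exact (P.inStr_le_bind (hD hp) hk u fun L _ => (h u hu).1).2
      · intro u _ v _ huv
        rw [← Dir.opp_opp u, (Prod.mk.inj huv).2, Dir.opp_opp]
  · have hD : C₀ ⊆ S := hU ▸ Set.subset_union_left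
    obtain ⟨p, hp, k, hk, h2, h⟩ := key C₀ hD hne₀ (Set.disjoint_right.1 hdis h0)
    refine ⟨(Finset.univ.filter (fun u => ∃ L, P.face k u = .inn L)).image
      (fun u => (p, u)), ?_, ?_⟩
    · intro e he
      obtain ⟨u, hu, rfl⟩ := Finset.mem_image.1 he
      have := h u hu
      rw [← hU] at this
      exact ⟨hp, this.1.resolve_left this.2⟩
    · rw [Finset.sum_image]
      · refine h2.trans (Finset.sum_le_sum fun u hu => ?_)
        exact (P.inStr_le_bind (hD hp) hk u fun L _ => (h u hu).1).1
      · intro u _ v _ huv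
        exact (Prod.mk.inj huv).2

/-- A tile that binds to a configuration can only bind through sides at which it is attached. -/
theorem bindAt_le {S : Set (ℤ × ℤ)} (hS : P.Closed S) {m : ℤ × ℤ} (hm : m ∉ S) (k : κ) (u : Dir) :
    (P.conf S).bindAt m (P.tile k) u ≤ (P.face k u).inStr P.str ∧
      (0 < (P.conf S).bindAt m (P.tile k) u → ∀ L, P.face k u = .inn L →
        m + u.vec ∈ S ∧ ∃ k', P.kind (m + u.vec) = some k' ∧ P.face k' u.opp = .out L) := by
  rw [Config.bindAt]
  split_ifs with h
  · obtain ⟨t, ht, hg⟩ := h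
    obtain ⟨hmS, k', hk', htk⟩ := P.conf_eq_some.1 ht
    rw [htk] at hg
    have hcode {x y : Λ × Dir} (h : List.replicate (code x) () = List.replicate (code y) ()) :
        x = y := code_injective (by simpa using congrArg List.length h)
    rcases hf : P.face k u with _ | L | L
    · simp [TileType.str, tile, hf]
    · refine ⟨by simp [TileType.str, tile, hf, Face.inStr], fun _ L' hL' => ?_⟩
      obtain rfl : L = L' := by simpa using hL'
      refine ⟨hmS, k', hk', ?_⟩
      rcases hf' : P.face k' u.opp with _ | M | M <;> simp only [tile, hf, hf', Prod.mk.injEq] at hg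
      · exact absurd hg.2 (P.str_pos L).ne
      · have := (Prod.mk.inj (hcode hg.1)).2
        cases u <;> simp [Dir.opp] at this
      · rw [(Prod.mk.inj (hcode hg.1)).1]
    · exfalso
      rcases hf' : P.face k' u.opp with _ | M | M <;> simp only [tile, hf, hf', Prod.mk.injEq] at hg
      · exact absurd hg.2 (P.str_pos L).ne
      · have := hS.mem _ hmS k' _ M hk' hf'
        rw [add_vec_opp] at this
        exact hm this
      · have := (Prod.mk.inj (hcode hg.1)).2
        cases u <;> simp [Dir.opp] at this
  · simp

/-- Only the tiles of the blueprint can be attached. -/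
theorem eq_of_attach {S : Set (ℤ × ℤ)} (hS : P.Closed S) {m : ℤ × ℤ} (hm : m ∉ S)
    {t : TileType Unit} (ht : t ∈ P.tiles) (h : 2 ≤ ∑ u, (P.conf S).bindAt m t u) :
    ∃ k, P.kind m = some k ∧ t = P.tile k ∧
      ∀ u L, P.face k u = .inn L → m + u.vec ∈ S := by
  obtain ⟨p, k, hk, rfl⟩ := ht
  have hle (u : Dir) := (P.bindAt_le hS hm k u).1
  have hp : p ≠ (0, 0) := by
    rintro rfl
    rw [P.kind_zero] at hk
    cases hk
    have : ∑ u, (P.conf S).bindAt m (P.tile P.seed) u = 0 := Finset.sum_eq_zero fun u _ => by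
      have := hle u
      rcases hf : P.face P.seed u with _ | L | L
      · simpa [hf, Face.inStr] using this
      · exact absurd hf (P.seed_ne_inn u L)
      · simpa [hf, Face.inStr] using this
    omega
  have hsum := P.sum_inStr p k hk hp
  have heq (u : Dir) : (P.conf S).bindAt m (P.tile k) u = (P.face k u).inStr P.str :=
    (Finset.sum_eq_sum_iff_of_le fun u _ => hle u).1
      (le_antisymm (Finset.sum_le_sum fun u _ => hle u) (hsum.trans_le h)) u (Finset.mem_univ u)
  have hin (u : Dir) (L : Λ) (hL : P.face k u = .inn L) :=
    (P.bindAt_le hS hm k u).2 (by rw [heq, hL]; exact P.str_pos L) L hL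
  obtain ⟨u₀, L₀, hf₀, hb₀⟩ := P.exists_binding p k hk hp
  obtain ⟨-, k₁, hk₁, hf₁⟩ := hin u₀ L₀ hf₀
  obtain ⟨k', hk', hf'⟩ := P.exists_inn _ _ _ _ hk₁ hf₁ hb₀
  rw [add_vec_opp] at hk'
  rw [Dir.opp_opp] at hf'
  have hkk : k' = k := by
    refine P.eq_of_binding k' k u₀ L₀ hf' hf₀ hb₀ fun u L hL => ?_
    obtain ⟨L', hL'⟩ := P.inn_of_binding k' k u₀ L₀ hf' hf₀ hb₀ u L hL
    obtain ⟨-, k₂, hk₂, hf₂⟩ := hin u L hL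
    obtain ⟨k₃, hk₃, hf₃⟩ := P.exists_out m k' u L' hk' hL'
    rw [hk₂] at hk₃
    cases hk₃
    rw [hf₂] at hf₃
    cases hf₃
    exact hL'
  subst hkk
  exact ⟨k', hk', rfl, fun u L hL => (hin u L hL).1⟩

/-- The tile assembly system of the blueprint. -/
noncomputable def system : GTAS Unit where
  tiles := P.tiles
  seed := P.conf {(0, 0)}
  temp := 2
  seed_stable := P.closed_singleton.stable

theorem conf_inj {S S' : Set (ℤ × ℤ)} {α : Config P.tiles} (h : α.Sub (P.conf S')) (hS : α.dom = S)
    : α = P.conf S := by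
  funext p
  rcases hp : α p with _ | t
  · symm
    by_contra hcon
    obtain ⟨t, ht⟩ := Option.ne_none_iff_exists'.1 hcon
    have : p ∈ α.dom := hS ▸ (P.conf_eq_some.1 ht).1
    obtain ⟨t', ht'⟩ := this
    rw [hp] at ht'
    cases ht'
  · have h1 := P.conf_eq_some.1 (h p t hp)
    exact (P.conf_eq_some.2 ⟨hS ▸ ⟨t, hp⟩, h1.2⟩).symm

/-- A stable single-tile extension adds a tile of the blueprint. -/
theorem extend {S : Set (ℤ × ℤ)} (hS : P.Closed S) {α : Config P.tiles} (hα : α.Stable 2)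
    (hext : (P.conf S).SingleTileExt α) : ∃ S', P.Closed S' ∧ α = P.conf S' := by
  obtain ⟨hsub, m, hm⟩ := hext
  have hdomS : (P.conf S).dom = S := by rw [P.dom_conf, Set.inter_eq_left.2 hS.subset]
  have hmα : m ∈ α.dom \ (P.conf S).dom := hm ▸ rfl
  have hSα : S ⊆ α.dom := by
    intro p hp
    rw [← hdomS] at hp
    obtain ⟨t, ht⟩ := hp
    exact ⟨t, hsub p t ht⟩
  have hmS : m ∉ S := hdomS ▸ hmα.2
  have hdom : {m} ∪ S = α.dom := by
    rw [← hm, hdomS]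
    exact Set.sdiff_union_of_subset hSα
  obtain ⟨t, ht⟩ := hmα.1
  obtain ⟨E, hE, hE2⟩ := hα {m} S hdom (Set.disjoint_singleton_left.2 hmS) ⟨m, rfl⟩ ⟨_, hS.zero_mem⟩
  have hbind : 2 ≤ ∑ u, (P.conf S).bindAt m t u := by
    refine hE2.trans ?_
    have hinj : Set.InjOn Prod.snd (E : Set ((ℤ × ℤ) × Dir)) := by
      intro e he f hf hef
      have h1 : e.1 = m := (hE e he).1
      have h2 : f.1 = m := (hE f hf).1
      exact Prod.ext (h1.trans h2.symm) hef
    calc ∑ e ∈ E, α.bind e.1 e.2 ≤ ∑ e ∈ E, (P.conf S).bindAt m t e.2 := by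
          refine Finset.sum_le_sum fun e he => ?_
          obtain ⟨h1, h2⟩ := hE e he
          have h1 : e.1 = m := h1
          rw [h1] at h2 ⊢
          rw [Config.bind, ht]
          simp only [Config.bindAt]
          obtain ⟨t', ht'⟩ : m + e.2.vec ∈ (P.conf S).dom := by rwa [hdomS]
          rw [hsub _ _ ht', ht']
      _ = ∑ u ∈ E.image Prod.snd, (P.conf S).bindAt m t u := by rw [Finset.sum_image hinj]
      _ ≤ _ := Finset.sum_le_sum_of_subset (Finset.subset_univ _)
  obtain ⟨k, hk, htk, hin⟩ := P.eq_of_attach hS hmS t.2 hbind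
  have hcl : P.Closed ({m} ∪ S) := by
    refine ⟨?_, .inr hS.zero_mem, ?_⟩
    · rintro p (rfl | hp)
      · exact ⟨k, hk⟩
      · exact hS.subset hp
    · rintro p (rfl | hp) k' u L hk' hu
      · rw [hk] at hk'
        cases hk'
        exact .inr (hin u L hu)
      · exact .inr (hS.mem p hp k' u L hk' hu)
  refine ⟨_, hcl, P.conf_inj (S' := {m} ∪ S) ?_ hdom.symm⟩
  intro p t' ht'
  have hp : p ∈ {m} ∪ S := hdom ▸ ⟨t', ht'⟩
  rcases hp with rfl | hp
  · rw [ht] at ht'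
    cases ht'
    exact P.conf_eq_some.2 ⟨.inl rfl, k, hk, htk⟩
  · rw [← hdomS] at hp
    obtain ⟨t'', ht''⟩ := hp
    have := hsub p t'' ht''
    rw [ht'] at this
    cases this
    obtain ⟨h1, h2⟩ := P.conf_eq_some.1 ht''
    exact P.conf_eq_some.2 ⟨.inr h1, h2⟩

/-- Every produced configuration is a part of the blueprint. -/
theorem closed_of_produces {α : Config P.tiles} (h : Produces 2 (P.conf {(0, 0)}) α) :
    ∃ S, P.Closed S ∧ α = P.conf S := by
  obtain ⟨k, a, ⟨hk, hst, hext⟩, h0, hdom, hsub⟩ := h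
  have hall (i : ℕ) (hi : (i : ℕ∞) < k) : ∃ S, P.Closed S ∧ a i = P.conf S := by
    induction i with
    | zero => exact ⟨_, P.closed_singleton, h0⟩
    | succ i ih =>
      obtain ⟨S, hS, hi'⟩ := ih (lt_of_le_of_lt (by exact_mod_cast i.le_succ) hi)
      have := hext i hi
      rw [hi'] at this
      exact P.extend hS (hst _ hi) this
  refine ⟨α.dom, ⟨?_, ?_, ?_⟩, P.conf_inj (S' := P.dom) ?_ rfl⟩
  · intro p hp
    rw [hdom] at hp
    obtain ⟨i, hi, hp⟩ := hp
    obtain ⟨S, hS, hi'⟩ := hall i hi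
    rw [hi', P.dom_conf] at hp
    exact hp.2
  · rw [hdom]
    refine ⟨0, hk, ?_⟩
    rw [h0]
    rw [P.dom_conf]
    exact ⟨rfl, _, P.kind_zero⟩
  · intro p hp k' u L hk' hu
    rw [hdom] at hp ⊢
    obtain ⟨i, hi, hp⟩ := hp
    obtain ⟨S, hS, hi'⟩ := hall i hi
    refine ⟨i, hi, ?_⟩
    rw [hi', P.dom_conf, Set.inter_eq_left.2 hS.subset] at hp ⊢
    exact hS.mem p hp k' u L hk' hu
  · intro p t hp
    have : p ∈ α.dom := ⟨t, hp⟩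
    rw [hdom] at this
    obtain ⟨i, hi, t', ht'⟩ := this
    have h2 := hsub i hi p t' ht'
    rw [hp] at h2
    cases h2
    obtain ⟨S, hS, hi'⟩ := hall i hi
    rw [hi'] at ht'
    obtain ⟨h3, h4⟩ := P.conf_eq_some.1 ht'
    exact P.conf_eq_some.2 ⟨hS.subset h3, h4⟩

theorem produces_conf_dom : Produces 2 (P.conf {(0, 0)}) (P.conf P.dom) := by
  have hsub (S S' : Set (ℤ × ℤ)) (h : S ⊆ S') : (P.conf S).Sub (P.conf S') := fun p t ht => by
    obtain ⟨h1, h2⟩ := P.conf_eq_some.1 ht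
    exact P.conf_eq_some.2 ⟨h h1, h2⟩
  have hdom (i : ℕ) : (P.conf (P.stages i)).dom = P.stages i := by
    rw [P.dom_conf, Set.inter_eq_left.2 (P.closed_stages i).subset]
  refine ⟨⊤, fun i => P.conf (P.stages i), ⟨by simp, fun i _ =>
    (P.closed_stages i).stable, fun i _ => ⟨hsub _ _ ?_, P.pick (P.stages i), ?_⟩⟩, ?_, ?_,
    fun i _ => hsub _ _ (P.closed_stages i).subset⟩
  · exact_mod_cast P.stages_mono i.le_succ
  · simp only [hdom]
    rw [stages]
    have := (P.pick_mem (P.stages i)).1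
    ext p
    simp only [Finset.coe_insert, Set.mem_sdiff, Set.mem_insert_iff, Finset.mem_coe,
      Set.mem_singleton_iff]
    constructor
    · tauto
    · rintro rfl; exact ⟨.inl rfl, this⟩
  · simp [stages]
  · rw [P.dom_conf, Set.inter_self]
    ext p
    constructor
    · intro hp
      obtain ⟨i, hi⟩ := P.exists_mem_stages hp
      exact ⟨i, by simp, by rw [hdom]; exact hi⟩
    · rintro ⟨i, -, hi⟩
      rw [hdom] at hi
      exact (P.closed_stages i).subset hi

theorem terminal_eq : P.system.terminal = {P.conf P.dom} := by
  ext α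
  constructor
  · rintro ⟨h1, h2⟩
    obtain ⟨S, hS, rfl⟩ := P.closed_of_produces h1.2
    suffices S = P.dom by rw [this]; rfl
    refine hS.subset.antisymm ?_
    by_contra hcon
    rw [← Set.sdiff_nonempty] at hcon
    obtain ⟨p, hp, k, hk, h⟩ := P.exists_minimal Set.sdiff_subset hcon
    have hp0 : p ≠ (0, 0) := by rintro rfl; exact hp.2 hS.zero_mem
    have hmem : p ∈ (P.conf S).frontier 2 := by
      refine Set.mem_iUnion₂.2 ⟨P.tile k, ⟨p, k, hk, rfl⟩, ?_, ?_⟩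
      · rw [P.dom_conf]
        exact fun h => hp.2 h.1
      · rw [← P.sum_inStr p k hk hp0]
        refine Finset.sum_le_sum fun u _ => ?_
        rcases hf : P.face k u with _ | L | L
        · simp [Face.inStr]
        · obtain ⟨k', hk', hf'⟩ := P.exists_out p k u L hk hf
          have hin : p + u.vec ∈ S := by
            by_contra hc
            exact h u L hf ⟨⟨k', hk'⟩, hc⟩
          rw [Config.bindAt, if_pos ⟨⟨P.tile k', _, k', hk', rfl⟩,
            P.conf_eq_some.2 ⟨hin, k', hk', rfl⟩, by simp [tile, hf, hf']⟩]
          simp [Face.inStr, TileType.str, tile, hf]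
        · simp [Face.inStr]
    have h2 : (P.conf S).frontier 2 = ∅ := h2
    rw [h2] at hmem
    exact hmem
  · rintro rfl
    refine ⟨⟨P.closed_dom.stable, P.produces_conf_dom⟩, ?_⟩
    rw [Set.eq_empty_iff_forall_notMem]
    intro p hp
    obtain ⟨t, ht, hp1, hp2⟩ := Set.mem_iUnion₂.1 hp
    have hpd : p ∉ P.dom := by
      intro h
      exact hp1 ((P.dom_conf P.dom).ge ⟨h, h⟩)
    obtain ⟨k, hk, -⟩ := P.eq_of_attach P.closed_dom hpd ht hp2
    exact hpd ⟨k, hk⟩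

/-- The set of points of a blueprint strictly self-assembles in a directed tile assembly system. -/
theorem exists_system : ∃ 𝒯 : GTAS Unit, 𝒯.IsTAS ∧ 𝒯.temp = 2 ∧ 𝒯.seed.dom = {(0, 0)} ∧
    𝒯.Directed ∧ 𝒯.StrictlyAssembles P.dom := by
  have hseed : (P.conf {(0, 0)}).dom = {(0, 0)} := by
    rw [P.dom_conf, Set.inter_eq_left.2 P.closed_singleton.subset]
  refine ⟨P.system, ⟨P.tiles_finite, ?_⟩, rfl, hseed, ?_, ?_⟩
  · exact hseed ▸ Set.finite_singleton _
  · rw [GTAS.Directed, P.terminal_eq]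
    exact Set.encard_singleton _
  · intro α hα
    rw [P.terminal_eq] at hα
    obtain rfl := Set.mem_singleton_iff.1 hα
    exact (P.dom_conf P.dom).trans (Set.inter_self _)

end Blueprint
theorem Face.swap_eq_inn {f : Face Label} {L : Label} : f.swap = .inn L ↔ f = .inn L.swap := by
  constructor
  · intro h
    rw [← f.swap_swap, h]; rfl
  · rintro rfl
    simp [Face.swap]

theorem Label.swap_eq_iff {L M : Label} : L.swap = M ↔ L = M.swap :=
  ⟨fun h => by rw [← h, Label.swap_swap], fun h => by rw [h, Label.swap_swap]⟩

theorem Face.inn_eq_inn {Λ : Type} {L M : Λ} : Face.inn M = Face.inn L ↔ L = M := by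
  rw [Face.inn.injEq, eq_comm]

/-- The strength of a label. -/
def Label.str : Label → ℕ
  | .single _ => 2
  | _ => 1

namespace Scheme

variable {G : Scheme}

/-! ### The sides through which tiles are attached -/

theorem westFace_ne_inn (G : Scheme) (γ : Ctx) (K : RowKind) (L : Label) :
    G.westFace γ K ≠ .inn L := by
  rcases K with _ | _ | _ <;> simp only [westFace, ne_eq, reduceCtorEq, not_false_eq_true]
  split <;> simp

theorem endFace_ne_inn (G : Scheme) (γ : Ctx) (z : Bool) (L : Label) : G.endFace γ z ≠ .inn L := by
  rw [endFace]
  split_ifs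
  · simp
  · simp
  · split <;> simp

/-- The side of an arm tile of positive level that has a label `coop`. -/
def coopDir (ax : Bool) (γ : Ctx) : Dir :=
  if ax then (if γ.m = .north then .north else .south) else (if γ.m = .east then .east else .west)

/-- The side of an arm tile of positive level that has a label `row`. -/
def rowDir (ax : Bool) (x : Xing) : Dir :=
  if ax then (if x = .no then .east else .west) else (if x = .no then .north else .south)

theorem coopDir_ne_rowDir (ax : Bool) (γ : Ctx) (x : Xing) : coopDir ax γ ≠ rowDir ax x := by
  cases ax <;> simp only [coopDir, rowDir] <;> split_ifs <;> simp_all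

theorem crossEast_ne_inn (G : Scheme) (γ : Ctx) (K : RowKind) (L : Label) :
    G.crossEast γ K ≠ .inn L := by
  rcases K with ⟨_ | _, _⟩ | _ | _ <;> simp [crossEast]

theorem armSouth_eq_inn {γ : Ctx} {d : ℤ} {x : Xing} {K : RowKind} {L : Label} :
    G.armSouth γ d x K = .inn L ↔ γ.m ≠ .north ∧ L = .coop true γ d x := by
  by_cases h : γ.m = .north
  · rcases K with ⟨_ | _, _⟩ | _ | _ <;> simp only [armSouth, h] <;> split_ifs <;> simp
  · simp [armSouth, h, eq_comm]

theorem armNorth_eq_inn {γ : Ctx} {d : ℤ} {x : Xing} {K : RowKind} {L : Label} :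
    G.armNorth γ d x K = .inn L ↔ γ.m = .north ∧ L = .coop true γ d x := by
  by_cases h : γ.m = .north
  · simp [armNorth, h, eq_comm]
  · simp only [armNorth, h, if_false, false_and, iff_false]
    split_ifs
    · exact G.endFace_ne_inn _ _ _
    · simp
    · simp

theorem face_arm_inn {ax : Bool} {γ : Ctx} {d : ℤ} {x : Xing} {K : RowKind} {u : Dir} {L : Label} :
    G.face (.arm ax γ d x K) u = .inn L ↔
      (u = coopDir ax γ ∧ L = .coop ax γ d x) ∨ (u = rowDir ax x ∧ L = .row K) := by
  have key (G : Scheme) (γ : Ctx) (u : Dir) (L : Label) : G.face (.arm true γ d x K) u = .inn L ↔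
      (u = coopDir true γ ∧ L = .coop true γ d x) ∨ (u = rowDir true x ∧ L = .row K) := by
    cases u <;> simp only [face, armFace, armNorth_eq_inn, armSouth_eq_inn, coopDir, rowDir]
    · split_ifs <;> simp_all
    · by_cases h : x = .no <;> by_cases hm : γ.m = .north <;>
        simp [h, hm, crossEast_ne_inn, Face.inn_eq_inn, -Face.inn.injEq]
    · split_ifs <;> simp_all
    · by_cases h : x = .no <;> by_cases hm : γ.m = .north <;>
        simp [h, hm, westFace_ne_inn, Face.inn_eq_inn, -Face.inn.injEq]
  cases ax with
  | true => exact key G γ u L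
  | false =>
    have h := key G.swap γ.swap u.swap L.swap
    have e := G.face_swap (.arm false γ d x K) u
    simp only [Kind.swap, Bool.not_false] at e
    rw [e, Face.swap_eq_inn, Label.swap_swap] at h
    rw [h]
    have h1 : (u.swap = coopDir true γ.swap) ↔ u = coopDir false γ := by
      have : γ.m.swap = .north ↔ γ.m = .east := Dir.swap_eq_iff
      by_cases h : γ.m = .east <;> simp [coopDir, this, h, Dir.swap_eq_iff]
    have h2 : (u.swap = rowDir true x) ↔ u = rowDir false x := by
      simp only [rowDir]
      rw [Dir.swap_eq_iff]
      split_ifs <;> simp_all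
    rw [h1, h2, Label.swap_eq_iff, Label.swap_eq_iff]
    simp [Label.swap]

/-- The side through which a tile that is not a cooperative arm tile is attached. -/
def singleDir (G : Scheme) : Kind → Dir
  | .pat _ q => if q = (0, 0) then (if G.pax then .west else .south) else G.qpar q
  | .corner γ _ => if γ = rctx then .north else if γ = rctx.swap then .east else γ.m
  | .arm0 true γ z =>
    if γ = rctx ∧ z = 1 then .west else if γ.m = .north then .north else .south
  | .arm0 false γ z =>
    if γ = rctx.swap ∧ z = 1 then .south else if γ.m = .east then .east else .west
  | .rfirst ax _ _ => if ax then .west else .south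
  | .arm _ γ _ _ _ => γ.m

theorem swap_eq_rctx {γ : Ctx} : γ.swap = rctx ↔ γ = rctx.swap :=
  ⟨fun h => by rw [← h, Ctx.swap_swap], fun h => by rw [h, Ctx.swap_swap]⟩

theorem singleDir_swap (G : Scheme) (k : Kind) (hk : ∀ ax γ d x K, k ≠ .arm ax γ d x K) :
    G.swap.singleDir k.swap = (G.singleDir k).swap := by
  rcases k with ⟨r, q⟩ | ⟨γ, z⟩ | ⟨_ | _, γ, z⟩ | ⟨_ | _, γ, z⟩ | ⟨ax, γ, d, x, K⟩
  · simp only [singleDir, Kind.swap, Prod.swap_eq_mk, swap_qpar, Prod.swap_swap]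
    cases hp : G.pax <;> split_ifs <;> simp_all
  · simp only [singleDir, Kind.swap, swap_eq_rctx]
    by_cases h1 : γ = rctx
    · subst h1; simp [Ctx.swap]
    · by_cases h2 : γ = rctx.swap
      · subst h2; simp [Ctx.swap]
      · have : ¬ γ.swap = rctx.swap := fun h => h1 (by rw [← γ.swap_swap, h, Ctx.swap_swap])
        simp [h1, h2, this, -Ctx.swap_mk]
  · have : γ.m.swap = .north ↔ γ.m = .east := Dir.swap_eq_iff
    simp only [singleDir, Kind.swap, Bool.not_false, swap_eq_rctx, Ctx.swap_m, this]
    split_ifs <;> simp_all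
  · have : γ.m.swap = .east ↔ γ.m = .north := Dir.swap_eq_iff
    have h2 : γ.swap = rctx.swap ↔ γ = rctx := by rw [← swap_eq_rctx, Ctx.swap_swap]
    simp only [singleDir, Kind.swap, Bool.not_true, h2, Ctx.swap_m, this]
    split_ifs <;> simp_all
  · simp [singleDir, Kind.swap]
  · simp [singleDir, Kind.swap]
  · exact absurd rfl (hk ax γ d x K)

theorem patFace_inn {r : Bool} {q : ℤ × ℤ} (h0 : ¬ (r = true ∧ q = (0, 0))) {u : Dir} {L : Label} :
    G.patFace r q u = .inn L ↔ u = G.singleDir (.pat r q) ∧ L = .single (.pat r q) := by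
  by_cases hq : q = (0, 0)
  · have hr : r = false := by
      cases r
      · rfl
      · exact absurd ⟨rfl, hq⟩ h0
    subst hr hq
    by_cases hu : u = if G.pax then .west else .south
    · rw [patFace, if_pos ⟨rfl, rfl, hu⟩]
      simp [singleDir, hu, Face.inn_eq_inn, -Face.inn.injEq]
    · rw [patFace, if_neg (by tauto), if_neg (by tauto)]
      simp only [singleDir, if_true, hu, false_and, iff_false]
      split_ifs <;> simp
  · by_cases hu : u = G.qpar q
    · rw [patFace, if_neg (by tauto), if_pos ⟨hq, hu⟩]
      simp [singleDir, hu, hq, Face.inn_eq_inn, -Face.inn.injEq]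
    · rw [patFace, if_neg (by tauto), if_neg (by tauto)]
      simp only [singleDir, if_neg hq, hu, false_and, iff_false]
      split_ifs <;> simp

theorem cornerNorth_inn {γ : Ctx} {z : Bool} {L : Label} :
    G.cornerNorth γ z = .inn L ↔ (γ.m = .north ∨ γ = rctx) ∧ L = .single (.corner γ z) := by
  simp only [cornerNorth, isR_iff]
  split_ifs <;> simp_all [eq_comm]

theorem cornerWest_inn {γ : Ctx} {z : Bool} {L : Label} :
    G.cornerWest γ z = .inn L ↔ (γ.m = .west ∧ γ ≠ rctx) ∧ L = .single (.corner γ z) := by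
  simp only [cornerWest, isR_iff]
  split_ifs
  · simp_all
  · simp_all [eq_comm]
  · simp_all [westFace_ne_inn]

theorem face_corner_inn {γ : Ctx} {z : Bool} {u : Dir} {L : Label} :
    G.face (.corner γ z) u = .inn L ↔
      u = G.singleDir (.corner γ z) ∧ L = .single (.corner γ z) := by
  have e1 : γ.m.swap = .north ↔ γ.m = .east := Dir.swap_eq_iff
  have e2 : γ.m.swap = .west ↔ γ.m = .south := Dir.swap_eq_iff
  have e3 : rctx ≠ rctx.swap := by simp [Ctx.swap]
  have hdir : u = G.singleDir (.corner γ z) ↔ match u with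
      | .north => γ.m = .north ∨ γ = rctx
      | .east => γ.m = .east ∨ γ = rctx.swap
      | .south => γ.m = .south ∧ γ ≠ rctx.swap
      | .west => γ.m = .west ∧ γ ≠ rctx := by
    by_cases h1 : γ = rctx
    · subst h1; cases u <;> simp [singleDir, e3, -Ctx.swap_mk]
    · by_cases h2 : γ = rctx.swap
      · subst h2; cases u <;> simp [singleDir, Ctx.swap]
      · cases u <;> simp [singleDir, h1, h2, eq_comm, -Ctx.swap_mk]
  have hcs : (Label.single (.corner γ.swap z)).swap = .single (.corner γ z) := by
    simp [Label.swap, Kind.swap]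
  rw [hdir]
  cases u <;> simp only [face, Face.swap_eq_inn, cornerNorth_inn, cornerWest_inn,
    Label.swap_eq_iff, hcs, swap_eq_rctx, Ctx.swap_m, e1, e2, ne_eq]

theorem face_arm0_inn {ax : Bool} {γ : Ctx} {z : ℤ} {u : Dir} {L : Label} :
    G.face (.arm0 ax γ z) u = .inn L ↔
      u = G.singleDir (.arm0 ax γ z) ∧ L = .single (.arm0 ax γ z) := by
  have key (G : Scheme) (γ : Ctx) (u : Dir) (L : Label) : G.face (.arm0 true γ z) u = .inn L ↔
      u = G.singleDir (.arm0 true γ z) ∧ L = .single (.arm0 true γ z) := by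
    have hR : γ = rctx → γ.m ≠ .north := by rintro rfl; simp
    cases u <;> simp only [face, arm0Face, singleDir, isR_iff]
    · by_cases h : γ.m = .north <;> by_cases h1 : γ = rctx ∧ z = 1
      · exact absurd h (hR h1.1)
      · simp [h, h1, eq_comm]
      · simp only [h1]
        split_ifs <;> simp_all [endFace_ne_inn]
      · simp only [h, h1, if_false]
        split_ifs <;> simp_all [endFace_ne_inn]
    · split_ifs <;> simp_all
    · by_cases h : γ.m = .north <;> by_cases h1 : γ = rctx ∧ z = 1
      · exact absurd h (hR h1.1)
      · simp only [h, h1, if_true, if_false]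
        split_ifs <;> simp_all
      · simp [h1]
      · simp [h, h1, eq_comm]
    · by_cases h1 : γ = rctx ∧ z = 1
      · simp [h1, eq_comm]
      · simp only [h1, if_false]
        split_ifs <;> simp_all
  cases ax with
  | true => exact key G γ u L
  | false =>
    have h := key G.swap γ.swap u.swap L.swap
    have e := G.face_swap (.arm0 false γ z) u
    simp only [Kind.swap, Bool.not_false] at e
    have e2 := G.singleDir_swap (.arm0 false γ z) (by simp)
    simp only [Kind.swap, Bool.not_false] at e2
    rw [e, Face.swap_eq_inn, Label.swap_swap, e2, Label.swap_eq_iff, Dir.swap_eq_iff,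
      Dir.swap_swap] at h
    rw [h]
    simp [Label.swap, Kind.swap]

theorem face_rfirst_inn {ax : Bool} {γ : Ctx} {z : Bool} {u : Dir} {L : Label} :
    G.face (.rfirst ax γ z) u = .inn L ↔
      u = G.singleDir (.rfirst ax γ z) ∧ L = .single (.rfirst ax γ z) := by
  cases ax <;> cases u <;>
    simp [face, rfirstFace, singleDir, crossEast, Label.swap, Kind.swap, eq_comm,
      Face.swap]

theorem face_inn {k : Kind} (hk : k ≠ .pat true (0, 0)) :
    (∀ u L, G.face k u = .inn L ↔ u = G.singleDir k ∧ L = .single k) ∨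
    ∃ ax γ d x K, k = .arm ax γ d x K := by
  rcases k with ⟨r, q⟩ | ⟨γ, z⟩ | ⟨ax, γ, z⟩ | ⟨ax, γ, z⟩ | ⟨ax, γ, d, x, K⟩
  · left
    intro u L
    exact patFace_inn (by rintro ⟨rfl, rfl⟩; exact hk rfl)
  · exact .inl fun u L => face_corner_inn
  · exact .inl fun u L => face_arm0_inn
  · exact .inl fun u L => face_rfirst_inn
  · exact .inr ⟨_, _, _, _, _, rfl⟩

theorem face_seed (u : Dir) (L : Label) : G.face (.pat true (0, 0)) u ≠ .inn L := by
  simp only [face, patFace]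
  split_ifs <;> simp_all

theorem inStr_eq_zero {f : Face Label} (h : ∀ L, f ≠ .inn L) : f.inStr Label.str = 0 := by
  rcases f with _ | L | L
  · rfl
  · exact absurd rfl (h L)
  · rfl

theorem sum_inStr {k : Kind} (hk : k ≠ .pat true (0, 0)) :
    ∑ u, (G.face k u).inStr Label.str = 2 := by
  rcases face_inn (G := G) hk with h | ⟨ax, γ, d, x, K, rfl⟩
  · rw [Finset.sum_eq_single (G.singleDir k)]
    · rw [(h _ _).2 ⟨rfl, rfl⟩]; rfl
    · intro u _ hu
      exact inStr_eq_zero fun L hL => hu ((h u L).1 hL).1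
    · simp
  · rw [← Finset.sum_subset (Finset.subset_univ {coopDir ax γ, rowDir ax x}),
      Finset.sum_pair (coopDir_ne_rowDir ax γ x), face_arm_inn.2 (.inl ⟨rfl, rfl⟩),
      face_arm_inn.2 (.inr ⟨rfl, rfl⟩)]
    · rfl
    · intro u _ hu
      refine inStr_eq_zero fun L hL => hu ?_
      rw [face_arm_inn] at hL
      rcases hL with h | h <;> simp [h.1]

theorem exists_binding {k : Kind} (hk : k ≠ .pat true (0, 0)) :
    ∃ u L, G.face k u = .inn L ∧ L.Binding := by
  rcases face_inn (G := G) hk with h | ⟨ax, γ, d, x, K, rfl⟩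
  · exact ⟨_, _, (h _ _).2 ⟨rfl, rfl⟩, trivial⟩
  · exact ⟨_, _, face_arm_inn.2 (.inl ⟨rfl, rfl⟩), trivial⟩

/-- A label through which a tile is attached determines its kind, except for the row kind of a
cooperative arm tile. -/
theorem eq_or_arm_of_binding {k k' : Kind} {u : Dir} {L : Label} (h : G.face k u = .inn L)
    (h' : G.face k' u = .inn L) (hL : L.Binding) :
    k = k' ∨ ∃ ax γ d x K K', k = .arm ax γ d x K ∧ k' = .arm ax γ d x K' := by
  have hk : k ≠ .pat true (0, 0) := by rintro rfl; exact face_seed u L h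
  have hk' : k' ≠ .pat true (0, 0) := by rintro rfl; exact face_seed u L h'
  rcases face_inn (G := G) hk with h1 | ⟨ax, γ, d, x, K, rfl⟩ <;>
    rcases face_inn (G := G) hk' with h2 | ⟨ax', γ', d', x', K', rfl⟩
  · have e1 := ((h1 u L).1 h).2
    have e2 := ((h2 u L).1 h').2
    rw [e1] at e2
    exact .inl (Label.single.inj e2)
  · have e1 := ((h1 u L).1 h).2
    subst e1
    rw [face_arm_inn] at h'
    simp at h'
  · have e1 := ((h2 u L).1 h').2
    subst e1
    rw [face_arm_inn] at h
    simp at h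
  · rw [face_arm_inn] at h h'
    rcases h with ⟨-, rfl⟩ | ⟨-, rfl⟩
    · simp only [Label.coop.injEq, reduceCtorEq, and_false, or_false] at h'
      obtain ⟨-, rfl, rfl, rfl, rfl⟩ := h'
      exact .inr ⟨_, _, _, _, _, _, rfl, rfl⟩
    · exact absurd hL (by simp [Label.Binding])

theorem inn_of_binding {k k' : Kind} {u : Dir} {L : Label} (h : G.face k u = .inn L)
    (h' : G.face k' u = .inn L) (hL : L.Binding) (u' : Dir) (L' : Label)
    (hu : G.face k' u' = .inn L') : ∃ L'', G.face k u' = .inn L'' := by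
  rcases eq_or_arm_of_binding h h' hL with rfl | ⟨ax, γ, d, x, K, K', rfl, rfl⟩
  · exact ⟨_, hu⟩
  · rw [face_arm_inn] at hu
    rcases hu with ⟨hu, -⟩ | ⟨hu, -⟩
    · exact ⟨_, face_arm_inn.2 (.inl ⟨hu, rfl⟩)⟩
    · exact ⟨_, face_arm_inn.2 (.inr ⟨hu, rfl⟩)⟩

/-- A binding label together with the label `row`, if there is one, determines the kind. -/
theorem eq_of_binding {k k' : Kind} {u : Dir} {L : Label} (h : G.face k u = .inn L)
    (h' : G.face k' u = .inn L) (hL : L.Binding)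
    (hall : ∀ u' L', G.face k' u' = .inn L' → G.face k u' = .inn L') : k = k' := by
  rcases eq_or_arm_of_binding h h' hL with rfl | ⟨ax, γ, d, x, K, K', rfl, rfl⟩
  · rfl
  · have := hall _ _ (face_arm_inn.2 (.inr ⟨rfl, rfl⟩))
    rw [face_arm_inn] at this
    simp at this
    rw [this]

/-! ### The order of growth -/

/-- A property of the positions of a block that passes on to each position from those to which its
tile is attached (and that therefore holds at the positions without tile). -/
def Hereditary (G : Scheme) (k : ℕ) (B : Option Ctx) (A : ℤ → ℤ → Prop) : Prop :=
  ∀ x y, 0 ≤ x → x < G.len k → 0 ≤ y → y < G.len k →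
    (∀ u L, G.faceAt (G.block k B x y) u = .inn L → A (x + u.vec.1) (y + u.vec.2)) → A x y

theorem Hereditary.swap (hG : G.Proper) {k : ℕ} {B : Option Ctx} {A : ℤ → ℤ → Prop}
    (h : G.Hereditary k B A) : G.swap.Hereditary k (B.map Ctx.swap) fun x y => A y x := by
  intro x y hx hx' hy hy' hA
  rw [swap_len] at hx' hy'
  refine h y x hy hy' hx hx' fun u L hL => ?_
  have := hA u.swap L.swap (by
    rw [hG.block_swap k B y x hy hx, faceAt_swap, hL]; rfl)
  rw [Dir.vec_swap] at this
  exact this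

theorem Hereditary.sub {k : ℕ} {B : Option Ctx} {A : ℤ → ℤ → Prop} (hG : G.Proper)
    (h : G.Hereditary (k + 1) B A) {a b : ℤ} (hV : (a, b) ∈ G.V) :
    G.Hereditary k (G.sub B (a, b)) fun x y =>
      A (1 + G.len k * a + x) (1 + G.len k * b + y) := by
  intro x y hx hx' hy hy' hA
  obtain ⟨ha, ha', hb, hb'⟩ := hG.V_bounds _ _ hV
  have hl := hG.add_three_le_len k
  have h1 : 0 ≤ G.len k * a := mul_nonneg (by omega) ha
  have h2 : 0 ≤ G.len k * b := mul_nonneg (by omega) hb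
  refine h _ _ (by omega) (hG.len_mul_add_lt ha' hx') (by omega) (hG.len_mul_add_lt hb' hy')
    fun u L hL => ?_
  rw [G.block_sub B hx hx' hy hy' ha hb hV] at hL
  simpa only [add_assoc] using hA u L hL

/-- The property holds at the positions next to the block from which its growth is started. -/
def Started (G : Scheme) (k : ℕ) (γ : Ctx) (A : ℤ → ℤ → Prop) : Prop :=
  match γ.m with
  | .west => ∀ y, 0 ≤ y → y < G.len k → y ≤ k ∨ γ = rctx → A (-1) y
  | .south => ∀ x, 0 ≤ x → x < G.len k → x ≤ k ∨ γ = rctx.swap → A x (-1)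
  | .east => ∀ y, 0 ≤ y → y < G.len k → y ≤ k → A (G.len k) y
  | .north => ∀ x, 0 ≤ x → x < G.len k → x ≤ k → A x (G.len k)

theorem Started.swap {k : ℕ} {γ : Ctx} {A : ℤ → ℤ → Prop} (h : G.Started k γ A) :
    G.swap.Started k γ.swap fun x y => A y x := by
  obtain ⟨r, w, m⟩ := γ
  have e (γ : Ctx) : γ.swap = rctx.swap ↔ γ = rctx := by rw [← swap_eq_rctx, Ctx.swap_swap]
  cases m
  · intro x h1 h2 h3
    rw [swap_len] at h2 ⊢
    exact h x h1 h2 h3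
  · intro x h1 h2 h3
    rw [swap_len] at h2 ⊢
    exact h x h1 h2 h3
  · exact fun x h1 h2 h3 => h x h1 (by simpa using h2) (h3.imp_right swap_eq_rctx.1)
  · exact fun x h1 h2 h3 => h x h1 (by simpa using h2) (h3.imp_right (e _).1)

section arms

variable {k : ℕ} {γ : Ctx} {A : ℤ → ℤ → Prop}

theorem corner_mem (hG : G.Proper) (h : G.Hereditary k (some γ) A)
    (h0 : A (G.singleDir (.corner γ (k = 0))).vec.1 (G.singleDir (.corner γ (k = 0))).vec.2) :
    A 0 0 := by
  have hl := hG.add_three_le_len k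
  refine h 0 0 le_rfl (by omega) le_rfl (by omega) fun u L hL => ?_
  rw [block_corner, faceAt_some, face_corner_inn] at hL
  rw [hL.1, zero_add, zero_add]
  exact h0

/-- A left arm that is not started from above grows upwards. In the rows `y ≤ k` it cooperates with
its left neighbor if it is started from there, and with the tiles inside the block otherwise. -/
theorem left_mem (h : G.Hereditary k (some γ) A) (hm : γ.m ≠ .north)
    (hl : 0 < G.len k) {y : ℤ} (hy : 1 ≤ y) (hy' : y < G.len k)
    (h1 : A 0 (y - 1) ∨ (γ = rctx ∧ y = 1))
    (h2 : if γ.m = .west ∧ (y ≤ k ∨ (γ = rctx ∧ y = 1)) then A (-1) y else k = 0 ∨ A 1 y) :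
    A 0 y := by
  have hRm : γ = rctx → γ.m = .west := by rintro rfl; rfl
  refine h 0 y le_rfl hl (by omega) hy' fun u L hL => ?_
  rw [G.block_left k γ (by omega), faceAt_some] at hL
  have hc : coopDir true γ = .south := by simp [coopDir, hm]
  rcases k with _ | k
  · rw [leftArm, face_arm0_inn] at hL
    rw [hL.1, singleDir]
    by_cases hR : γ = rctx ∧ y = 1
    · rw [if_pos ⟨hRm hR.1, .inr hR⟩] at h2
      simpa [hR, Dir.vec] using h2
    · rw [if_neg hR, if_neg hm]
      simpa [Dir.vec, sub_eq_add_neg] using h1.resolve_right hR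
  · simp only [leftArm, isR_iff] at hL
    by_cases hR : γ = rctx ∧ y = 1
    · rw [if_pos ⟨hRm hR.1, .inr hR⟩] at h2
      rw [if_pos hR, face_rfirst_inn] at hL
      rw [hL.1]
      simpa [singleDir, Dir.vec] using h2
    rw [if_neg hR] at hL
    by_cases hx : γ.m = .west ∧ y ≤ k + 1
    · rw [if_pos ⟨hx.1, .inl (by push_cast; exact hx.2)⟩] at h2
      rw [if_pos hx, face_arm_inn, hc] at hL
      rcases hL with ⟨rfl, -⟩ | ⟨rfl, -⟩
      · simpa [Dir.vec, sub_eq_add_neg] using h1.resolve_right hR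
      · by_cases hy1 : y = 1 <;> simpa [Dir.vec, rowDir, hy1] using h2
    · rw [if_neg (by push_cast; tauto)] at h2
      rw [if_neg hx, face_arm_inn, hc] at hL
      rcases hL with ⟨rfl, -⟩ | ⟨rfl, -⟩
      · simpa [Dir.vec, sub_eq_add_neg] using h1.resolve_right hR
      · simpa [Dir.vec, rowDir] using h2

/-- A left arm that is started from above grows downwards. -/
theorem left_mem_down (h : G.Hereditary k (some γ) A) (hm : γ.m = .north)
    (hl : 0 < G.len k) {y : ℤ} (hy : 1 ≤ y) (hy' : y < G.len k)
    (h1 : A 0 (y + 1)) (h2 : k = 0 ∨ A 1 y) : A 0 y := by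
  have hR : γ ≠ rctx := by rintro rfl; simp at hm
  refine h 0 y le_rfl hl (by omega) hy' fun u L hL => ?_
  rw [G.block_left k γ (by omega), faceAt_some] at hL
  have hc : coopDir true γ = .north := by simp [coopDir, hm]
  rcases k with _ | k
  · rw [leftArm, face_arm0_inn] at hL
    rw [hL.1, singleDir]
    simpa [hR, hm, Dir.vec] using h1
  · simp only [leftArm, isR_iff] at hL
    rw [if_neg (fun h => hR h.1), if_neg (by simp [hm]), face_arm_inn, hc] at hL
    rcases hL with ⟨rfl, -⟩ | ⟨rfl, -⟩
    · simpa [Dir.vec] using h1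
    · simpa [Dir.vec, rowDir] using h2

theorem left_upto (h : G.Hereditary k (some γ) A) (hm : γ.m ≠ .north) (hl : 0 < G.len k)
    {N : ℤ} (hN : N ≤ G.len k) (h0 : A 0 0)
    (h2 : ∀ y, 1 ≤ y → y < N →
      if γ.m = .west ∧ (y ≤ k ∨ (γ = rctx ∧ y = 1)) then A (-1) y else k = 0 ∨ A 1 y)
    {y : ℤ} (hy : 0 ≤ y) (hy' : y < N) : A 0 y := by
  lift y to ℕ using hy
  induction y with
  | zero => exact h0
  | succ y ih =>
    push_cast at hy' ⊢
    refine left_mem h hm hl (by omega) (by omega) (.inl ?_) (h2 _ (by omega) hy')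
    rw [add_sub_cancel_right]
    exact ih (by omega)

theorem left_down (h : G.Hereditary k (some γ) A) (hm : γ.m = .north) (hl : 0 < G.len k)
    (h0 : A 0 (G.len k)) (h2 : ∀ y, 1 ≤ y → y < G.len k → k = 0 ∨ A 1 y)
    {y : ℤ} (hy : 1 ≤ y) (hy' : y < G.len k) : A 0 y := by
  obtain ⟨j, hj⟩ : ∃ j : ℕ, y = G.len k - j := ⟨(G.len k - y).toNat, by omega⟩
  induction j generalizing y with
  | zero => omega
  | succ j ih =>
    refine left_mem_down h hm hl hy hy' ?_ (h2 y hy hy')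
    rcases eq_or_ne (y + 1) (G.len k) with e | e
    · rw [e]; exact h0
    · exact ih (by omega) (by omega) (by push_cast at hj; omega)

end arms

theorem pat_mem (hG : G.Proper) {B : Option Ctx} {A : ℤ → ℤ → Prop} (h : G.Hereditary 0 B A)
    (h0 : B = none ∨ (A 0 1 ∧ A 1 0)) {x y : ℤ} (hx : 1 ≤ x) (hx' : x < G.len 0)
    (hy : 1 ≤ y) (hy' : y < G.len 0) : A x y := by
  by_cases hq : (x - 1, y - 1) ∈ G.Q
  · obtain ⟨rk, htree⟩ := hG.Q_tree
    obtain ⟨j, hj⟩ : ∃ j, rk (x - 1, y - 1) = j := ⟨_, rfl⟩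
    induction j using Nat.strong_induction_on generalizing x y with
    | _ j ih =>
      refine h x y (by omega) hx' (by omega) hy' fun u L hL => ?_
      rw [G.block_zero_of_mem B hx hy hq, faceAt_some] at hL
      by_cases hs : B.isNone = true ∧ (x - 1, y - 1) = ((0, 0) : ℤ × ℤ)
      · rw [hs.1, hs.2] at hL
        exact absurd hL (face_seed u L)
      · rw [face, patFace_inn hs] at hL
        rw [hL.1, singleDir]
        split_ifs with h1 hp
        · rcases h0 with rfl | h0
          · simp [h1] at hs
          · obtain ⟨e1, e2⟩ := Prod.mk.inj h1
            obtain rfl : x = 1 := by omega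
            obtain rfl : y = 1 := by omega
            simpa [Dir.vec] using h0.1
        · rcases h0 with rfl | h0
          · simp [h1] at hs
          · obtain ⟨e1, e2⟩ := Prod.mk.inj h1
            obtain rfl : x = 1 := by omega
            obtain rfl : y = 1 := by omega
            simpa [Dir.vec] using h0.2
        · obtain ⟨t1, t2⟩ := htree _ hq h1
          set v := (G.qpar (x - 1, y - 1)).vec
          have e : ((x - 1, y - 1) : ℤ × ℤ) + v = (x + v.1 - 1, y + v.2 - 1) := by
            ext
            · simp only [Prod.fst_add]; ring
            · simp only [Prod.snd_add]; ring
          rw [e] at t1 t2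
          have hb := hG.Q_bounds _ _ t1
          simp only [len] at *
          exact ih _ (hj ▸ t2) (by omega) (by omega) (by omega) (by omega) t1 rfl
  · refine h x y (by omega) hx' (by omega) hy' fun u L hL => ?_
    rw [G.block_zero_of_notMem B hx hy hq] at hL
    simp at hL

/-- If the growth of a block is started, the block is completed. -/
def Grows (G : Scheme) (k : ℕ) (B : Option Ctx) : Prop :=
  ∀ A, G.Hereditary k B A → (∀ γ, B = some γ → G.Started k γ A) →
    ∀ x y, 0 ≤ x → x < G.len k → 0 ≤ y → y < G.len k → A x y

theorem Grows.of_swap (hG : G.Proper) {k : ℕ} {B : Option Ctx}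
    (h : G.swap.Grows k (B.map Ctx.swap)) : G.Grows k B := by
  intro A hA hS x y hx hx' hy hy'
  refine h (fun x y => A y x) (hA.swap hG) (fun γ hγ => ?_) y x hy (by simpa using hy') hx
    (by simpa using hx')
  obtain ⟨γ', hB, rfl⟩ := Option.map_eq_some_iff.1 hγ
  exact (hS γ' hB).swap

section subblocks

variable {k : ℕ} {B : Option Ctx} {A : ℤ → ℤ → Prop}

/-- The property holds on the subblock at `(a, b)`. -/
def SubMem (G : Scheme) (k : ℕ) (A : ℤ → ℤ → Prop) (a b : ℤ) : Prop :=
  ∀ x y, 0 ≤ x → x < G.len k → 0 ≤ y → y < G.len k →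
    A (1 + G.len k * a + x) (1 + G.len k * b + y)

/-- The growth of a subblock is started by the neighbor in the direction `γ.m`. -/
theorem subMem_of_parent (hG : G.Proper) (hgrow : ∀ B, G.Grows k B)
    (hA : G.Hereditary (k + 1) B A) {a b : ℤ} (hV : (a, b) ∈ G.V) {γ : Ctx}
    (hγ : G.sub B (a, b) = some γ) (h : G.SubMem k A (a + γ.m.vec.1) (b + γ.m.vec.2)) :
    G.SubMem k A a b := by
  have hl := hG.add_three_le_len k
  have hH := hA.sub hG hV
  rw [hγ] at hH
  refine hgrow (some γ) _ hH ?_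
  rintro _ ⟨⟩
  obtain ⟨r, w, m⟩ := γ
  cases m <;> simp only [Started, Dir.vec, add_zero] at h ⊢ <;> intro z hz hz' _
  · have := h z 0 hz hz' le_rfl (by omega)
    rwa [show 1 + G.len k * (b + 1) + 0 = 1 + G.len k * b + G.len k by ring] at this
  · have := h 0 z le_rfl (by omega) hz hz'
    rwa [show 1 + G.len k * (a + 1) + 0 = 1 + G.len k * a + G.len k by ring] at this
  · have := h z (G.len k - 1) hz hz' (by omega) (by omega)
    rwa [show 1 + G.len k * (b + -1) + (G.len k - 1) = 1 + G.len k * b + -1 by ring] at this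
  · have := h (G.len k - 1) z (by omega) (by omega) hz hz'
    rwa [show 1 + G.len k * (a + -1) + (G.len k - 1) = 1 + G.len k * a + -1 by ring] at this

theorem subMem_col (hG : G.Proper) (hgrow : ∀ B, G.Grows k B)
    (hA : G.Hereditary (k + 1) B A) (hm : ∀ γ, B = some γ → γ.m ≠ .north)
    (h0 : G.SubMem k A 0 0) {b : ℤ} (hb : 0 ≤ b) (hb' : b < G.c) : G.SubMem k A 0 b := by
  lift b to ℕ using hb
  induction b with
  | zero => exact h0
  | succ b ih =>
    have e : ((b + 1 : ℕ) : ℤ) ≠ 0 := by omega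
    have hs : ∃ r, G.sub B (0, ((b + 1 : ℕ) : ℤ)) = some ⟨r, (0, ((b + 1 : ℕ) : ℤ)), .south⟩ := by
      rcases B with _ | γ
      · exact ⟨true, by simp only [sub, Prod.mk.injEq, e]; simp⟩
      · exact ⟨false, by simp only [sub, Prod.mk.injEq, e, hm γ rfl]; simp⟩
    obtain ⟨r, hs⟩ := hs
    refine subMem_of_parent hG hgrow hA (hG.col_mem _ (by omega) hb') hs ?_
    have := ih (by omega)
    simpa [Dir.vec] using this

theorem subMem_row (hG : G.Proper) (hgrow : ∀ B, G.Grows k B)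
    (hA : G.Hereditary (k + 1) B A) (hm : ∀ γ, B = some γ → γ.m ≠ .east)
    (h0 : G.SubMem k A 0 0) {a : ℤ} (ha : 0 ≤ a) (ha' : a < G.c) : G.SubMem k A a 0 := by
  lift a to ℕ using ha
  induction a with
  | zero => exact h0
  | succ a ih =>
    have e : ((a + 1 : ℕ) : ℤ) ≠ 0 := by omega
    have hs : ∃ r, G.sub B (((a + 1 : ℕ) : ℤ), 0) = some ⟨r, (((a + 1 : ℕ) : ℤ), 0), .west⟩ := by
      rcases B with _ | γ
      · exact ⟨true, by simp only [sub, Prod.mk.injEq, e]; simp⟩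
      · exact ⟨false, by simp only [sub, Prod.mk.injEq, e, hm γ rfl]; simp⟩
    obtain ⟨r, hs⟩ := hs
    refine subMem_of_parent hG hgrow hA (hG.row_mem _ (by omega) ha') hs ?_
    have := ih (by omega)
    simpa [Dir.vec] using this

theorem subMem_of_notMem (hG : G.Proper) (hA : G.Hereditary (k + 1) B A) {a b : ℤ} (ha : 0 ≤ a)
    (ha' : a < G.c) (hb : 0 ≤ b) (hb' : b < G.c) (hV : (a, b) ∉ G.V) : G.SubMem k A a b := by
  intro x y hx hx' hy hy'
  have hl := hG.add_three_le_len k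
  have h1 : 0 ≤ G.len k * a := mul_nonneg (by omega) ha
  have h2 : 0 ≤ G.len k * b := mul_nonneg (by omega) hb
  refine hA _ _ (by omega) (hG.len_mul_add_lt ha' hx') (by omega) (hG.len_mul_add_lt hb' hy')
    fun u L hL => ?_
  rw [G.block_sub_none B hx hx' hy hy' ha hb hV] at hL
  simp at hL

/-- The growth spreads along the spanning tree. -/
theorem subMem_all (hG : G.Proper) (hgrow : ∀ B, G.Grows k B)
    (hA : G.Hereditary (k + 1) B A) (hrow : ∀ a, 0 ≤ a → a < G.c → G.SubMem k A a 0)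
    (hcol : ∀ b, 0 ≤ b → b < G.c → G.SubMem k A 0 b) {a b : ℤ} (ha : 0 ≤ a) (ha' : a < G.c)
    (hb : 0 ≤ b) (hb' : b < G.c) : G.SubMem k A a b := by
  by_cases hV : (a, b) ∈ G.V
  · obtain ⟨rk, htree⟩ := hG.tree
    obtain ⟨j, hj⟩ : ∃ j, rk (a, b) = j := ⟨_, rfl⟩
    induction j using Nat.strong_induction_on generalizing a b with
    | _ j ih =>
      by_cases ha0 : a = 0
      · subst ha0; exact hcol b hb hb'
      by_cases hb0 : b = 0
      · subst hb0; exact hrow a ha ha'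
      obtain ⟨t1, t2⟩ := htree _ hV ha0 hb0
      obtain ⟨γ, hs⟩ : ∃ γ, G.sub B (a, b) = some γ := by
        rw [← Option.ne_none_iff_exists', ne_eq, sub_eq_none_iff]
        simp [ha0]
      refine subMem_of_parent hG hgrow hA hV hs ?_
      rw [sub_off ha0 hb0 hs]
      have hbd := hG.V_bounds _ _ t1
      exact ih _ (hj ▸ t2) hbd.1 hbd.2.1 hbd.2.2.1 hbd.2.2.2 t1 rfl
  · exact subMem_of_notMem hG hA ha ha' hb hb' hV

theorem off_mem (hG : G.Proper) (hall : ∀ a b, 0 ≤ a → a < G.c → 0 ≤ b → b < G.c → G.SubMem k A a b)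
    {x y : ℤ} (hx : 1 ≤ x) (hx' : x < G.len (k + 1)) (hy : 1 ≤ y) (hy' : y < G.len (k + 1)) :
    A x y := by
  obtain ⟨a, r, ha, ha', hr, hr', rfl⟩ := hG.exists_digit (k := k) hx hx'
  obtain ⟨b, s, hb, hb', hs, hs', rfl⟩ := hG.exists_digit (k := k) hy hy'
  exact hall a b ha ha' hb hb' r s hr hr' hs hs'

theorem row_mem_of_subMem (hG : G.Proper)
    (hrow : ∀ a, 0 ≤ a → a < G.c → G.SubMem k A a 0) {x : ℤ} (hx : 1 ≤ x)
    (hx' : x < G.len (k + 1)) : A x 1 := by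
  have hl := hG.add_three_le_len k
  obtain ⟨a, r, ha, ha', hr, hr', rfl⟩ := hG.exists_digit (k := k) hx hx'
  simpa using hrow a ha ha' r 0 hr hr' le_rfl (by omega)

theorem col_mem_of_subMem (hG : G.Proper)
    (hcol : ∀ b, 0 ≤ b → b < G.c → G.SubMem k A 0 b) {y : ℤ} (hy : 1 ≤ y)
    (hy' : y < G.len (k + 1)) : A 1 y := by
  have hl := hG.add_three_le_len k
  obtain ⟨b, s, hb, hb', hs, hs', rfl⟩ := hG.exists_digit (k := k) hy hy'
  simpa using hcol b hb hb' 0 s le_rfl (by omega) hs hs'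

end subblocks

theorem forall_mem_of_parts {A : ℤ → ℤ → Prop} {l : ℤ} (h0 : A 0 0)
    (h1 : ∀ y, 1 ≤ y → y < l → A 0 y) (h2 : ∀ x, 1 ≤ x → x < l → A x 0)
    (h3 : ∀ x y, 1 ≤ x → x < l → 1 ≤ y → y < l → A x y) :
    ∀ x y, 0 ≤ x → x < l → 0 ≤ y → y < l → A x y := by
  intro x y hx hx' hy hy'
  rcases eq_or_lt_of_le hx with rfl | hx0 <;> rcases eq_or_lt_of_le hy with rfl | hy0
  · exact h0
  · exact h1 y hy0 hy'
  · exact h2 x hx0 hx'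
  · exact h3 x y hx0 hx' hy0 hy'

section west

variable {k : ℕ} {γ : Ctx} {A : ℤ → ℤ → Prop}

theorem corner_west (hG : G.Proper) (hA : G.Hereditary k (some γ) A) (hm : γ.m = .west)
    (hS : ∀ y, 0 ≤ y → y < G.len k → y ≤ k ∨ γ = rctx → A (-1) y) : A 0 0 := by
  have hl := hG.add_three_le_len k
  refine corner_mem hG hA ?_
  by_cases hR : γ = rctx
  · have := left_mem hA (by simp [hm]) (by omega) le_rfl (by omega) (.inr ⟨hR, rfl⟩) (by
      rw [if_pos ⟨hm, .inr ⟨hR, rfl⟩⟩]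
      exact hS 1 (by omega) (by omega) (.inr hR))
    simpa [singleDir, hR, Dir.vec] using this
  · have h2 : γ ≠ rctx.swap := by rintro rfl; simp at hm
    have := hS 0 le_rfl (by omega) (.inl (by omega))
    simpa only [singleDir, hR, h2, if_false, hm, Dir.vec] using this

theorem bottom_west (hG : G.Proper) (hA : G.Hereditary k (some γ) A) (hm : γ.m = .west)
    (h0 : A 0 0) (h2 : ∀ x, 1 ≤ x → x < G.len k → k = 0 ∨ A x 1) {x : ℤ} (hx : 0 ≤ x)
    (hx' : x < G.len k) : A x 0 := by
  have hl := hG.add_three_le_len k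
  refine left_upto (N := G.len k) (hA.swap hG) (by simp [hm]) (by simp; omega) (by simp) h0
    (fun x h3 h4 => ?_) hx hx'
  rw [if_neg (by simp [hm])]
  exact h2 x h3 h4

theorem left_all (hG : G.Proper) (hA : G.Hereditary k (some γ) A) (hm : γ.m ≠ .north)
    (h0 : A 0 0) (hS : γ.m = .west → ∀ y, 0 ≤ y → y < G.len k → y ≤ k ∨ γ = rctx → A (-1) y)
    (h2 : ∀ y, 1 ≤ y → y < G.len k → k = 0 ∨ A 1 y) {y : ℤ} (hy : 0 ≤ y)
    (hy' : y < G.len k) : A 0 y := by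
  have hl := hG.add_three_le_len k
  refine left_upto (N := G.len k) hA hm (by omega) le_rfl h0 (fun y h3 h4 => ?_) hy hy'
  split_ifs with h
  · exact hS h.1 y (by omega) h4 (h.2.imp_right And.left)
  · exact h2 y h3 h4

/-- A block of level `0` that is started from the left. -/
theorem grows_west_zero (hG : G.Proper) (hm : γ.m = .west) : G.Grows 0 (some γ) := by
  intro A hA hS
  have hS := hS γ rfl
  simp only [Started, hm] at hS
  have hl := hG.add_three_le_len 0
  have h0 := corner_west hG hA hm hS
  have hleft {y : ℤ} (hy : 0 ≤ y) (hy' : y < G.len 0) : A 0 y :=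
    left_all hG hA (by simp [hm]) h0 (fun _ => hS) (fun _ _ _ => .inl rfl) hy hy'
  have hbot {x : ℤ} (hx : 0 ≤ x) (hx' : x < G.len 0) : A x 0 :=
    bottom_west hG hA hm h0 (fun _ _ _ => .inl rfl) hx hx'
  push_cast at hl
  exact forall_mem_of_parts h0 (fun y h1 h2 => hleft (by omega) h2)
    (fun x h1 h2 => hbot (by omega) h2)
    fun x y h1 h2 h3 h4 => pat_mem hG hA
      (.inr ⟨hleft (by omega) (by omega), hbot (by omega) (by omega)⟩) h1 h2 h3 h4

/-- A block that is started from the left: first its corner and the lowest part of its left arm are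
built, then the subblock in the corner, the other subblocks, and the remaining tiles of the arms. -/
theorem grows_west_succ (hG : G.Proper) (hgrow : ∀ B, G.Grows k B) (hm : γ.m = .west) :
    G.Grows (k + 1) (some γ) := by
  intro A hA hS
  have hS := hS γ rfl
  simp only [Started, hm] at hS
  have hl := hG.add_three_le_len (k + 1)
  have hc := hG.two_le_c
  have h0 := corner_west hG hA hm hS
  have hV0 := hG.row_mem 0 le_rfl (by omega)
  have hs0 : G.sub (some γ) (0, 0) = some ⟨false, (0, 0), .west⟩ := by simp [sub, hm]
  have h00 : G.SubMem k A 0 0 := by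
    have hH := hA.sub hG hV0
    rw [hs0] at hH
    refine hgrow _ _ hH ?_
    rintro _ ⟨⟩
    intro y hy hy' hyk
    have hyk : y ≤ k := by simpa using hyk
    rw [mul_zero, add_zero, show (1 : ℤ) + -1 = 0 by norm_num]
    refine left_upto (N := k + 2) hA (by simp [hm]) (by omega) (by push_cast at hl; omega) h0
      (fun y h3 h4 => ?_) (by omega) (by omega)
    rw [if_pos ⟨hm, .inl (by push_cast; omega)⟩]
    exact hS y (by omega) (by push_cast at hl; omega) (.inl (by push_cast; omega))
  have hrow := fun a => subMem_row hG hgrow hA (a := a) (by rintro _ ⟨⟩; simp [hm]) h00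
  have hcol := fun b => subMem_col hG hgrow hA (b := b) (by rintro _ ⟨⟩; simp [hm]) h00
  refine forall_mem_of_parts h0 (fun y h1 h2 => ?_) (fun x h1 h2 => ?_) fun x y h1 h2 h3 h4 =>
    off_mem hG (fun a b => subMem_all hG hgrow hA hrow hcol) h1 h2 h3 h4
  · exact left_all hG hA (by simp [hm]) h0 (fun _ => hS)
      (fun y h3 h4 => .inr (col_mem_of_subMem hG hcol h3 h4)) (by omega) h2
  · exact bottom_west hG hA hm h0 (fun x h3 h4 => .inr (row_mem_of_subMem hG hrow h3 h4))
      (by omega) h2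

end west

section east

variable {k : ℕ} {γ : Ctx} {A : ℤ → ℤ → Prop}

theorem bottom_east (hG : G.Proper) (hA : G.Hereditary k (some γ) A) (hm : γ.m = .east)
    (hS : A (G.len k) 0) (h2 : ∀ x, 1 ≤ x → x < G.len k → k = 0 ∨ A x 1) {x : ℤ} (hx : 1 ≤ x)
    (hx' : x < G.len k) : A x 0 := by
  have hl := hG.add_three_le_len k
  exact left_down (hA.swap hG) (by simp [hm]) (by simp; omega) (by simpa using hS)
    (by simpa using h2) hx (by simpa using hx')

theorem corner_east (hG : G.Proper) (hA : G.Hereditary k (some γ) A) (hm : γ.m = .east)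
    (h : A 1 0) : A 0 0 := by
  refine corner_mem hG hA ?_
  have h1 : γ ≠ rctx := by rintro rfl; simp at hm
  have h2 : γ ≠ rctx.swap := by rintro rfl; simp at hm
  simpa only [singleDir, h1, h2, if_false, hm, Dir.vec] using h

theorem grows_east_zero (hG : G.Proper) (hm : γ.m = .east) : G.Grows 0 (some γ) := by
  intro A hA hS
  have hS := hS γ rfl
  simp only [Started, hm] at hS
  have hl := hG.add_three_le_len 0
  push_cast at hl
  have hbot {x : ℤ} (hx : 1 ≤ x) (hx' : x < G.len 0) : A x 0 :=
    bottom_east hG hA hm (hS 0 le_rfl (by omega) le_rfl) (fun _ _ _ => .inl rfl) hx hx'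
  have h0 := corner_east hG hA hm (hbot le_rfl (by omega))
  have hleft {y : ℤ} (hy : 0 ≤ y) (hy' : y < G.len 0) : A 0 y :=
    left_all hG hA (by simp [hm]) h0 (by simp [hm]) (fun _ _ _ => .inl rfl) hy hy'
  exact forall_mem_of_parts h0 (fun y h1 h2 => hleft (by omega) h2) (fun x h1 h2 => hbot h1 h2)
    fun x y h1 h2 h3 h4 => pat_mem hG hA
      (.inr ⟨hleft (by omega) (by omega), hbot (by omega) (by omega)⟩) h1 h2 h3 h4

/-- A block that is started from the right: first the subblocks of the bottom row are built from
right to left, then the bottom arm, the corner, the left arm, and the other subblocks. -/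
theorem grows_east_succ (hG : G.Proper) (hgrow : ∀ B, G.Grows k B) (hm : γ.m = .east) :
    G.Grows (k + 1) (some γ) := by
  intro A hA hS
  have hS := hS γ rfl
  simp only [Started, hm] at hS
  have hl := hG.add_three_le_len (k + 1)
  have hlk := hG.add_three_le_len k
  have hc := hG.two_le_c
  have hs (a : ℤ) : G.sub (some γ) (a, 0) = some ⟨false, (a, 0), .east⟩ := by
    by_cases ha : a = 0 <;> simp [sub, hm, ha]
  have hrow (a : ℤ) (ha : 0 ≤ a) (ha' : a < G.c) : G.SubMem k A a 0 := by
    obtain ⟨j, hj⟩ : ∃ j : ℕ, a = G.c - 1 - j := ⟨(G.c - 1 - a).toNat, by omega⟩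
    induction j generalizing a with
    | zero =>
      have hV := hG.row_mem a ha ha'
      have hH := hA.sub hG hV
      rw [hs] at hH
      refine hgrow _ _ hH ?_
      rintro _ ⟨⟩
      intro y hy hy' hyk
      have e : 1 + G.len k * a + G.len k = G.len (k + 1) := by rw [hj, len]; push_cast; ring
      rw [e, mul_zero, add_zero]
      have := hG.len_mul_add_lt (k := k) (a := 0) (by omega) hy'
      rw [mul_zero, add_zero] at this
      exact hS _ (by omega) this (by push_cast; omega)
    | succ j ih =>
      refine subMem_of_parent hG hgrow hA (hG.row_mem a ha ha') (hs a) ?_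
      have := ih (a + 1) (by omega) (by push_cast at hj; omega) (by push_cast at hj; omega)
      simpa [Dir.vec] using this
  have hcol := fun b => subMem_col hG hgrow hA (b := b) (by rintro _ ⟨⟩; simp [hm])
    (hrow 0 le_rfl (by omega))
  have hbot {x : ℤ} (hx : 1 ≤ x) (hx' : x < G.len (k + 1)) : A x 0 :=
    bottom_east hG hA hm (hS 0 le_rfl (by omega) (by omega))
      (fun x h3 h4 => .inr (row_mem_of_subMem hG hrow h3 h4)) hx hx'
  have h0 := corner_east hG hA hm (hbot le_rfl (by omega))
  refine forall_mem_of_parts h0 (fun y h1 h2 => ?_) (fun x h1 h2 => hbot h1 h2)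
    fun x y h1 h2 h3 h4 => off_mem hG (fun a b => subMem_all hG hgrow hA hrow hcol) h1 h2 h3 h4
  exact left_all hG hA (by simp [hm]) h0 (by simp [hm])
    (fun y h3 h4 => .inr (col_mem_of_subMem hG hcol h3 h4)) (by omega) h2

end east

theorem Proper.grows_none_succ (hG : G.Proper) {k : ℕ} (hgrow : ∀ B, G.Grows k B) :
    G.Grows (k + 1) none := by
  intro A hA _
  have hc := hG.two_le_c
  have hV0 := hG.row_mem 0 le_rfl (by omega)
  have hs0 : G.sub none (0, 0) = none := by simp [sub]
  have hnone (x y : ℤ) (hx : 0 ≤ x) (hx' : x < G.len (k + 1)) (hy : 0 ≤ y)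
      (hy' : y < G.len (k + 1)) (h : x = 0 ∨ y = 0) : A x y := by
    refine hA x y hx hx' hy hy' fun u L hL => ?_
    rw [G.block_none_edge _ h] at hL
    simp at hL
  have h00 : G.SubMem k A 0 0 := by
    have hH := hA.sub hG hV0
    rw [hs0] at hH
    exact hgrow none _ hH (by rintro _ ⟨⟩)
  have hrow := fun a => subMem_row hG hgrow hA (a := a) (by rintro _ ⟨⟩) h00
  have hcol := fun b => subMem_col hG hgrow hA (b := b) (by rintro _ ⟨⟩) h00
  have hl := hG.add_three_le_len (k + 1)
  exact forall_mem_of_parts (hnone 0 0 le_rfl (by omega) le_rfl (by omega) (.inl rfl))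
    (fun y h1 h2 => hnone 0 y le_rfl (by omega) (by omega) h2 (.inl rfl))
    (fun x h1 h2 => hnone x 0 (by omega) h2 le_rfl (by omega) (.inr rfl))
    fun x y h1 h2 h3 h4 => off_mem hG (fun a b => subMem_all hG hgrow hA hrow hcol) h1 h2 h3 h4

theorem Proper.grows_none_zero (hG : G.Proper) : G.Grows 0 none := by
  intro A hA _ x y hx hx' hy hy'
  by_cases h : x = 0 ∨ y = 0
  · refine hA x y hx hx' hy hy' fun u L hL => ?_
    rw [G.block_none_edge _ h] at hL
    simp at hL
  · exact pat_mem hG hA (.inl rfl) (by omega) hx' (by omega) hy'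

/-- Every block whose growth is started is completed. -/
theorem Proper.grows (hG : G.Proper) (k : ℕ) (B : Option Ctx) : G.Grows k B := by
  induction k generalizing G B with
  | zero =>
    rcases B with _ | γ
    · exact hG.grows_none_zero
    · rcases hm : γ.m
      · exact .of_swap hG (grows_east_zero hG.swap (by simp [hm]))
      · exact grows_east_zero hG hm
      · exact .of_swap hG (grows_west_zero hG.swap (by simp [hm]))
      · exact grows_west_zero hG hm
  | succ k ih =>
    rcases B with _ | γ
    · exact hG.grows_none_succ fun B => ih hG B
    · rcases hm : γ.m
      · exact .of_swap hG (grows_east_succ hG.swap (fun B => ih hG.swap B) (by simp [hm]))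
      · exact grows_east_succ hG (fun B => ih hG B) hm
      · exact .of_swap hG (grows_west_succ hG.swap (fun B => ih hG.swap B) (by simp [hm]))
      · exact grows_west_succ hG (fun B => ih hG B) hm

/-! ### The tiling of the plane -/

/-- Whether `p` lies in the block of level `i` at the origin. Its lower left corner is the point
`(-(i + 1), -(i + 1))`, so that the pattern starts at the point `(0, 0)`. -/
def InTop (G : Scheme) (i : ℕ) (p : ℤ × ℤ) : Prop :=
  (0 ≤ p.1 + i + 1 ∧ p.1 + i + 1 < G.len i) ∧ 0 ≤ p.2 + i + 1 ∧ p.2 + i + 1 < G.len i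

/-- The tile at `p` in the block of level `i` at the origin. -/
noncomputable def topKind (G : Scheme) (i : ℕ) (p : ℤ × ℤ) : Option Kind :=
  G.block i none (p.1 + i + 1) (p.2 + i + 1)

theorem Proper.two_mul_add_three_le_len (hG : G.Proper) (k : ℕ) : 2 * k + 3 ≤ G.len k := by
  have hc := hG.two_le_c
  have hn := hG.two_le_n
  induction k with
  | zero => simp only [len]; omega
  | succ k ih => simp only [len]; push_cast; nlinarith

theorem InTop.succ (hG : G.Proper) {i : ℕ} {p : ℤ × ℤ} (h : G.InTop i p) : G.InTop (i + 1) p := by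
  have hc := hG.two_le_c
  have h1 := hG.len_mul_add_lt (show 0 < G.c by omega) h.1.2
  have h2 := hG.len_mul_add_lt (show 0 < G.c by omega) h.2.2
  obtain ⟨⟨h3, -⟩, h4, -⟩ := h
  simp only [mul_zero, add_zero] at h1 h2
  refine ⟨⟨?_, ?_⟩, ?_, ?_⟩ <;> push_cast <;> omega

theorem topKind_succ (hG : G.Proper) {i : ℕ} {p : ℤ × ℤ} (h : G.InTop i p) :
    G.topKind (i + 1) p = G.topKind i p := by
  have hc := hG.two_le_c
  have := G.block_sub none h.1.1 h.1.2 h.2.1 h.2.2 le_rfl le_rfl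
    (hG.row_mem 0 le_rfl (by omega))
  have e : G.sub none (0, 0) = none := by simp [sub]
  rw [e, mul_zero, add_zero] at this
  rw [topKind, topKind, ← this]
  congr 1 <;> push_cast <;> ring

theorem InTop.mono (hG : G.Proper) {i j : ℕ} (hij : i ≤ j) {p : ℤ × ℤ} (h : G.InTop i p) :
    G.InTop j p ∧ G.topKind j p = G.topKind i p := by
  induction hij with
  | refl => exact ⟨h, rfl⟩
  | step _ ih => exact ⟨ih.1.succ hG, (topKind_succ hG ih.1).trans ih.2⟩

theorem Proper.inTop (hG : G.Proper) {i : ℕ} {p : ℤ × ℤ} (h : p.1.natAbs + p.2.natAbs ≤ i) :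
    G.InTop i p := by
  have := hG.two_mul_add_three_le_len i
  refine ⟨⟨?_, ?_⟩, ?_, ?_⟩ <;> omega

/-- The tile at `p`. -/
noncomputable def kindAt (G : Scheme) (p : ℤ × ℤ) : Option Kind :=
  G.topKind (p.1.natAbs + p.2.natAbs) p

theorem InTop.kindAt_eq (hG : G.Proper) {i : ℕ} {p : ℤ × ℤ} (h : G.InTop i p) :
    G.kindAt p = G.topKind i p := by
  have h1 := (h.mono hG (le_max_left i (p.1.natAbs + p.2.natAbs))).2
  have h2 := ((hG.inTop le_rfl).mono hG (le_max_right i (p.1.natAbs + p.2.natAbs))).2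
  rw [← h1, h2, kindAt]

theorem Proper.compat_kindAt (hG : G.Proper) (p : ℤ × ℤ) (u : Dir) :
    (G.faceAt (G.kindAt p) u).Compat (G.faceAt (G.kindAt (p + u.vec)) u.opp) := by
  have key (p : ℤ × ℤ) : (G.faceAt (G.kindAt p) .east).Compat
      (G.faceAt (G.kindAt (p + Dir.east.vec)) .west) ∧
      (G.faceAt (G.kindAt p) .north).Compat (G.faceAt (G.kindAt (p + Dir.north.vec)) .south) := by
    have h0 : G.InTop (p.1.natAbs + p.2.natAbs + 1) p := hG.inTop (by omega)
    have h1 : G.InTop (p.1.natAbs + p.2.natAbs + 1) (p + Dir.east.vec) :=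
      hG.inTop (by simp only [Dir.vec, Prod.fst_add, Prod.snd_add]; omega)
    have h2 : G.InTop (p.1.natAbs + p.2.natAbs + 1) (p + Dir.north.vec) :=
      hG.inTop (by simp only [Dir.vec, Prod.fst_add, Prod.snd_add]; omega)
    rw [h0.kindAt_eq hG, h1.kindAt_eq hG, h2.kindAt_eq hG]
    simp only [InTop, topKind, Dir.vec, Prod.fst_add, Prod.snd_add, add_zero,
      add_right_comm _ (1 : ℤ)] at h0 h1 h2 ⊢
    exact ⟨hG.compat_east _ none h0.1.1 h1.1.2 h0.2.1 h0.2.2,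
      hG.compat_north _ none h0.1.1 h0.1.2 h0.2.1 h2.2.2⟩
  have e (p : ℤ × ℤ) (u : Dir) : p + u.vec + u.opp.vec = p := by
    rw [Dir.vec_opp, add_neg_cancel_right]
  cases u
  · exact (key p).2
  · exact (key p).1
  · have := (key (p + Dir.south.vec)).2.symm
    rwa [show Dir.north = Dir.south.opp from rfl, e] at this
  · have := (key (p + Dir.west.vec)).1.symm
    rwa [show Dir.east = Dir.west.opp from rfl, e] at this

theorem leftArm_ne_pat (G : Scheme) (k : ℕ) (γ : Ctx) (z : ℤ) (r : Bool) (q : ℤ × ℤ) :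
    G.leftArm k γ z ≠ .pat r q := by
  cases k <;> simp only [leftArm]
  · simp
  · split_ifs <;> simp

theorem frame_ne_pat (G : Scheme) (k : ℕ) (B : Option Ctx) (x y : ℤ) (r : Bool) (q : ℤ × ℤ) :
    G.frame k B x y ≠ some (.pat r q) := by
  rcases B with _ | γ
  · simp [frame]
  · have := G.swap.leftArm_ne_pat k γ.swap x r q.swap
    simp only [frame]
    split_ifs
    · simp
    · simpa using G.leftArm_ne_pat k γ y r q
    · intro h
      apply this
      rw [← Kind.swap_swap (G.swap.leftArm k γ.swap x), Option.some.inj h]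
      rfl

/-- The pattern tiles of the block at the origin have a kind of their own. -/
theorem Proper.eq_of_block_eq_pat (hG : G.Proper) {k : ℕ} {B : Option Ctx} {x y : ℤ} {q : ℤ × ℤ}
    (hx : 0 ≤ x) (hx' : x < G.len k) (hy : 0 ≤ y) (hy' : y < G.len k)
    (h : G.block k B x y = some (.pat true q)) : B = none ∧ x = q.1 + k + 1 ∧ y = q.2 + k + 1 := by
  have hframe (k : ℕ) (B : Option Ctx) {x y : ℤ} (hxy : ¬ (1 ≤ x ∧ 1 ≤ y))
      (h : G.block k B x y = some (.pat true q)) : False := by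
    cases k <;> rw [block, if_neg hxy] at h <;> exact G.frame_ne_pat _ _ _ _ _ _ h
  induction k generalizing B x y with
  | zero =>
    by_cases h1 : 1 ≤ x ∧ 1 ≤ y
    · rw [block, if_pos h1] at h
      split_ifs at h
      simp only [Option.some.injEq, Kind.pat.injEq] at h
      obtain ⟨h2, rfl⟩ := h
      exact ⟨by simpa using h2, by push_cast; ring, by push_cast; ring⟩
    · exact (hframe 0 B h1 h).elim
  | succ k ih =>
    by_cases h1 : 1 ≤ x ∧ 1 ≤ y
    · obtain ⟨a, r, ha, ha', hr, hr', rfl⟩ := hG.exists_digit (k := k) h1.1 hx'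
      obtain ⟨b, s, hb, hb', hs, hs', rfl⟩ := hG.exists_digit (k := k) h1.2 hy'
      by_cases hV : (a, b) ∈ G.V
      · rw [G.block_sub B hr hr' hs hs' ha hb hV] at h
        obtain ⟨h2, h3, h4⟩ := ih hr hr' hs hs' h
        rw [sub_eq_none_iff] at h2
        obtain ⟨rfl, h2⟩ := h2
        obtain ⟨rfl, rfl⟩ := Prod.mk.inj h2
        exact ⟨rfl, by push_cast; rw [h3]; ring, by push_cast; rw [h4]; ring⟩
      · rw [G.block_sub_none B hr hr' hs hs' ha hb hV] at h
        simp at h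
    · exact (hframe _ B h1 h).elim

theorem Proper.kindAt_zero (hG : G.Proper) : G.kindAt (0, 0) = some (.pat true (0, 0)) := by
  simp [kindAt, topKind, block, hG.Q_zero]

theorem Proper.kindAt_ne_seed (hG : G.Proper) {p : ℤ × ℤ} {k : Kind} (h : G.kindAt p = some k)
    (hp : p ≠ (0, 0)) : k ≠ .pat true (0, 0) := by
  rintro rfl
  have hin := hG.inTop (le_refl (p.1.natAbs + p.2.natAbs))
  obtain ⟨-, h1, h2⟩ := hG.eq_of_block_eq_pat hin.1.1 hin.1.2 hin.2.1 hin.2.2 h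
  refine hp (Prod.ext ?_ ?_)
  · show p.1 = 0
    simp only at h1; omega
  · show p.2 = 0
    simp only at h2; omega

theorem Proper.induction (hG : G.Proper) (S : Set (ℤ × ℤ))
    (hS : ∀ p, (∀ k u L, G.kindAt p = some k → G.face k u = .inn L → p + u.vec ∈ S) → p ∈ S) :
    S = Set.univ := by
  refine Set.eq_univ_of_forall fun p => ?_
  set i := p.1.natAbs + p.2.natAbs with hi
  have hin : G.InTop i p := hG.inTop le_rfl
  have := hG.grows i none (fun x y => (x - i - 1, y - i - 1) ∈ S) ?_ (by simp) _ _ hin.1.1 hin.1.2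
    hin.2.1 hin.2.2
  · convert this using 1
    ext <;> simp only <;> ring
  · intro x y hx hx' hy hy' h
    refine hS _ fun k u L hk hL => ?_
    have hxy : G.InTop i (x - i - 1, y - i - 1) := by
      refine ⟨⟨?_, ?_⟩, ?_, ?_⟩ <;> simp only <;> omega
    rw [hxy.kindAt_eq hG, topKind] at hk
    simp only [show (x - i - 1 + i + 1 : ℤ) = x by ring,
      show (y - i - 1 + i + 1 : ℤ) = y by ring] at hk
    have := h u L (by rw [hk]; exact hL)
    convert this using 1
    ext <;> simp only [Prod.fst_add, Prod.snd_add] <;> ring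

theorem Proper.infinite_dom (hG : G.Proper) : {p | ∃ k, G.kindAt p = some k}.Infinite := by
  have hc := hG.two_le_c
  refine Set.infinite_of_injective_forall_mem
    (f := fun i : ℕ => (G.len i - i - 1, -(i : ℤ) - 1)) ?_ ?_
  · intro i j h
    have := (Prod.mk.inj h).2
    omega
  · intro i
    have hl := hG.add_three_le_len i
    have h1 := hG.len_mul_add_lt (k := i) (a := 1) (r := 0) (by omega) (by omega)
    have hin : G.InTop (i + 1) (G.len i - i - 1, -(i : ℤ) - 1) := by
      refine ⟨⟨?_, ?_⟩, ?_, ?_⟩ <;> push_cast <;> omega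
    have hsub : G.sub none (1, 0) = some rctx := by simp [sub]
    have := G.block_sub (k := i) none le_rfl (by omega) le_rfl (by omega) zero_le_one le_rfl
      (hG.row_mem 1 zero_le_one (by omega))
    rw [hsub, block_corner] at this
    refine ⟨.corner rctx (i = 0), ?_⟩
    rw [hin.kindAt_eq hG, ← this, topKind]
    congr 1 <;> push_cast <;> ring

/-! ### Finitely many kinds -/

/-- The parameters of a kind are in the range that occurs. -/
def Bounded (G : Scheme) : Kind → Prop
  | .pat _ q => q ∈ Set.Icc 0 G.n ×ˢ Set.Icc 0 G.n
  | .corner γ _ => γ.w ∈ Set.Icc 0 G.c ×ˢ Set.Icc 0 G.c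
  | .arm0 _ γ z => γ.w ∈ Set.Icc 0 G.c ×ˢ Set.Icc 0 G.c ∧ z ∈ Set.Icc 0 G.n
  | .rfirst _ γ _ => γ.w ∈ Set.Icc 0 G.c ×ˢ Set.Icc 0 G.c
  | .arm _ γ d _ _ => γ.w ∈ Set.Icc 0 G.c ×ˢ Set.Icc 0 G.c ∧ d ∈ Set.Icc 0 G.c

theorem Bounded.swap {k : Kind} (h : G.swap.Bounded k) : G.Bounded k.swap := by
  cases k <;> simp_all [Bounded, Kind.swap]

theorem finite_bounded (G : Scheme) : {k | G.Bounded k}.Finite := by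
  have hbox (m : ℤ) : (Set.Icc 0 m ×ˢ Set.Icc 0 m).Finite :=
    (Set.finite_Icc 0 m).prod (Set.finite_Icc 0 m)
  have hctx : {γ : Ctx | γ.w ∈ Set.Icc 0 G.c ×ˢ Set.Icc 0 G.c}.Finite :=
    (((Set.finite_univ (α := Bool)).prod ((hbox G.c).prod (Set.finite_univ (α := Dir)))).image
      fun t => (⟨t.1, t.2.1, t.2.2⟩ : Ctx)).subset fun γ h =>
       ⟨(γ.root, γ.w, γ.m), by simpa using h, rfl⟩
  have h1 := ((Set.finite_univ (α := Bool)).prod (hbox G.n)).image fun t => Kind.pat t.1 t.2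
  have h2 := (hctx.prod (Set.finite_univ (α := Bool))).image fun t => Kind.corner t.1 t.2
  have h3 := ((Set.finite_univ (α := Bool)).prod (hctx.prod (Set.finite_Icc 0 G.n))).image
    fun t => Kind.arm0 t.1 t.2.1 t.2.2
  have h4 := ((Set.finite_univ (α := Bool)).prod (hctx.prod (Set.finite_univ (α := Bool)))).image
    fun t => Kind.rfirst t.1 t.2.1 t.2.2
  have h5 := ((Set.finite_univ (α := Bool)).prod (hctx.prod ((Set.finite_Icc 0 G.c).prod
    (Set.finite_univ (α := Xing × RowKind))))).image
    fun t => Kind.arm t.1 t.2.1 t.2.2.1 t.2.2.2.1 t.2.2.2.2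
  refine ((((h1.union h2).union h3).union h4).union h5).subset ?_
  rintro (⟨r, q⟩ | ⟨γ, z⟩ | ⟨ax, γ, z⟩ | ⟨ax, γ, z⟩ | ⟨ax, γ, d, x, K⟩) h
  · exact .inl (.inl (.inl (.inl ⟨(r, q), ⟨trivial, h⟩, rfl⟩)))
  · exact .inl (.inl (.inl (.inr ⟨(γ, z), ⟨h, trivial⟩, rfl⟩)))
  · exact .inl (.inl (.inr ⟨(ax, γ, z), ⟨trivial, h⟩, rfl⟩))
  · exact .inl (.inr ⟨(ax, γ, z), ⟨trivial, h, trivial⟩, rfl⟩)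
  · exact .inr ⟨(ax, γ, d, x, K), ⟨trivial, h.1, h.2, trivial⟩, rfl⟩

theorem Proper.bounded_leftArm (hG : G.Proper) {k : ℕ} {γ : Ctx}
    (hγ : γ.w ∈ Set.Icc 0 G.c ×ˢ Set.Icc 0 G.c) {z : ℤ} (hz : 1 ≤ z) (hz' : z < G.len k) :
    G.Bounded (G.leftArm k γ z) := by
  have hc := hG.two_le_c
  rcases k with _ | k
  · exact ⟨hγ, by omega, by simp only [len] at hz'; omega⟩
  · obtain ⟨a, r, ha, ha', hr, hr', rfl⟩ := hG.exists_digit hz hz'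
    rw [hG.leftArm_succ γ ha hr hr']
    split_ifs
    · exact hγ
    · exact ⟨hγ, le_rfl, by omega⟩
    · exact ⟨hγ, le_rfl, by omega⟩
    · exact ⟨hγ, ha, ha'.le⟩

theorem Proper.bounded_block (hG : G.Proper) {k : ℕ} {B : Option Ctx} (hB : G.Valid B) {x y : ℤ}
    (hx : 0 ≤ x) (hx' : x < G.len k) (hy : 0 ≤ y) (hy' : y < G.len k) {κ : Kind}
    (h : G.block k B x y = some κ) : G.Bounded κ := by
  have hframe (k : ℕ) {B : Option Ctx} (hB : G.Valid B) {x y : ℤ} (hx : 0 ≤ x) (hx' : x < G.len k)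
      (hy : 0 ≤ y) (hy' : y < G.len k) (hxy : ¬ (1 ≤ x ∧ 1 ≤ y))
      (h : G.block k B x y = some κ) : G.Bounded κ := by
    rcases B with _ | γ
    · rw [G.block_none_edge _ (by omega)] at h
      simp at h
    have hw : γ.w ∈ Set.Icc 0 G.c ×ˢ Set.Icc 0 G.c := by
      obtain ⟨h1, h2, h3, h4⟩ := hG.V_bounds _ _ (hB γ rfl).mem
      exact ⟨⟨h1, h2.le⟩, h3, h4.le⟩
    by_cases hx0 : x = 0
    · subst hx0
      by_cases hy0 : y = 0
      · subst hy0
        rw [block_corner] at h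
        obtain rfl := Option.some.inj h
        exact hw
      · rw [G.block_left k γ hy0] at h
        obtain rfl := Option.some.inj h
        exact hG.bounded_leftArm hw (by omega) hy'
    · obtain rfl : y = 0 := by omega
      rw [G.block_bottom k γ hx0] at h
      obtain rfl := Option.some.inj h
      exact (hG.swap.bounded_leftArm (γ := γ.swap) ⟨hw.2, hw.1⟩ (by omega)
        (by simpa using hx')).swap
  induction k generalizing B x y with
  | zero =>
    by_cases h1 : 1 ≤ x ∧ 1 ≤ y
    · rw [block, if_pos h1] at h
      split_ifs at h with hq
      obtain rfl := Option.some.inj h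
      obtain ⟨h1, h2, h3, h4⟩ := hG.Q_bounds _ _ hq
      exact ⟨⟨h1, h2.le⟩, h3, h4.le⟩
    · exact hframe 0 hB hx hx' hy hy' h1 h
  | succ k ih =>
    by_cases h1 : 1 ≤ x ∧ 1 ≤ y
    · obtain ⟨a, r, ha, ha', hr, hr', rfl⟩ := hG.exists_digit (k := k) h1.1 hx'
      obtain ⟨b, s, hb, hb', hs, hs', rfl⟩ := hG.exists_digit (k := k) h1.2 hy'
      by_cases hV : (a, b) ∈ G.V
      · rw [G.block_sub B hr hr' hs hs' ha hb hV] at h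
        exact ih (fun γ hγ => valid_sub hV hγ) hr hr' hs hs' h
      · rw [G.block_sub_none B hr hr' hs hs' ha hb hV] at h
        simp at h
    · exact hframe _ hB hx hx' hy hy' h1 h

/-- The blueprint of the growth that a scheme describes. -/
noncomputable def Proper.blueprint (hG : G.Proper) : Blueprint Kind Label where
  face := G.face
  str := Label.str
  binding := Label.Binding
  kind := G.kindAt
  seed := .pat true (0, 0)
  str_pos L := by cases L <;> simp [Label.str]
  kind_zero := hG.kindAt_zero
  seed_ne_inn := face_seed
  exists_inn p k u L hk hf hL := by
    have h := hG.compat_kindAt p u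
    rw [hk, faceAt_some, hf] at h
    generalize hg : G.faceAt (G.kindAt (p + u.vec)) u.opp = g at h
    cases h with
    | quiet h1 _ =>
      rcases h1 with h1 | ⟨K, h1⟩
      · simp at h1
      · obtain rfl := Face.out.inj h1
        exact hL.elim
    | out_inn _ =>
      cases hk' : G.kindAt (p + u.vec) with
      | none => simp [hk'] at hg
      | some k' => exact ⟨k', rfl, by rwa [hk'] at hg⟩
  exists_out p k u L hk hf := by
    have h := hG.compat_kindAt p u
    rw [hk, faceAt_some, hf] at h
    generalize hg : G.faceAt (G.kindAt (p + u.vec)) u.opp = g at h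
    cases h with
    | quiet h1 _ => rcases h1 with h1 | ⟨K, h1⟩ <;> simp at h1
    | inn_out _ =>
      cases hk' : G.kindAt (p + u.vec) with
      | none => simp [hk'] at hg
      | some k' => exact ⟨k', rfl, by rwa [hk'] at hg⟩
  sum_inStr p k hk hp := sum_inStr (hG.kindAt_ne_seed hk hp)
  exists_binding p k hk hp := exists_binding (hG.kindAt_ne_seed hk hp)
  inn_of_binding _ _ _ _ h h' hL := inn_of_binding h h' hL
  eq_of_binding _ _ _ _ h h' hL := eq_of_binding h h' hL
  induction := hG.induction
  finite_kinds := G.finite_bounded.subset <| by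
    rintro k ⟨p, hp⟩
    have hin := hG.inTop (le_refl (p.1.natAbs + p.2.natAbs))
    exact hG.bounded_block (by rintro _ ⟨⟩) hin.1.1 hin.1.2 hin.2.1 hin.2.2 hp
  infinite_dom := hG.infinite_dom

end Scheme
/-! ### The fibered version as the set of tiles -/

section fibered

variable {c : ℕ} {V : Set (ℤ × ℤ)}

theorem mem_stage_two (h0 : (0, 0) ∈ V) {p : ℤ × ℤ} :
    p ∈ stage c V 2 ↔ ∃ q ∈ V, ∃ v ∈ V, p = (q.1 + c * v.1, q.2 + c * v.2) := by
  have h1 (q : ℤ × ℤ) : q ∈ stage c V 1 ↔ q ∈ V := by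
    constructor
    · rintro (rfl | ⟨_, rfl, v, hv, rfl⟩)
      · exact h0
      · simpa [← Prod.zero_eq_mk] using hv
    · intro h
      exact .inr ⟨_, rfl, q, h, by simp [← Prod.zero_eq_mk]⟩
  constructor
  · rintro (h | ⟨q, hq, v, hv, rfl⟩)
    · exact ⟨p, (h1 p).1 h, _, h0, by simp⟩
    · exact ⟨q, (h1 q).1 hq, v, hv, by ext <;> simp⟩
  · rintro ⟨q, hq, v, hv, rfl⟩
    exact .inr ⟨q, (h1 q).2 hq, v, hv, by ext <;> simp⟩

/-- The layer that is added to the fibers in the stage `k`. -/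
def fiberLayer (c k : ℕ) : Set (ℤ × ℤ) :=
  {p | (p.1 = -(k : ℤ) - 1 ∧ -(k : ℤ) - 1 ≤ p.2 ∧ p.2 < edgeLength c k - k - 1) ∨
    (p.2 = -(k : ℤ) - 1 ∧ -(k : ℤ) - 1 ≤ p.1 ∧ p.1 < edgeLength c k - k - 1)}

theorem fiber_zero : fiber c 0 = fiberLayer c 0 := by
  ext ⟨x, y⟩
  simp only [fiber, fiberLayer, edgeLength, Set.mem_union, Set.mem_prod, Set.mem_singleton_iff,
    Set.mem_Icc, Set.mem_ofPred_eq, Nat.cast_zero]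
  omega

theorem fiber_succ (k : ℕ) : fiber c (k + 1) = fiber c k ∪ fiberLayer c (k + 1) := by
  ext ⟨x, y⟩
  simp only [fiber, fiberLayer, Set.mem_union, Set.mem_prod, Set.mem_singleton_iff,
    Set.mem_Icc, Set.mem_ofPred_eq]
  refine or_congr_right ?_
  push_cast
  omega

theorem mem_fiberedStage_succ {k : ℕ} {p : ℤ × ℤ} : p ∈ fiberedStage c V (k + 1) ↔
    p ∈ fiberedStage c V k ∨ ∃ q ∈ fiberedStage c V k ∪ fiber c k, ∃ a b, (a, b) ∈ V ∧
      (a, b) ≠ ((0, 0) : ℤ × ℤ) ∧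
      p = (q.1 + edgeLength c k * a, q.2 + edgeLength c k * b) := by
  refine or_congr_right ?_
  constructor
  · rintro ⟨q, hq, ⟨a, b⟩, ⟨hv, hv0⟩, rfl⟩
    exact ⟨q, hq, a, b, hv, hv0, by ext <;> simp⟩
  · rintro ⟨q, hq, a, b, hv, hv0, rfl⟩
    exact ⟨q, hq, (a, b), ⟨hv, hv0⟩, by ext <;> simp⟩

/-- The square of side `edgeLength c k` that contains the stage `k` and its fibers. -/
def fiberBox (c k : ℕ) : Set (ℤ × ℤ) :=
  {p | (0 ≤ p.1 + k + 1 ∧ p.1 + k + 1 < edgeLength c k) ∧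
    0 ≤ p.2 + k + 1 ∧ p.2 + k + 1 < edgeLength c k}

/-- The scheme of growth for the fibered version of the fractal generated by `V`, where `par` and
`qpar` are spanning trees of `V` and of the second stage. -/
def fractalScheme (c : ℕ) (V : Set (ℤ × ℤ)) (par qpar : ℤ × ℤ → Dir) : Scheme :=
  ⟨c, c ^ 2, V, par, stage c V 2, qpar, true⟩

variable {par qpar : ℤ × ℤ → Dir}

theorem len_fractalScheme (k : ℕ) : (fractalScheme c V par qpar).len k = edgeLength c k := by
  induction k with
  | zero => rfl
  | succ k ih => rw [Scheme.len, ih]; rfl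

variable (hG : (fractalScheme c V par qpar).Proper)
include hG

theorem fiberLayer_subset_box (k : ℕ) : fiberLayer c k ⊆ fiberBox c k := by
  have hl := hG.add_three_le_len k
  rw [len_fractalScheme] at hl
  rintro ⟨x, y⟩ (h | h) <;> simp only at h <;> refine ⟨⟨?_, ?_⟩, ?_, ?_⟩ <;> simp only <;> omega

theorem fibers_subset_box (k : ℕ) : fiberedStage c V k ∪ fiber c k ⊆ fiberBox c k := by
  induction k with
  | zero =>
    refine Set.union_subset (fun p hp => ?_) (fiber_zero.trans_subset (fiberLayer_subset_box hG 0))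
    obtain ⟨h1, h2, h3, h4⟩ := hG.Q_bounds p.1 p.2 hp
    have : (fractalScheme c V par qpar).n = c ^ 2 := rfl
    rw [this] at h2 h4
    have e : edgeLength c 0 = c ^ 2 + 1 := rfl
    refine ⟨⟨?_, ?_⟩, ?_, ?_⟩ <;> push_cast <;> omega
  | succ k ih =>
    have hc := hG.two_le_c
    have hl := hG.add_three_le_len k
    have hlt {a r : ℤ} := hG.len_mul_add_lt (k := k) (a := a) (r := r)
    simp only [len_fractalScheme] at hl hlt
    have key {q : ℤ × ℤ} {a b : ℤ} (hq : q ∈ fiberBox c k) (hV : (a, b) ∈ V) :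
        (q.1 + edgeLength c k * a, q.2 + edgeLength c k * b) ∈ fiberBox c (k + 1) := by
      obtain ⟨ha, ha', hb, hb'⟩ := hG.V_bounds a b hV
      obtain ⟨⟨h1, h2⟩, h3, h4⟩ := hq
      have h5 := hlt ha' h2
      have h6 := hlt hb' h4
      have h7 : 0 ≤ edgeLength c k * a := mul_nonneg (by omega) ha
      have h8 : 0 ≤ edgeLength c k * b := mul_nonneg (by omega) hb
      refine ⟨⟨?_, ?_⟩, ?_, ?_⟩ <;> push_cast <;> omega
    have key0 {q : ℤ × ℤ} (hq : q ∈ fiberBox c k) : q ∈ fiberBox c (k + 1) := by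
      simpa using key hq (hG.row_mem 0 le_rfl (by omega))
    rintro p (hp | hp)
    · rcases mem_fiberedStage_succ.1 hp with hp | ⟨q, hq, a, b, hV, -, rfl⟩
      · exact key0 (ih (.inl hp))
      · exact key (ih hq) hV
    · rw [fiber_succ] at hp
      rcases hp with hp | hp
      · exact key0 (ih (.inr hp))
      · exact fiberLayer_subset_box hG _ hp

/-- The points of the next stage and of its fibers in the translates of the box. -/
theorem mem_translate_iff {k : ℕ} {q : ℤ × ℤ} (hq : q ∈ fiberBox c k) {a b : ℤ} (ha : 0 ≤ a)
    (hb : 0 ≤ b) :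
    ((q.1 + edgeLength c k * a, q.2 + edgeLength c k * b) ∈ fiberedStage c V (k + 1) ↔
      (a, b) = ((0, 0) : ℤ × ℤ) ∧ q ∈ fiberedStage c V k ∨
        (a, b) ∈ V ∧ (a, b) ≠ ((0, 0) : ℤ × ℤ) ∧ q ∈ fiberedStage c V k ∪ fiber c k) ∧
    ((q.1 + edgeLength c k * a, q.2 + edgeLength c k * b) ∈ fiber c (k + 1) ↔
      (a, b) = ((0, 0) : ℤ × ℤ) ∧ q ∈ fiber c k) := by
  have hl := hG.add_three_le_len k
  rw [len_fractalScheme] at hl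
  have h7 : 0 ≤ edgeLength c k * a := mul_nonneg (by omega) ha
  have h8 : 0 ≤ edgeLength c k * b := mul_nonneg (by omega) hb
  have hbox := fibers_subset_box hG k
  -- The representation of a point by a point of the box and a translation is unique.
  have huniq {q' : ℤ × ℤ} {a' b' : ℤ} (hq' : q' ∈ fiberBox c k)
      (h : (q.1 + edgeLength c k * a, q.2 + edgeLength c k * b) =
        (q'.1 + edgeLength c k * a', q'.2 + edgeLength c k * b')) :
      a' = a ∧ b' = b ∧ q' = q := by
    obtain ⟨⟨h3, h4⟩, h5, h6⟩ := hq'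
    obtain ⟨h1, h2⟩ := Prod.mk.inj h
    have e1 := Scheme.digit_ediv (a := a) hq.1.1 hq.1.2
    have e2 := Scheme.digit_ediv (a := b) hq.2.1 hq.2.2
    have e3 := Scheme.digit_ediv (a := a') h3 h4
    have e4 := Scheme.digit_ediv (a := b') h5 h6
    obtain rfl : a' = a := by
      rw [← e1, ← e3]; congr 1; linarith
    obtain rfl : b' = b := by
      rw [← e2, ← e4]; congr 1; linarith
    exact ⟨rfl, rfl, Prod.ext (by linarith) (by linarith)⟩
  have huniq0 (hq' : (q.1 + edgeLength c k * a, q.2 + edgeLength c k * b) ∈ fiberBox c k) :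
      a = 0 ∧ b = 0 := by
    obtain ⟨h1, h2, -⟩ := huniq (a' := 0) (b' := 0) hq' (by simp)
    exact ⟨h1.symm, h2.symm⟩
  constructor
  · rw [mem_fiberedStage_succ]
    refine or_congr ⟨fun h => ?_, ?_⟩ ⟨?_, fun ⟨h1, h2, h3⟩ => ⟨q, h3, a, b, h1, h2, rfl⟩⟩
    · obtain ⟨rfl, rfl⟩ := huniq0 (hbox (.inl h))
      exact ⟨rfl, by simpa using h⟩
    · rintro ⟨h1, h2⟩
      obtain ⟨rfl, rfl⟩ := Prod.mk.inj h1
      simpa using h2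
    · rintro ⟨q', h1, a', b', h2, h3, h4⟩
      obtain ⟨rfl, rfl, rfl⟩ := huniq (hbox h1) h4
      exact ⟨h2, h3, h1⟩
  · have h1 : (q.1 + edgeLength c k * a, q.2 + edgeLength c k * b) ∉ fiberLayer c (k + 1) := by
      obtain ⟨⟨h3, -⟩, h5, -⟩ := hq
      rintro (⟨h1, -⟩ | ⟨h1, -⟩) <;> push_cast at h1 <;> omega
    rw [fiber_succ, Set.mem_union, or_iff_left h1]
    constructor
    · intro h
      obtain ⟨rfl, rfl⟩ := huniq0 (hbox (.inr h))
      exact ⟨rfl, by simpa using h⟩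
    · rintro ⟨h1, h2⟩
      obtain ⟨rfl, rfl⟩ := Prod.mk.inj h1
      simpa using h2

/-- The tiles of a block form a stage of the fibered version, with the fibers unless the block is
at the origin. -/
theorem block_ne_none_iff (k : ℕ) (B : Option Ctx) {x y : ℤ} (hx : 0 ≤ x)
    (hx' : x < edgeLength c k) (hy : 0 ≤ y) (hy' : y < edgeLength c k) :
    (fractalScheme c V par qpar).block k B x y ≠ none ↔
      (x - k - 1, y - k - 1) ∈ fiberedStage c V k ∨
        (B ≠ none ∧ (x - k - 1, y - k - 1) ∈ fiber c k) := by
  set G := fractalScheme c V par qpar with hGdef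
  have hlen (k : ℕ) : G.len k = edgeLength c k := len_fractalScheme k
  have hedge (k : ℕ) (B : Option Ctx) {x y : ℤ} (hx : 0 ≤ x) (hx' : x < edgeLength c k)
      (hy : 0 ≤ y) (hy' : y < edgeLength c k) (h : x = 0 ∨ y = 0) :
      (G.block k B x y ≠ none ↔ B ≠ none) ∧ (x - k - 1, y - k - 1) ∈ fiberLayer c k := by
    constructor
    · rcases B with _ | γ
      · simp [G.block_none_edge k h]
      · by_cases hx0 : x = 0
        · subst hx0
          by_cases hy0 : y = 0
          · subst hy0; simp [Scheme.block_corner]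
          · simp [G.block_left k γ hy0]
        · obtain rfl : y = 0 := by tauto
          simp [G.block_bottom k γ hx0]
    · rcases h with rfl | rfl
      · refine .inl ⟨?_, ?_, ?_⟩ <;> simp only <;> omega
      · refine .inr ⟨?_, ?_, ?_⟩ <;> simp only <;> omega
  induction k generalizing B x y with
  | zero =>
    by_cases h : 1 ≤ x ∧ 1 ≤ y
    · have h1 : (x - (0 : ℕ) - 1, y - (0 : ℕ) - 1) ∉ fiber c 0 := by
        rw [fiber_zero]
        rintro (h1 | h1) <;> simp only at h1 <;> omega
      have h2 : fiberedStage c V 0 = G.Q := rfl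
      rw [Scheme.block, if_pos h, h2, or_iff_left (fun h => h1 h.2)]
      simp only [Nat.cast_zero, sub_zero]
      split_ifs <;> simp_all
    · obtain ⟨h1, h2⟩ := hedge 0 B hx hx' hy hy' (by omega)
      rw [h1, fiber_zero]
      have h3 : (x - (0 : ℕ) - 1, y - (0 : ℕ) - 1) ∉ fiberedStage c V 0 := by
        intro h3
        obtain ⟨h4, -, h5, -⟩ := hG.Q_bounds _ _ h3
        push_cast at h4 h5
        omega
      simp only [h3, h2, and_true, false_or]
  | succ k ih =>
    have hc := hG.two_le_c
    have hl := hG.add_three_le_len k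
    rw [hlen] at hl
    by_cases h : 1 ≤ x ∧ 1 ≤ y
    · rw [← hlen] at hx' hy'
      obtain ⟨a, r, ha, ha', hr, hr', rfl⟩ := hG.exists_digit (k := k) h.1 hx'
      obtain ⟨b, s, hb, hb', hs, hs', rfl⟩ := hG.exists_digit (k := k) h.2 hy'
      rw [hlen] at hr' hs'
      have hbox : ((r - k - 1, s - k - 1) : ℤ × ℤ) ∈ fiberBox c k := by
        refine ⟨⟨?_, ?_⟩, ?_, ?_⟩ <;> simp only <;> omega
      have hpq : ((1 + G.len k * a + r - (k + 1 : ℕ) - 1, 1 + G.len k * b + s - (k + 1 : ℕ) - 1)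
          : ℤ × ℤ) = (r - k - 1 + edgeLength c k * a, s - k - 1 + edgeLength c k * b) := by
        rw [hlen]
        ext <;> push_cast <;> ring
      obtain ⟨hT, hF⟩ := mem_translate_iff hG hbox ha hb
      rw [hpq, hT, hF]
      have hV0 : ((0, 0) : ℤ × ℤ) ∈ V := hG.row_mem 0 le_rfl (by omega)
      by_cases hV : (a, b) ∈ V
      · rw [G.block_sub B hr (by rwa [hlen]) hs (by rwa [hlen]) ha hb hV]
        refine (ih (G.sub B (a, b)) hr hr' hs hs').trans ?_
        rw [ne_eq (G.sub B (a, b)), Scheme.sub_eq_none_iff, Set.mem_union]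
        by_cases h0 : (a, b) = ((0, 0) : ℤ × ℤ)
        · simp [h0]
        · simp [h0, hV]
      · rw [G.block_sub_none B hr (by rwa [hlen]) hs (by rwa [hlen]) ha hb hV]
        have h0 : (a, b) ≠ ((0, 0) : ℤ × ℤ) := fun h => hV (h ▸ hV0)
        simp [h0, hV]
    · obtain ⟨h1, h2⟩ := hedge (k + 1) B hx hx' hy hy' (by omega)
      have h3 : (x - (k + 1 : ℕ) - 1, y - (k + 1 : ℕ) - 1) ∉ fiberedStage c V (k + 1) := by
        have key {q : ℤ × ℤ} {a b : ℤ} (hq : q ∈ fiberBox c k) (hV : (a, b) ∈ V)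
            (h1 : (x - (k + 1 : ℕ) - 1, y - (k + 1 : ℕ) - 1) =
              (q.1 + edgeLength c k * a, q.2 + edgeLength c k * b)) : False := by
          obtain ⟨h1, h2⟩ := Prod.mk.inj h1
          obtain ⟨⟨h3, -⟩, h4, -⟩ := hq
          obtain ⟨h5, -, h6, -⟩ := hG.V_bounds a b hV
          have h7 : 0 ≤ edgeLength c k * a := mul_nonneg (by omega) h5
          have h8 : 0 ≤ edgeLength c k * b := mul_nonneg (by omega) h6
          push_cast at h1 h2
          omega
        intro h3
        rcases mem_fiberedStage_succ.1 h3 with h3 | ⟨q, hq, a, b, hV, -, h3⟩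
        · exact key (fibers_subset_box hG k (.inl h3)) (hG.row_mem 0 le_rfl (by omega)) (by simp)
        · exact key (fibers_subset_box hG k hq) hV h3
      rw [h1, fiber_succ]
      simp only [h3, false_or, Set.mem_union, h2, or_true, and_true]

theorem dom_blueprint : hG.blueprint.dom = fibered c V := by
  have hlen (k : ℕ) : (fractalScheme c V par qpar).len k = edgeLength c k := len_fractalScheme k
  have key {i : ℕ} {p : ℤ × ℤ} (h : (fractalScheme c V par qpar).InTop i p) :
      p ∈ hG.blueprint.dom ↔ p ∈ fiberedStage c V i := by
    have h1 := block_ne_none_iff hG i none h.1.1 (by rw [← hlen]; exact h.1.2) h.2.1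
      (by rw [← hlen]; exact h.2.2)
    have e : (p.1 + i + 1 - i - 1, p.2 + i + 1 - i - 1) = p := by
      ext <;> simp only <;> ring
    rw [e, or_iff_left (by simp)] at h1
    rw [← h1, Option.ne_none_iff_exists']
    show (∃ k, (fractalScheme c V par qpar).kindAt p = some k) ↔ _
    rw [h.kindAt_eq hG]
    rfl
  ext p
  rw [fibered, Set.mem_iUnion]
  constructor
  · intro hp
    exact ⟨_, (key (hG.inTop le_rfl)).1 hp⟩
  · rintro ⟨i, hi⟩
    refine (key ?_).2 hi
    have := fibers_subset_box hG i (.inl hi)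
    rwa [fiberBox, ← hlen] at this

end fibered
/-! ### Spanning trees -/

/-- The directions along a breadth-first spanning tree. -/
theorem exists_spanning_tree {S : Set (ℤ × ℤ)} (h0 : (0, 0) ∈ S)
    (hS : ∀ p : S, (fullGridGraph S).Reachable p ⟨_, h0⟩) :
    ∃ (par : ℤ × ℤ → Dir) (rk : ℤ × ℤ → ℕ), ∀ w ∈ S, w ≠ (0, 0) →
      w + (par w).vec ∈ S ∧ rk (w + (par w).vec) < rk w := by
  classical
  let rk : ℤ × ℤ → ℕ := fun w => if h : w ∈ S then (fullGridGraph S).dist ⟨w, h⟩ ⟨_, h0⟩ else 0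
  have key (w : ℤ × ℤ) : ∃ u : Dir, w ∈ S → w ≠ (0, 0) → w + u.vec ∈ S ∧ rk (w + u.vec) < rk w := by
    by_cases hw : w ∈ S
    · by_cases hw0 : w = (0, 0)
      · exact ⟨.north, fun _ h => absurd hw0 h⟩
      obtain ⟨W, hW⟩ := (hS ⟨w, hw⟩).exists_walk_length_eq_dist
      cases W with
      | nil => exact absurd rfl hw0
      | @cons _ v _ hadj W =>
        rw [SimpleGraph.Walk.length_cons] at hW
        obtain ⟨u, hu⟩ := hadj
        refine ⟨u, fun _ _ => ?_⟩
        have hv : w + u.vec ∈ S := hu ▸ v.2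
        have hv' : v = ⟨w + u.vec, hv⟩ := Subtype.ext hu
        refine ⟨hv, ?_⟩
        simp only [rk, dif_pos hw, dif_pos hv]
        rw [← hW, ← hv']
        exact Nat.lt_succ_of_le (SimpleGraph.dist_le W)
    · exact ⟨.north, fun h => absurd h hw⟩
  choose par hpar using key
  exact ⟨par, rk, hpar⟩

section

variable {c : ℕ} {V : Set (ℤ × ℤ)}
  (hrow : ∀ a : ℤ, 0 ≤ a → a < c → (a, 0) ∈ V) (hcol : ∀ b : ℤ, 0 ≤ b → b < c → (0, b) ∈ V)
  (hc : 1 < c) (hconn : (fullGridGraph V).Connected)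
include hrow hcol hc hconn

/-- The copies of the generator in the second stage are connected along their axes. -/
theorem reachable_stage_two (h0 : (0, 0) ∈ stage c V 2) (p : stage c V 2) :
    (fullGridGraph (stage c V 2)).Reachable p ⟨_, h0⟩ := by
  have h0V : ((0, 0) : ℤ × ℤ) ∈ V := hrow 0 le_rfl (by omega)
  have hmem {q v : ℤ × ℤ} (hq : q ∈ V) (hv : v ∈ V) :
      (q.1 + c * v.1, q.2 + c * v.2) ∈ stage c V 2 := (mem_stage_two h0V).2 ⟨q, hq, v, hv, rfl⟩
  -- the translation of the generator to one of its copies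
  let f (v : V) : fullGridGraph V →g fullGridGraph (stage c V 2) :=
    { toFun := fun q => ⟨_, hmem q.2 v.2⟩
      map_rel' := by
        rintro q q' ⟨u, hu⟩
        refine ⟨u, ?_⟩
        simp only [hu]
        ext <;> simp only [Prod.fst_add, Prod.snd_add] <;> ring }
  have hcopy (v q q' : V) : (fullGridGraph (stage c V 2)).Reachable (f v q) (f v q') :=
    (hconn.preconnected q q').map (f v)
  let o : V := ⟨_, h0V⟩
  have hstep (v v' : V) (u : Dir) (hu : u = .east ∨ u = .north) (h : (v' : ℤ × ℤ) = v + u.vec) :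
      (fullGridGraph (stage c V 2)).Reachable (f v o) (f v' o) := by
    rcases hu with rfl | rfl
    · refine (hcopy v o ⟨(c - 1, 0), hrow _ (by omega) (by omega)⟩).trans
        (SimpleGraph.Adj.reachable ⟨.east, ?_⟩)
      simp only [f, o, RelHom.coeFn_mk, h, Dir.vec]
      ext <;> simp only [Prod.fst_add, Prod.snd_add] <;> ring
    · refine (hcopy v o ⟨(0, c - 1), hcol _ (by omega) (by omega)⟩).trans
        (SimpleGraph.Adj.reachable ⟨.north, ?_⟩)
      simp only [f, o, RelHom.coeFn_mk, h, Dir.vec]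
      ext <;> simp only [Prod.fst_add, Prod.snd_add] <;> ring
  have hwalk {v v' : V} (W : (fullGridGraph V).Walk v v') :
      (fullGridGraph (stage c V 2)).Reachable (f v o) (f v' o) := by
    induction W with
    | nil => rfl
    | @cons v w _ hadj _ ih =>
      refine SimpleGraph.Reachable.trans ?_ ih
      obtain ⟨u, hu⟩ := hadj
      have hu' : (v : ℤ × ℤ) = w + u.opp.vec := by rw [hu, Dir.vec_opp, add_neg_cancel_right]
      cases u
      · exact hstep v w _ (.inr rfl) hu
      · exact hstep v w _ (.inl rfl) hu
      · exact (hstep w v _ (.inr rfl) hu').symm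
      · exact (hstep w v _ (.inl rfl) hu').symm
  obtain ⟨q, hq, v, hv, e⟩ := (mem_stage_two h0V).1 p.2
  obtain rfl : p = f ⟨v, hv⟩ ⟨q, hq⟩ := Subtype.ext e
  obtain ⟨W⟩ := hconn.preconnected ⟨v, hv⟩ o
  have e0 : (⟨_, h0⟩ : stage c V 2) = f o o := Subtype.ext (by simp [f, o])
  rw [e0]
  exact (hcopy _ _ o).trans (hwalk W)

end

theorem IsNiceFractal.exists_proper {c : ℕ} {V X : Set (ℤ × ℤ)} (hX : IsNiceFractal c V X) :
    ∃ par qpar, (fractalScheme c V par qpar).Proper := by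
  have hc := hX.one_lt
  have hrow : ∀ a : ℤ, 0 ≤ a → a < c → (a, 0) ∈ V := fun a h h' =>
    hX.axes_subset (.inl ⟨⟨h, by omega⟩, rfl⟩)
  have hcol : ∀ b : ℤ, 0 ≤ b → b < c → (0, b) ∈ V := fun b h h' =>
    hX.axes_subset (.inr ⟨rfl, h, by omega⟩)
  have h0 : ((0, 0) : ℤ × ℤ) ∈ V := hrow 0 le_rfl (by omega)
  have hV : ∀ a b, (a, b) ∈ V → 0 ≤ a ∧ a < c ∧ 0 ≤ b ∧ b < c := fun a b h => by
    obtain ⟨⟨h1, h2⟩, h3, h4⟩ := hX.subset_square h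
    simp only at h1 h2 h3 h4
    omega
  have hQ0 : ((0, 0) : ℤ × ℤ) ∈ stage c V 2 := (mem_stage_two h0).2 ⟨_, h0, _, h0, by simp⟩
  obtain ⟨par, rk, hpar⟩ := exists_spanning_tree h0 fun p => hX.connected.preconnected p _
  obtain ⟨qpar, qrk, hqpar⟩ :=
    exists_spanning_tree hQ0 (reachable_stage_two hrow hcol hc hX.connected hQ0)
  refine ⟨par, qpar, ?_⟩
  constructor
  · show (2 : ℤ) ≤ c
    omega
  · show (2 : ℤ) ≤ c ^ 2
    nlinarith
  · exact hV
  · exact hrow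
  · exact hcol
  · exact ⟨rk, fun w hw h1 _ => hpar w hw (by rintro rfl; exact h1 rfl)⟩
  · intro a b h
    obtain ⟨q, hq, v, hv, e⟩ := (mem_stage_two h0).1 h
    obtain ⟨rfl, rfl⟩ := Prod.mk.inj e
    obtain ⟨h1, h2, h3, h4⟩ := hV _ _ hq
    obtain ⟨h5, h6, h7, h8⟩ := hV _ _ hv
    show 0 ≤ _ ∧ _ < (c : ℤ) ^ 2 ∧ 0 ≤ _ ∧ _ < (c : ℤ) ^ 2
    refine ⟨?_, ?_, ?_, ?_⟩ <;> nlinarith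
  · exact hQ0
  · have := hrow (c - 1) (by omega) (by omega)
    exact (mem_stage_two h0).2 ⟨_, this, _, this, by ext <;> simp only [fractalScheme] <;> ring⟩
  · have := hcol (c - 1) (by omega) (by omega)
    exact (mem_stage_two h0).2 ⟨_, this, _, this, by ext <;> simp only [fractalScheme] <;> ring⟩
  · exact ⟨qrk, hqpar⟩

end SelfAssembly

theorem mainTheorem3 (c : ℕ) (V X : Set (ℤ × ℤ)) (hX : SelfAssembly.IsNiceFractal c V X) :
    ∃ (A : Type) (_ : Finite A) (𝒯 : SelfAssembly.GTAS A),
      𝒯.IsTAS ∧ 𝒯.temp = 2 ∧ 𝒯.seed.dom = {(0, 0)} ∧ 𝒯.Directed ∧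
        𝒯.StrictlyAssembles (SelfAssembly.fibered c V) := by
  obtain ⟨par, qpar, hG⟩ := hX.exists_proper
  obtain ⟨𝒯, h1, h2, h3, h4, h5⟩ := hG.blueprint.exists_system
  exact ⟨Unit, inferInstance, 𝒯, h1, h2, h3, h4, by rwa [SelfAssembly.dom_blueprint] at h5⟩
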